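/- Let $\Omega\subset\mathbb{RP}^2$ be a strictly convex domain (a bounded open convex subset of an affine chart whose closure is strictly convex), and let $\rho_0:\pi_1(S)\to SL(3,\mathbb R)$ be the holonomy representation of a strictly convex real projective structure $S=\Omega/\rho_0(\pi_1(S))$ on a closed oriented surface $S$ (necessarily of genus at least $2$). Let $\gamma$ be a simple closed curve on $S$ that is not null-homotopic, let $\lambda_1>\lambda_2>\lambda_3>0$ be the eigenvalues of $\rho_0(\gamma)$, with eigenvectors $v_1,v_2,v_3$, and let $\tilde\gamma$ be the axis of $\rho_0(\gamma)$, the part in $\Omega$ of the line through $[v_1]$ and $[v_3]$; its translates are the lifts of the geodesic representative of $\gamma$. For $s\in\mathbb R$ let $O_s\in SL(3,\mathbb R)$ be the matrix with $O_sv_1=e^{-s/3}v_1$, $O_sv_2=e^{2s/3}v_2$, $O_sv_3=e^{-s/3}v_3$. Let $K_1\ne K_2$ be the two connected components of $\Omega\setminus\bigcup_{h\in\pi_1(S)}\rho_0(h)\tilde\gamma$ that have $\tilde\gamma$ as a side (in either order), with stabilizers $\Gamma_1,\Gamma_2\subset\pi_1(S)$. The bulging deformation of $\rho_0$ along $\gamma$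 is the family of homomorphisms $\rho_s:\pi_1(S)\to SL(3,\mathbb R)$, $s\in\mathbb R$, such that $\rho_s(h)=\rho_0(h)$ for $h\in\Gamma_1$, $\rho_s(h)=O_s\rho_0(h)O_s^{-1}$ for $h\in\Gamma_2$, and $\rho_s(h)=O_s\rho_0(h)$ whenever $\rho_0(h)K_1=K_2$. (If $\gamma$ separates $S$, then $\pi_1(S)=\Gamma_1*_{\langle\gamma\rangle}\Gamma_2$ and the last case does not occur; otherwise $\pi_1(S)$ is the HNN extension of $\Gamma_1$ with stable letter any $h$ such that $\rho_0(h)K_1=K_2$.) The bulged domain is $$\Omega_s=\bigcup_{h\in\pi_1(S)}\rho_s(h)\bigl(K_1\cup\tilde\gamma\cup O_sK_2\bigr).$$ For a domain $\Omega'$ that is bounded and convex in an affine chart with Lebesgue measure $\mathrm{Vol}$, let $$\mu_{\Omega'}(A)=\int_A\frac{d\mathrm{Vol}(x)}{\mathrm{Vol}(B_x(1))},\qquad B_x(1)=\{v:\|v\|_x<1\},\qquad \|v\|_x=\tfrac12\Bigl(\tfrac1{|x-p^-|}+\tfrac1{|x-p^+|}\Bigr)|v|,$$ where $p^\pm$ are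 the points at which the line through $x$ with direction $v$ meets $\partial\Omega'$ (the Hilbert, or Busemann–Hausdorff, area measure). Let $\mathrm{Area}(\Omega_s/\rho_s(\pi_1(S)))$ be the $\mu_{\Omega_s}$-measure of a fundamental domain for the action of $\rho_s(\pi_1(S))$ on $\Omega_s$. Then $$\mathrm{Area}\bigl(\Omega_s/\rho_s(\pi_1(S))\bigr)\to\infty\qquad\text{as } s\to\infty .$$ -/

import Mathlib

open Set Filter Topology MeasureTheory
open scoped Pointwise MatrixGroups LinearAlgebra.Projectivization

noncomputable section

/-- The real projective plane. -/
abbrev RP2 : Type := ℙ ℝ (Fin 3 → ℝ)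

/-- The quotient topology of `ℝ³ ∖ {0}`. -/
instance RP2.instTopologicalSpace : TopologicalSpace RP2 :=
  TopologicalSpace.coinduced
    (fun v : {v : Fin 3 → ℝ // v ≠ 0} => (Projectivization.mk ℝ v.1 v.2 : RP2)) inferInstance

instance RP2.instMeasurableSpace : MeasurableSpace RP2 := borel RP2

instance RP2.instBorelSpace : BorelSpace RP2 := ⟨rfl⟩

theorem affineVector_ne_zero (x : EuclideanSpace ℝ (Fin 2)) :
    (![x 0, x 1, 1] : Fin 3 → ℝ) ≠ 0 := fun h => by
  have := congrFun h 2
  simp at this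

/-- The affine charts of the projective plane: `x ↦ M [x₀ : x₁ : 1]`. As `M` varies, the ranges
are all the affine planes in `ℝP²`, each with Euclidean coordinates. -/
def affineChart (M : SL(3, ℝ)) (x : EuclideanSpace ℝ (Fin 2)) : RP2 :=
  M • (Projectivization.mk ℝ ![x 0, x 1, 1] (affineVector_ne_zero x) : RP2)

/-! ### Hilbert geometry -/

/-- The point where the ray from `x ∈ U` in direction `v` leaves `U`. -/
def exitPoint (U : Set (EuclideanSpace ℝ (Fin 2))) (x v : EuclideanSpace ℝ (Fin 2)) :
    EuclideanSpace ℝ (Fin 2) :=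
  x + sSup {t : ℝ | 0 ≤ t ∧ segment ℝ x (x + t • v) ⊆ U} • v

/-- The Hilbert Finsler norm `‖v‖ₓ = ½ (1/|x - p⁻| + 1/|x - p⁺|) |v|`. -/
def finslerNorm (U : Set (EuclideanSpace ℝ (Fin 2))) (x v : EuclideanSpace ℝ (Fin 2)) : ℝ :=
  1 / 2 * (1 / dist x (exitPoint U x (-v)) + 1 / dist x (exitPoint U x v)) * ‖v‖

/-- The Busemann measure of a bounded domain `U` of the plane: the measure on `U` whose density
with respect to Lebesgue measure is `1 / Vol (Bₓ(1))`, with `Bₓ(1)` the unit ball of the Finsler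
norm at `x`. (The normalization of Lebesgue measure cancels.) -/
def finslerMeasure (U : Set (EuclideanSpace ℝ (Fin 2))) :
    Measure (EuclideanSpace ℝ (Fin 2)) :=
  (volume.restrict U).withDensity fun x => (volume {v | finslerNorm U x v < 1})⁻¹

open Classical in
/-- The Hilbert measure `μ_Ω` on `ℝP²`, supported on `Ω`: the Busemann measure computed in an
affine chart in which `Ω` is bounded (for convex `Ω` the choice of the chart does not matter). -/
def hilbertMeasure (Ω : Set RP2) : Measure RP2 :=
  if h : ∃ M : SL(3, ℝ), Ω ⊆ range (affineChart M) ∧ Bornology.IsBounded (affineChart M ⁻¹' Ω)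
  then Measure.map (affineChart h.choose) (finslerMeasure (affineChart h.choose ⁻¹' Ω))
  else 0

/-- The Hilbert area of the quotient `Ω / ρ(G)`: the `μ_Ω`-measure of a fundamental domain. -/
def hilbertArea {G : Type*} [Group G] (Ω : Set RP2) (ρ : G →* SL(3, ℝ)) : ENNReal :=
  covolume ρ.range RP2 (hilbertMeasure Ω)

/-! ### Strictly convex projective surfaces -/

/-- `Ω` is a strictly convex domain: it is a bounded open convex set in some affine chart, and its
closure there is strictly convex. -/
def IsStrictlyConvexDomain (Ω : Set RP2) : Prop :=
  ∃ M : SL(3, ℝ), Ω ⊆ range (affineChart M) ∧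
    (affineChart M ⁻¹' Ω).Nonempty ∧ IsOpen (affineChart M ⁻¹' Ω) ∧
    Bornology.IsBounded (affineChart M ⁻¹' Ω) ∧ Convex ℝ (affineChart M ⁻¹' Ω) ∧
    StrictConvex ℝ (closure (affineChart M ⁻¹' Ω))

/-- The cone of all nonzero vectors over `Ω`; for a strictly convex domain it has two connected
components, exchanged by `v ↦ -v`. -/
def coneOver (Ω : Set RP2) : Set (Fin 3 → ℝ) :=
  {v | ∃ hv : v ≠ 0, (Projectivization.mk ℝ v hv : RP2) ∈ Ω}

/-- `ρ` is the holonomy representation of a strictly convex real projective structure on a closed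
oriented surface `S = Ω / ρ(G)`, where `G = π₁(S)` is the group of deck transformations of the
universal cover `Ω → S`. The genus of `S` is automatically at least two, because the sphere and
the torus carry no strictly convex structure. -/
structure IsStrictlyConvexHolonomy {G : Type*} [Group G] (Ω : Set RP2) (ρ : G →* SL(3, ℝ)) :
    Prop where
  strictlyConvex : IsStrictlyConvexDomain Ω
  invariant : ∀ h : G, ρ h • Ω = Ω
  /-- Each `ρ h` preserves the orientation of `Ω`. As `det (ρ h) = 1`, this says that it preserves
  each of the two components of the cone over `Ω`. -/
  oriented : ∀ h : G, ∀ v ∈ coneOver Ω, JoinedIn (coneOver Ω) v (ρ h • v)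
  free : ∀ h : G, ∀ x ∈ Ω, ρ h • x = x → h = 1
  properlyDiscontinuous : ∀ K : Set RP2, K ⊆ Ω → IsCompact K →
    {h : G | ((ρ h • K) ∩ K).Nonempty}.Finite
  cocompact : ∃ K : Set RP2, K ⊆ Ω ∧ IsCompact K ∧ Ω ⊆ ⋃ h : G, ρ h • K

/-- `c` is a lift to `Ω` of a simple closed curve `ℝ/ℤ → S = Ω / ρ(G)`, and the corresponding
deck transformation is `g`: the closed curve represents the conjugacy class of `g`. -/
structure IsLiftOfSimpleClosedCurve {G : Type*} [Group G] (Ω : Set RP2) (ρ : G →* SL(3, ℝ))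
    (g : G) (c : ℝ → RP2) : Prop where
  continuous : Continuous c
  mem : ∀ t, c t ∈ Ω
  equivariant : ∀ t, c (t + 1) = ρ g • c t
  simple : ∀ (h : G) (t u : ℝ), ρ h • c t = c u → ∃ n : ℤ, u = t + n

/-! ### Bulging -/

/-- `A` is diagonalized, with eigenvalues `e^{t₁}, e^{t₂}, e^{t₃}`, `t₁ > t₂ > t₃`, by the columns
`v₊, v₀, v₋` of `P`; these represent the attracting, neutral and repelling fixed points of `A`. -/
def IsEigenframe (A P : SL(3, ℝ)) : Prop :=
  ∃ t₁ t₂ t₃ : ℝ, t₁ > t₂ ∧ t₂ > t₃ ∧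
    (A : Matrix (Fin 3) (Fin 3) ℝ) * P =
      P * Matrix.diagonal ![Real.exp t₁, Real.exp t₂, Real.exp t₃]

/-- The axis in `Ω` of a hyperbolic element with eigenframe `P`: the part in `Ω` of the projective
line through the attracting and the repelling fixed point (first and third column of `P`). -/
def axis (Ω : Set RP2) (P : SL(3, ℝ)) : Set RP2 :=
  {x ∈ Ω | x.submodule ≤ Submodule.span ℝ {fun i => P i 0, fun i => P i 2}}

/-- The union of all lifts of (the geodesic representative of) the curve. -/
def lifts {G : Type*} [Group G] (Ω : Set RP2) (ρ : G →* SL(3, ℝ)) (P : SL(3, ℝ)) : Set RP2 :=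
  ⋃ h : G, ρ h • axis Ω P

/-- `K` is a connected component of `Ω ∖ {lifts of γ}` having the axis as one of its sides. -/
def IsAdjacentPiece {G : Type*} [Group G] (Ω : Set RP2) (ρ : G →* SL(3, ℝ)) (P : SL(3, ℝ))
    (K : Set RP2) : Prop :=
  (∃ x ∈ Ω \ lifts Ω ρ P, K = connectedComponentIn (Ω \ lifts Ω ρ P) x) ∧
    axis Ω P ⊆ closure K

/-- `diag(e^{-s/3}, e^{2s/3}, e^{-s/3})`. -/
def bulgeDiagonal (s : ℝ) : SL(3, ℝ) :=
  ⟨Matrix.diagonal ![Real.exp (-s / 3), Real.exp (2 * s / 3), Real.exp (-s / 3)], by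
    rw [Matrix.det_diagonal, Fin.prod_univ_three]
    simp only [Matrix.cons_val_zero, Matrix.cons_val_one, Matrix.cons_val]
    rw [← Real.exp_add, ← Real.exp_add, ← Real.exp_zero]
    congr 1
    ring⟩

/-- The transformation `O_s`, which is `diag(e^{-s/3}, e^{2s/3}, e^{-s/3})` in the frame `P`. -/
def bulge (P : SL(3, ℝ)) (s : ℝ) : SL(3, ℝ) := P * bulgeDiagonal s * P⁻¹

/-- `ρ'` is the bulging deformation with parameter `s` of `ρ` along the curve with eigenframe `P`
and sides `K₁`, `K₂`. Let `G₁`, `G₂` be the stabilizers of `K₁` and `K₂`.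
* If the curve separates, then `G = G₁ *_⟨γ⟩ G₂`, no element of `G` maps `K₁` to `K₂`, and `ρ'` is
  `ρ` on `G₁` and `O_s ρ O_s⁻¹` on `G₂`.
* If it does not separate, then `G` is the HNN extension of `G₁` whose stable letter `γ₂` is any
  element mapping `K₁` to `K₂`, and `ρ'` is `ρ` on `G₁` and sends `γ₂` to `O_s ρ(γ₂)`; the
  condition on `G₂ = γ₂ G₁ γ₂⁻¹` then follows from the others. -/
structure IsBulging {G : Type*} [Group G] (ρ : G →* SL(3, ℝ)) (P : SL(3, ℝ)) (K₁ K₂ : Set RP2)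
    (s : ℝ) (ρ' : G →* SL(3, ℝ)) : Prop where
  left : ∀ h : G, ρ h • K₁ = K₁ → ρ' h = ρ h
  right : ∀ h : G, ρ h • K₂ = K₂ → ρ' h = bulge P s * ρ h * (bulge P s)⁻¹
  stable : ∀ h : G, ρ h • K₁ = K₂ → ρ' h = bulge P s * ρ h

/-- The bulged domain `Ω_s`: the union of the `ρ'`-translates of the unchanged piece `K₁`, the
axis, and the stretched piece `O_s K₂` on the other side of the axis. -/
def bulgedDomain {G : Type*} [Group G] (Ω : Set RP2) (P : SL(3, ℝ)) (K₁ K₂ : Set RP2)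
    (s : ℝ) (ρ' : G →* SL(3, ℝ)) : Set RP2 :=
  ⋃ h : G, ρ' h • (K₁ ∪ axis Ω P ∪ bulge P s • K₂)

end

noncomputable section

/-! ### Projective coordinates -/

/-! The argument takes place in ℝ³. Let `C` be one component of the cone over Ω. The walls are the
planes over the lifts of γ, and the pieces are the regions of `C` that they bound. In the eigenframe
of γ write x₀, x₁, x₂ for the coordinates, so that the axis is x₁ = 0 and K₂ is on the side x₁ > 0.

Divergence. All bulged domains lie in one triangle x₀ > 0, x₂ > 0, x₁ + A(x₀ + x₂) > 0, with A
independent of s (`WallSystem.exists_triangle`). The map O_s⁻¹ carries the Hilbert measure of Ω_s to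
that of O_s⁻¹Ω_s (`hilbertMeasure_smul`). It returns O_s K₂ to K₂, hence keeps in place a fixed half
square on the K₂ side of a point of the axis, while it squeezes the triangle to x₁ + A e^{-s}(x₀ +
x₂) > 0. At height y over the axis the domain now extends by at most y + A e^{-s} downwards, so a
Finsler unit ball there has area at most 16(y + A e^{-s}) (`finslerDensity_ge`). The half square
therefore has measure at least a constant times ∫₀^ε dy/(y + A e^{-s}), which tends to infinity
(`tendsto_lintegral_inv_add`).

Passage to the quotient. The half square lies in a set whose points are pairwise inequivalent under
ρ₀. Its developed image must then be inequivalent under ρ_s, which is injectivity of the developing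
map (`WallSystem.dev_injective`). Both injectivity and the fixed triangle come from ping-pong
(`WallSystem.dev_inTriangle`). Crossing a wall multiplies the developing map by a matrix that is
diagonal and positive in the frame of the wall, and such a matrix preserves the triangle beyond the
wall cut out by the supporting lines of Ω at its ends. These triangles are nested along a segment,
so everything beyond the first wall develops into the triangle beyond that wall. Nesting rests on
two facts: distinct walls do not meet in `C`, and they share no end
(`WallSystem.no_shared_endpoint`).

Convexity of Ω_s is never needed, because the Finsler norm is handled through exit times of rays
from open bounded sets. -/

instance specialLinearGroup_continuousConstSMul : ContinuousConstSMul SL(3, ℝ) (Fin 3 → ℝ) where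
  continuous_const_smul g :=
    Continuous.matrix_mulVec (continuous_const (y := (g : Matrix (Fin 3) (Fin 3) ℝ))) continuous_id

/-- The representative of `affineChart 1 x` with last coordinate `1`. -/
def affineVector (x : EuclideanSpace ℝ (Fin 2)) : Fin 3 → ℝ := ![x 0, x 1, 1]

/-- The direction vector at infinity corresponding to `v`. -/
def directionVector (v : EuclideanSpace ℝ (Fin 2)) : Fin 3 → ℝ := ![v 0, v 1, 0]

theorem affineVector_ne (x : EuclideanSpace ℝ (Fin 2)) : affineVector x ≠ 0 :=
  affineVector_ne_zero x

@[simp] theorem affineVector_two (x : EuclideanSpace ℝ (Fin 2)) : affineVector x 2 = 1 := rfl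

@[simp] theorem directionVector_two (x : EuclideanSpace ℝ (Fin 2)) : directionVector x 2 = 0 := rfl

theorem affineVector_add_smul (x v : EuclideanSpace ℝ (Fin 2)) (t : ℝ) :
    affineVector (x + t • v) = affineVector x + t • directionVector v := by
  ext i; fin_cases i <;> simp [affineVector, directionVector]

theorem affineVector_injective : Function.Injective affineVector := by
  intro x y h
  ext i
  have h0 := congrFun h 0
  have h1 := congrFun h 1
  fin_cases i
  · simpa [affineVector] using h0
  · simpa [affineVector] using h1

theorem directionVector_injective : Function.Injective directionVector := by
  intro x y h
  ext i
  have h0 := congrFun h 0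
  have h1 := congrFun h 1
  fin_cases i
  · simpa [directionVector] using h0
  · simpa [directionVector] using h1

theorem continuous_affineVector : Continuous affineVector := by
  refine continuous_pi fun i => ?_
  fin_cases i
  · exact EuclideanSpace.proj (𝕜 := ℝ) (0 : Fin 2) |>.continuous
  · exact EuclideanSpace.proj (𝕜 := ℝ) (1 : Fin 2) |>.continuous
  · exact continuous_const

/-- The point of the plane with homogeneous coordinates `w`. -/
def dehomogenize (w : Fin 3 → ℝ) : EuclideanSpace ℝ (Fin 2) := !₂[w 0 / w 2, w 1 / w 2]

theorem smul_affineVector_dehomogenize {w : Fin 3 → ℝ} (hw : w 2 ≠ 0) :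
    w 2 • affineVector (dehomogenize w) = w := by
  ext i; fin_cases i <;> simp [affineVector, dehomogenize] <;> field_simp

theorem affineVector_dehomogenize {w : Fin 3 → ℝ} (hw : w 2 ≠ 0) :
    affineVector (dehomogenize w) = (w 2)⁻¹ • w := by
  conv_rhs => rw [← smul_affineVector_dehomogenize hw]
  rw [smul_smul]; simp [hw, affineVector]

theorem smul_vec_ne_zero (g : SL(3, ℝ)) {v : Fin 3 → ℝ} (hv : v ≠ 0) : g • v ≠ 0 :=
  (smul_ne_zero_iff_ne g).mpr hv

theorem affineChart_eq (M : SL(3, ℝ)) (x : EuclideanSpace ℝ (Fin 2)) :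
    affineChart M x =
      Projectivization.mk ℝ (M • affineVector x) (smul_vec_ne_zero M (affineVector_ne x)) := rfl

theorem mk_eq_mk_iff_smul {v w : Fin 3 → ℝ} (hv : v ≠ 0) (hw : w ≠ 0) :
    (Projectivization.mk ℝ v hv : RP2) = Projectivization.mk ℝ w hw ↔
      ∃ c : ℝ, c ≠ 0 ∧ v = c • w := by
  rw [Projectivization.mk_eq_mk_iff']
  constructor
  · rintro ⟨c, rfl⟩
    exact ⟨c, fun h => hv (by simp [h]), rfl⟩
  · rintro ⟨c, -, rfl⟩
    exact ⟨c, rfl⟩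

theorem mk_eq_affineChart_iff (M : SL(3, ℝ)) {v : Fin 3 → ℝ} (hv : v ≠ 0)
    (x : EuclideanSpace ℝ (Fin 2)) :
    (Projectivization.mk ℝ v hv : RP2) = affineChart M x ↔
      (M⁻¹ • v) 2 ≠ 0 ∧ x = dehomogenize (M⁻¹ • v) := by
  rw [affineChart_eq, mk_eq_mk_iff_smul]
  constructor
  · rintro ⟨c, hc, h⟩
    have h' : M⁻¹ • v = c • affineVector x := by
      rw [h, ← smul_comm M c, inv_smul_smul]
    have h2 : (M⁻¹ • v) 2 = c := by rw [h']; simp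
    refine ⟨h2 ▸ hc, affineVector_injective ?_⟩
    rw [affineVector_dehomogenize (h2 ▸ hc), h2, h', smul_smul, inv_mul_cancel₀ hc, one_smul]
  · rintro ⟨h, rfl⟩
    refine ⟨_, h, ?_⟩
    rw [← smul_comm M, smul_affineVector_dehomogenize h, smul_inv_smul]

theorem affineChart_smul (g M : SL(3, ℝ)) (x : EuclideanSpace ℝ (Fin 2)) :
    affineChart (g * M) x = g • affineChart M x := mul_smul _ _ _

theorem isOpen_RP2_iff {s : Set RP2} :
    IsOpen s ↔ IsOpen {v : Fin 3 → ℝ | ∃ hv : v ≠ 0, (Projectivization.mk ℝ v hv : RP2) ∈ s} := by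
  rw [isOpen_coinduced]
  have h0 : IsOpen {v : Fin 3 → ℝ | v ≠ 0} := isOpen_ne
  rw [h0.isOpenEmbedding_subtypeVal.isOpen_iff_image_isOpen]
  constructor <;> intro h <;> convert h using 1 <;> ext v <;> simp

theorem continuous_mk_comp {X : Type*} [TopologicalSpace X] {f : X → Fin 3 → ℝ}
    (hf : Continuous f) (h0 : ∀ x, f x ≠ 0) :
    Continuous fun x => (Projectivization.mk ℝ (f x) (h0 x) : RP2) := by
  have : Continuous fun v : {v : Fin 3 → ℝ // v ≠ 0} => (Projectivization.mk ℝ v.1 v.2 : RP2) :=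
    continuous_coinduced_rng
  exact this.comp (hf.subtype_mk h0)

theorem continuous_affineChart (M : SL(3, ℝ)) : Continuous (affineChart M) := by
  have := continuous_mk_comp (continuous_affineVector.const_smul M)
    fun x => smul_vec_ne_zero M (affineVector_ne x)
  exact this

instance RP2.instContinuousConstSMul : ContinuousConstSMul SL(3, ℝ) RP2 where
  continuous_const_smul g := by
    refine continuous_coinduced_dom.2 ?_
    exact continuous_mk_comp (continuous_subtype_val.const_smul g)
      fun v => smul_vec_ne_zero g v.2

/-! ### Exit times and the Finsler norm -/

/-- The times up to which the ray from `x` in direction `v` stays in `U`. -/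
def rayTimes (U : Set (EuclideanSpace ℝ (Fin 2))) (x v : EuclideanSpace ℝ (Fin 2)) : Set ℝ :=
  {t : ℝ | 0 ≤ t ∧ segment ℝ x (x + t • v) ⊆ U}

theorem mem_segment_add_smul {x v z : EuclideanSpace ℝ (Fin 2)} {t : ℝ} (ht : 0 ≤ t) :
    z ∈ segment ℝ x (x + t • v) ↔ ∃ s, 0 ≤ s ∧ s ≤ t ∧ z = x + s • v := by
  rw [segment_eq_image']
  constructor
  · rintro ⟨θ, ⟨h0, h1⟩, rfl⟩
    exact ⟨θ * t, by positivity, mul_le_of_le_one_left ht h1, by simp [smul_smul]⟩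
  · rintro ⟨s, h0, h1, rfl⟩
    rcases ht.eq_or_lt with rfl | hlt
    · exact ⟨0, by simp, by simp [le_antisymm h1 h0]⟩
    · exact ⟨s / t, ⟨by positivity, by rw [div_le_one hlt]; exact h1⟩, by
        simp [smul_smul, div_mul_cancel₀ _ hlt.ne']⟩

theorem rayTimes_bddAbove {U : Set (EuclideanSpace ℝ (Fin 2))} (hU : Bornology.IsBounded U)
    (x : EuclideanSpace ℝ (Fin 2)) {v : EuclideanSpace ℝ (Fin 2)} (hv : v ≠ 0) :
    BddAbove (rayTimes U x v) := by
  obtain ⟨R, hR⟩ := hU.subset_closedBall x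
  refine ⟨R / ‖v‖, fun t ht => ?_⟩
  have h := hR (ht.2 (right_mem_segment ℝ _ _))
  rw [mem_closedBall_iff_norm, add_sub_cancel_left, norm_smul, Real.norm_of_nonneg ht.1] at h
  rwa [le_div_iff₀ (norm_pos_iff.2 hv)]

theorem exists_pos_mem_rayTimes {U : Set (EuclideanSpace ℝ (Fin 2))} (hU : IsOpen U)
    {x : EuclideanSpace ℝ (Fin 2)} (hx : x ∈ U) (v : EuclideanSpace ℝ (Fin 2)) :
    ∃ t ∈ rayTimes U x v, 0 < t := by
  obtain ⟨ε, hε, hb⟩ := Metric.isOpen_iff.1 hU x hx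
  refine ⟨ε / (2 * (‖v‖ + 1)), ⟨by positivity, ?_⟩, by positivity⟩
  refine Subset.trans ((convex_ball x ε).segment_subset (Metric.mem_ball_self hε) ?_) hb
  rw [mem_ball_iff_norm, add_sub_cancel_left, norm_smul, Real.norm_of_nonneg (by positivity)]
  rw [div_mul_eq_mul_div, div_lt_iff₀ (by positivity)]
  nlinarith [norm_nonneg v]

theorem sSup_rayTimes_pos {U : Set (EuclideanSpace ℝ (Fin 2))} (hU : IsOpen U)
    (hb : Bornology.IsBounded U) {x : EuclideanSpace ℝ (Fin 2)} (hx : x ∈ U)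
    {v : EuclideanSpace ℝ (Fin 2)} (hv : v ≠ 0) : 0 < sSup (rayTimes U x v) := by
  obtain ⟨t, ht, h0⟩ := exists_pos_mem_rayTimes hU hx v
  exact h0.trans_le (le_csSup (rayTimes_bddAbove hb x hv) ht)

/-- The Euclidean length of `v` cancels, so the norm is a function of the exit times of `v` and `-v`
alone. Projective invariance thereby reduces to a statement about one real parameter. -/
theorem finslerNorm_eq {U : Set (EuclideanSpace ℝ (Fin 2))}
    (x : EuclideanSpace ℝ (Fin 2)) {v : EuclideanSpace ℝ (Fin 2)} (hv : v ≠ 0) :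
    finslerNorm U x v = 1 / 2 * (1 / sSup (rayTimes U x (-v)) + 1 / sSup (rayTimes U x v)) := by
  have key : ∀ w : EuclideanSpace ℝ (Fin 2), dist x (exitPoint U x w) =
      sSup (rayTimes U x w) * ‖w‖ := by
    intro w
    have h0 : 0 ≤ sSup (rayTimes U x w) := Real.sSup_nonneg fun t ht => ht.1
    change dist x (x + sSup (rayTimes U x w) • w) = _
    rw [dist_self_add_right, norm_smul, Real.norm_of_nonneg h0]
  have hn : ‖v‖ ≠ 0 := norm_ne_zero_iff.2 hv
  rw [finslerNorm, key, key, norm_neg]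
  by_cases h1 : sSup (rayTimes U x (-v)) = 0 <;> by_cases h2 : sSup (rayTimes U x v) = 0 <;>
    simp [h1, h2] <;> field_simp

theorem finslerNorm_zero (U : Set (EuclideanSpace ℝ (Fin 2))) (x : EuclideanSpace ℝ (Fin 2)) :
    finslerNorm U x 0 = 0 := by simp [finslerNorm]

/-- Transfers a shift by `k` of inverse times from individual times to suprema. If the left side
minus `k` is not positive there is nothing to prove; otherwise its inverse bounds every time in `S`.
-/
theorem one_div_csSup_le {S T : Set ℝ} {k : ℝ} (hT : BddAbove T)
    (hS : ∃ t ∈ S, 0 < t) (hSb : BddAbove S)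
    (h : ∀ t ∈ S, 0 < t → ∃ τ ∈ T, 0 < τ ∧ 1 / τ = 1 / t + k) :
    1 / sSup T ≤ 1 / sSup S + k := by
  obtain ⟨t₀, ht₀, hpos⟩ := hS
  have hSpos : 0 < sSup S := hpos.trans_le (le_csSup hSb ht₀)
  have h1 : ∀ t ∈ S, 0 < t → 1 / sSup T - k ≤ 1 / t := by
    intro t ht h0
    obtain ⟨τ, hτ, hτ0, he⟩ := h t ht h0
    have : 1 / sSup T ≤ 1 / τ := one_div_le_one_div_of_le hτ0 (le_csSup hT hτ)
    linarith
  rcases le_or_gt (1 / sSup T - k) 0 with hle | hgt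
  · have : 0 < 1 / sSup S := by positivity
    linarith
  · have : sSup S ≤ 1 / (1 / sSup T - k) := by
      refine csSup_le ⟨t₀, ht₀⟩ fun t ht => ?_
      rcases le_or_gt t 0 with h0 | h0
      · exact h0.trans (by positivity)
      · rw [le_div_iff₀ hgt]
        have := h1 t ht h0
        rw [le_div_iff₀ h0] at this
        linarith
    rw [le_div_iff₀ hgt] at this
    have : 1 / sSup T - k ≤ 1 / sSup S := by
      rw [le_div_iff₀ hSpos]; linarith
    linarith

/-! ### Projective transformations of the plane -/

/-- The projective transformation with matrix `N` in affine coordinates. -/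
def projMap (N : SL(3, ℝ)) (x : EuclideanSpace ℝ (Fin 2)) : EuclideanSpace ℝ (Fin 2) :=
  dehomogenize (N • affineVector x)

/-- The denominator of `projMap N`. -/
def projDenom (N : SL(3, ℝ)) (x : EuclideanSpace ℝ (Fin 2)) : ℝ := (N • affineVector x) 2

theorem affineVector_projMap {N : SL(3, ℝ)} {x : EuclideanSpace ℝ (Fin 2)}
    (h : projDenom N x ≠ 0) :
    affineVector (projMap N x) = (projDenom N x)⁻¹ • N • affineVector x :=
  affineVector_dehomogenize h

theorem affineChart_projMap {M₁ M₂ : SL(3, ℝ)} {x : EuclideanSpace ℝ (Fin 2)}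
    (h : projDenom (M₂⁻¹ * M₁) x ≠ 0) :
    affineChart M₂ (projMap (M₂⁻¹ * M₁) x) = affineChart M₁ x := by
  have := (mk_eq_affineChart_iff M₂ (smul_vec_ne_zero M₁ (affineVector_ne x))
    (projMap (M₂⁻¹ * M₁) x)).2
    ⟨by rw [smul_smul]; exact h, by rw [smul_smul]; rfl⟩
  exact this.symm

theorem projDenom_ne_zero {M₁ M₂ : SL(3, ℝ)} {x : EuclideanSpace ℝ (Fin 2)}
    (h : affineChart M₁ x ∈ range (affineChart M₂)) : projDenom (M₂⁻¹ * M₁) x ≠ 0 := by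
  obtain ⟨y, hy⟩ := h
  have := (mk_eq_affineChart_iff M₂ (smul_vec_ne_zero M₁ (affineVector_ne x)) y).1 hy.symm
  rw [smul_smul] at this
  exact this.1

/-- The derivative of `projMap N` at `x`. -/
def projDeriv (N : SL(3, ℝ)) (x : EuclideanSpace ℝ (Fin 2)) :
    EuclideanSpace ℝ (Fin 2) →L[ℝ] EuclideanSpace ℝ (Fin 2) :=
  LinearMap.toContinuousLinearMap
  { toFun := fun v => !₂[
      ((N • directionVector v) 0 - projMap N x 0 * (N • directionVector v) 2) / projDenom N x,
      ((N • directionVector v) 1 - projMap N x 1 * (N • directionVector v) 2) / projDenom N x]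
    map_add' := by
      intro v w
      have : directionVector (v + w) = directionVector v + directionVector w := by
        ext i; fin_cases i <;> simp [directionVector]
      ext i; fin_cases i <;> simp [this, smul_add] <;> ring
    map_smul' := by
      intro c v
      have : directionVector (c • v) = c • directionVector v := by
        ext i; fin_cases i <;> simp [directionVector]
      ext i; fin_cases i <;> simp [this, smul_comm N c] <;> ring }

theorem directionVector_projDeriv {N : SL(3, ℝ)} {x : EuclideanSpace ℝ (Fin 2)}
    (h : projDenom N x ≠ 0) (v : EuclideanSpace ℝ (Fin 2)) :
    directionVector (projDeriv N x v) = (projDenom N x)⁻¹ •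
      (N • directionVector v - (N • directionVector v) 2 • affineVector (projMap N x)) := by
  change directionVector !₂[_, _] = _
  generalize N • directionVector v = w
  ext i
  fin_cases i <;> simp [directionVector, affineVector, Matrix.vecHead, Matrix.vecTail] <;>
    field_simp

theorem projDenom_add_smul (N : SL(3, ℝ)) (x v : EuclideanSpace ℝ (Fin 2)) (t : ℝ) :
    projDenom N (x + t • v) = projDenom N x + t * (N • directionVector v) 2 := by
  simp [projDenom, affineVector_add_smul, smul_add, smul_comm N t]

/-- On a line a projective map is the Möbius map t ↦ t/(1 + tκ), which in terms of 1/t is the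
translation by κ. Reversing `v` reverses the sign of κ, and this is what makes the Hilbert norm
invariant. -/
theorem projMap_add_smul {N : SL(3, ℝ)} {x : EuclideanSpace ℝ (Fin 2)}
    (h : projDenom N x ≠ 0) (v : EuclideanSpace ℝ (Fin 2)) {t : ℝ}
    (ht : 1 + t * ((N • directionVector v) 2 / projDenom N x) ≠ 0) :
    projMap N (x + t • v) = projMap N x +
      (t / (1 + t * ((N • directionVector v) 2 / projDenom N x))) • projDeriv N x v := by
  have hd : projDenom N (x + t • v) =
      projDenom N x * (1 + t * ((N • directionVector v) 2 / projDenom N x)) := by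
    rw [projDenom_add_smul]; field_simp
  have hd0 : projDenom N (x + t • v) ≠ 0 := by rw [hd]; exact mul_ne_zero h ht
  apply affineVector_injective
  rw [affineVector_add_smul, affineVector_projMap hd0, directionVector_projDeriv h,
    affineVector_projMap h, affineVector_add_smul, smul_add, smul_comm N t, hd]
  set q := (N • directionVector v) 2 with hq
  set d := projDenom N x
  have ht' : d + t * q ≠ 0 := by
    have := mul_ne_zero h ht
    rwa [mul_add, mul_one, mul_left_comm, mul_div_cancel₀ _ h] at this
  ext i
  simp only [Pi.smul_apply, Pi.add_apply, Pi.sub_apply, smul_eq_mul]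
  field_simp
  ring

theorem hasFDerivAt_projMap {N : SL(3, ℝ)} {x : EuclideanSpace ℝ (Fin 2)}
    (h : projDenom N x ≠ 0) : HasFDerivAt (projMap N) (projDeriv N x) x := by
  have hco : ∀ i : Fin 3, HasFDerivAt (fun y => (N • affineVector y) i)
      (LinearMap.toContinuousLinearMap
        { toFun := fun v => (N • directionVector v) i
          map_add' := by
            intro v w
            have : directionVector (v + w) = directionVector v + directionVector w := by
              ext i; fin_cases i <;> simp [directionVector]
            simp [this, smul_add]
          map_smul' := by
            intro c v
            have : directionVector (c • v) = c • directionVector v := by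
              ext i; fin_cases i <;> simp [directionVector]
            simp [this, smul_comm N c] } : EuclideanSpace ℝ (Fin 2) →L[ℝ] ℝ) x := by
    intro i
    set L : EuclideanSpace ℝ (Fin 2) →L[ℝ] ℝ := LinearMap.toContinuousLinearMap _ with hL
    have : (fun y => (N • affineVector y) i) = fun y => (N • affineVector x) i - L x + L y := by
      funext y
      have h1 : affineVector y = affineVector x + (1 : ℝ) • directionVector (y - x) := by
        rw [← affineVector_add_smul]; simp
      have h2 : (N • directionVector (y - x)) i = L (y - x) := rfl
      rw [h1, smul_add, one_smul, Pi.add_apply, h2, map_sub]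
      ring
    rw [this]
    exact (L.hasFDerivAt).const_add _
  rw [← hasFDerivWithinAt_univ, hasFDerivWithinAt_euclidean]
  have hdiv : ∀ i : Fin 3, HasFDerivAt (fun y => (N • affineVector y) i / (N • affineVector y) 2)
      _ x := fun i => ((hco i).mul ((hasDerivAt_inv h).comp_hasFDerivAt x (hco 2))).congr_of_eventuallyEq
        (Eventually.of_forall fun y => div_eq_mul_inv _ _)
  intro i
  fin_cases i
  · refine (hasFDerivWithinAt_univ.2 (hdiv 0)).congr_fderiv ?_
    ext v
    simp [projDeriv, projMap, dehomogenize, projDenom] at h ⊢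
    field_simp
    ring
  · refine (hasFDerivWithinAt_univ.2 (hdiv 1)).congr_fderiv ?_
    ext v
    simp [projDeriv, projMap, dehomogenize, projDenom] at h ⊢
    field_simp
    ring

theorem projDenom_inv {N : SL(3, ℝ)} {x : EuclideanSpace ℝ (Fin 2)} (h : projDenom N x ≠ 0) :
    projDenom N⁻¹ (projMap N x) = (projDenom N x)⁻¹ := by
  rw [projDenom, affineVector_projMap h, smul_comm, inv_smul_smul]
  simp

theorem projMap_inv {N : SL(3, ℝ)} {x : EuclideanSpace ℝ (Fin 2)} (h : projDenom N x ≠ 0) :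
    projMap N⁻¹ (projMap N x) = x := by
  have h' : projDenom N⁻¹ (projMap N x) ≠ 0 := by rw [projDenom_inv h]; exact inv_ne_zero h
  apply affineVector_injective
  rw [affineVector_projMap h', projDenom_inv h, affineVector_projMap h, smul_comm N⁻¹,
    inv_smul_smul, smul_smul, inv_inv, mul_inv_cancel₀ h, one_smul]

theorem projDeriv_inv {N : SL(3, ℝ)} {x : EuclideanSpace ℝ (Fin 2)} (h : projDenom N x ≠ 0)
    (v : EuclideanSpace ℝ (Fin 2)) :
    projDeriv N⁻¹ (projMap N x) (projDeriv N x v) = v := by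
  have h' : projDenom N⁻¹ (projMap N x) ≠ 0 := by rw [projDenom_inv h]; exact inv_ne_zero h
  apply directionVector_injective
  rw [directionVector_projDeriv h', projDenom_inv h, projMap_inv h, directionVector_projDeriv h,
    affineVector_projMap h]
  simp only [smul_comm N⁻¹, smul_sub, inv_smul_smul]
  ext i
  simp
  field_simp
  ring

theorem projDeriv_det_ne_zero {N : SL(3, ℝ)} {x : EuclideanSpace ℝ (Fin 2)}
    (h : projDenom N x ≠ 0) : (projDeriv N x).det ≠ 0 := by
  have h1 : (projDeriv N⁻¹ (projMap N x) : EuclideanSpace ℝ (Fin 2) →ₗ[ℝ] _) ∘ₗ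
      (projDeriv N x : EuclideanSpace ℝ (Fin 2) →ₗ[ℝ] _) = LinearMap.id :=
    LinearMap.ext fun v => projDeriv_inv h v
  have h2 := congrArg LinearMap.det h1
  rw [LinearMap.det_comp, LinearMap.det_id] at h2
  intro h0
  change LinearMap.det (projDeriv N x : EuclideanSpace ℝ (Fin 2) →ₗ[ℝ] _) = 0 at h0
  rw [h0, mul_zero] at h2
  exact zero_ne_one h2

/-- Along a ray, a projective transformation shifts the inverse exit time. -/
theorem one_div_exit_projMap_le {N : SL(3, ℝ)} {U₁ U₂ : Set (EuclideanSpace ℝ (Fin 2))}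
    (hd : ∀ x ∈ U₁, projDenom N x ≠ 0) (hm : ∀ x ∈ U₁, projMap N x ∈ U₂)
    (ho : IsOpen U₁) (hb₁ : Bornology.IsBounded U₁) (hb₂ : Bornology.IsBounded U₂)
    {x : EuclideanSpace ℝ (Fin 2)} (hx : x ∈ U₁) {v : EuclideanSpace ℝ (Fin 2)} (hv : v ≠ 0) :
    1 / sSup (rayTimes U₂ (projMap N x) (projDeriv N x v)) ≤
      1 / sSup (rayTimes U₁ x v) + (N • directionVector v) 2 / projDenom N x := by
  have hv' : projDeriv N x v ≠ 0 := fun h0 => hv (by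
    have := projDeriv_inv (hd x hx) v
    rw [h0, map_zero] at this
    exact this.symm)
  refine one_div_csSup_le (rayTimes_bddAbove hb₂ _ hv') (exists_pos_mem_rayTimes ho hx v)
    (rayTimes_bddAbove hb₁ x hv) fun t ht h0 => ?_
  set q := (N • directionVector v) 2 / projDenom N x with hq
  have hdx := hd x hx
  -- The factor 1 + s q is the denominator at x + s v divided by the denominator at x. It equals 1
  -- at s = 0 and has no zero on the segment, so it is positive at t.
  have hne : ∀ s, 0 ≤ s → s ≤ t → 1 + s * q ≠ 0 := by
    intro s hs0 hst h1
    refine hd _ (ht.2 ((mem_segment_add_smul ht.1).2 ⟨s, hs0, hst, rfl⟩)) ?_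
    rw [projDenom_add_smul]
    have : (N • directionVector v) 2 = q * projDenom N x := by rw [hq]; field_simp
    rw [this]
    linear_combination projDenom N x * h1
  have hpos : 0 < 1 + t * q := by
    by_contra hcon
    push Not at hcon
    have hq0 : q < 0 := by nlinarith
    refine hne (-1 / q) (div_nonneg_of_nonpos (by norm_num) hq0.le) ?_ ?_
    · rw [div_le_iff_of_neg hq0]; linarith
    · rw [div_mul_cancel₀ _ hq0.ne]; norm_num
  -- The image of the time t. A point of the image segment with time σ comes from the time σ/(1 - σ
  -- q), which lies between 0 and t.
  refine ⟨t / (1 + t * q), ⟨by positivity, ?_⟩, by positivity, by field_simp⟩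
  intro z hz
  obtain ⟨σ, hσ0, hσ, rfl⟩ := (mem_segment_add_smul (by positivity)).1 hz
  have h1 : 0 < 1 - σ * q := by
    rw [le_div_iff₀ hpos] at hσ
    rcases hσ0.eq_or_lt with rfl | hσ0
    · simp
    · have : 0 < t * (1 - σ * q) := by nlinarith
      exact pos_of_mul_pos_right this h0.le
  have hs : σ / (1 - σ * q) ≤ t := by
    rw [le_div_iff₀ hpos] at hσ
    rw [div_le_iff₀ h1]; linarith
  have hs0 : 0 ≤ σ / (1 - σ * q) := by positivity
  have h2 := projMap_add_smul hdx v (hne _ hs0 hs)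
  have h3 := hm _ (ht.2 ((mem_segment_add_smul ht.1).2 ⟨_, hs0, hs, rfl⟩))
  rw [h2] at h3
  convert h3 using 3
  rw [← hq]
  have : 1 + σ / (1 - σ * q) * q = 1 / (1 - σ * q) := by field_simp; ring
  rw [this]; field_simp

/-- The shifts of the inverse exit times of `v` and of `-v` are opposite and cancel in the sum. -/
theorem finslerNorm_projMap_le {N : SL(3, ℝ)} {U₁ U₂ : Set (EuclideanSpace ℝ (Fin 2))}
    (hd : ∀ x ∈ U₁, projDenom N x ≠ 0) (hm : ∀ x ∈ U₁, projMap N x ∈ U₂)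
    (ho : IsOpen U₁) (hb₁ : Bornology.IsBounded U₁) (hb₂ : Bornology.IsBounded U₂)
    {x : EuclideanSpace ℝ (Fin 2)} (hx : x ∈ U₁) (v : EuclideanSpace ℝ (Fin 2)) :
    finslerNorm U₂ (projMap N x) (projDeriv N x v) ≤ finslerNorm U₁ x v := by
  rcases eq_or_ne v 0 with rfl | hv
  · simp [finslerNorm_zero]
  have hv' : projDeriv N x v ≠ 0 := fun h0 => hv (by
    have := projDeriv_inv (hd x hx) v
    rw [h0, map_zero] at this
    exact this.symm)
  rw [finslerNorm_eq _ hv, finslerNorm_eq _ hv', ← map_neg]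
  have h1 := one_div_exit_projMap_le hd hm ho hb₁ hb₂ hx hv
  have h2 := one_div_exit_projMap_le hd hm ho hb₁ hb₂ hx (neg_ne_zero.2 hv)
  have h3 : (N • directionVector (-v)) 2 = -(N • directionVector v) 2 := by
    have : directionVector (-v) = -directionVector v := by
      ext i; fin_cases i <;> simp [directionVector]
    rw [this, smul_neg, Pi.neg_apply]
  rw [h3, neg_div] at h2
  linarith

end

noncomputable section

/-! ### Projective invariance of the Hilbert measure -/

/-- The norm inequality is applied to `N` and to its inverse. -/
theorem finslerBall_projMap {N : SL(3, ℝ)} {U₁ U₂ : Set (EuclideanSpace ℝ (Fin 2))}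
    (hd : ∀ x ∈ U₁, projDenom N x ≠ 0) (hm : ∀ x ∈ U₁, projMap N x ∈ U₂)
    (hd' : ∀ x ∈ U₂, projDenom N⁻¹ x ≠ 0) (hm' : ∀ x ∈ U₂, projMap N⁻¹ x ∈ U₁)
    (ho₁ : IsOpen U₁) (ho₂ : IsOpen U₂) (hb₁ : Bornology.IsBounded U₁)
    (hb₂ : Bornology.IsBounded U₂) {x : EuclideanSpace ℝ (Fin 2)} (hx : x ∈ U₁) :
    {v | finslerNorm U₂ (projMap N x) v < 1} = projDeriv N x '' {v | finslerNorm U₁ x v < 1} := by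
  ext w
  constructor
  · intro hw
    refine ⟨projDeriv N⁻¹ (projMap N x) w, ?_, ?_⟩
    · have := finslerNorm_projMap_le hd' hm' ho₂ hb₂ hb₁ (hm x hx) w
      rw [projMap_inv (hd x hx)] at this
      exact this.trans_lt hw
    · have := projDeriv_inv (hd' _ (hm x hx)) w
      rwa [inv_inv, projMap_inv (hd x hx)] at this
  · rintro ⟨v, hv, rfl⟩
    exact (finslerNorm_projMap_le hd hm ho₁ hb₁ hb₂ hx v).trans_lt hv

theorem finslerMeasure_apply {U A : Set (EuclideanSpace ℝ (Fin 2))} (hA : MeasurableSet A) :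
    finslerMeasure U A = ∫⁻ x in A ∩ U, (volume {v | finslerNorm U x v < 1})⁻¹ := by
  rw [finslerMeasure, withDensity_apply _ hA, Measure.restrict_restrict hA]

/-- In the change of variables the Jacobian determinant multiplies the Lebesgue element and also the
volume of the unit ball, so it cancels in the density. -/
theorem finslerMeasure_projMap {N : SL(3, ℝ)} {U₁ U₂ : Set (EuclideanSpace ℝ (Fin 2))}
    (hd : ∀ x ∈ U₁, projDenom N x ≠ 0) (hm : ∀ x ∈ U₁, projMap N x ∈ U₂)
    (hd' : ∀ x ∈ U₂, projDenom N⁻¹ x ≠ 0) (hm' : ∀ x ∈ U₂, projMap N⁻¹ x ∈ U₁)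
    (ho₁ : IsOpen U₁) (ho₂ : IsOpen U₂) (hb₁ : Bornology.IsBounded U₁)
    (hb₂ : Bornology.IsBounded U₂) {A₁ A₂ : Set (EuclideanSpace ℝ (Fin 2))}
    (hA₁ : MeasurableSet A₁) (hA₂ : MeasurableSet A₂)
    (hA : ∀ x ∈ U₁, projMap N x ∈ A₂ ↔ x ∈ A₁) :
    finslerMeasure U₂ A₂ = finslerMeasure U₁ A₁ := by
  have himage : A₂ ∩ U₂ = projMap N '' (A₁ ∩ U₁) := by
    ext y
    constructor
    · rintro ⟨hy, hyU⟩
      have h1 : projMap N (projMap N⁻¹ y) = y := by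
        have := projMap_inv (hd' y hyU)
        rwa [inv_inv] at this
      exact ⟨projMap N⁻¹ y, ⟨(hA _ (hm' y hyU)).1 (h1.symm ▸ hy), hm' y hyU⟩, h1⟩
    · rintro ⟨x, ⟨hx, hxU⟩, rfl⟩
      exact ⟨(hA x hxU).2 hx, hm x hxU⟩
  have hmeas : MeasurableSet (A₁ ∩ U₁) := hA₁.inter ho₁.measurableSet
  rw [finslerMeasure_apply hA₁, finslerMeasure_apply hA₂, himage,
    lintegral_image_eq_lintegral_abs_det_fderiv_mul volume hmeas
      (fun x hx => (hasFDerivAt_projMap (hd x hx.2)).hasFDerivWithinAt)]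
  · refine setLIntegral_congr_fun hmeas fun x hx => ?_
    have hdet := projDeriv_det_ne_zero (hd x hx.2)
    have h0 : ENNReal.ofReal |(projDeriv N x).det| ≠ 0 := by simpa using hdet
    rw [finslerBall_projMap hd hm hd' hm' ho₁ ho₂ hb₁ hb₂ hx.2,
      Measure.addHaar_image_continuousLinearMap,
      ENNReal.mul_inv (Or.inl h0) (Or.inl ENNReal.ofReal_ne_top), ← mul_assoc,
      ENNReal.mul_inv_cancel h0 ENNReal.ofReal_ne_top, one_mul]
  · intro x hx y hy hxy
    rw [← projMap_inv (hd x hx.2), hxy, projMap_inv (hd y hy.2)]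

/-- `Ω` is a bounded subset of the affine chart with frame `M`. -/
def IsBoundedInChart (Ω : Set RP2) (M : SL(3, ℝ)) : Prop :=
  Ω ⊆ range (affineChart M) ∧ Bornology.IsBounded (affineChart M ⁻¹' Ω)

/-- The definition of `hilbertMeasure` picks an arbitrary chart. Any two charts in which Ω is
bounded differ by a projective map, under which the Busemann measure is invariant, so any convenient
chart may be used. -/
theorem hilbertMeasure_eq_map {Ω : Set RP2} {M : SL(3, ℝ)} (hM : IsBoundedInChart Ω M)
    (ho : IsOpen Ω) :
    hilbertMeasure Ω =
      Measure.map (affineChart M) (finslerMeasure (affineChart M ⁻¹' Ω)) := by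
  have h : ∃ M : SL(3, ℝ), Ω ⊆ range (affineChart M) ∧
    Bornology.IsBounded (affineChart M ⁻¹' Ω) := ⟨M, hM⟩
  rw [hilbertMeasure, dif_pos h]
  have key : ∀ M' : SL(3, ℝ), IsBoundedInChart Ω M' →
      ∀ A : Set RP2, MeasurableSet A → finslerMeasure (affineChart M' ⁻¹' Ω) (affineChart M' ⁻¹' A)
        = finslerMeasure (affineChart M ⁻¹' Ω) (affineChart M ⁻¹' A) := by
    intro M' hM' A hA
    have hd : ∀ M M' : SL(3, ℝ), IsBoundedInChart Ω M' → ∀ x ∈ affineChart M ⁻¹' Ω,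
        projDenom (M'⁻¹ * M) x ≠ 0 := fun M M' hM' x hx => projDenom_ne_zero (hM'.1 hx)
    have hm : ∀ M M' : SL(3, ℝ), IsBoundedInChart Ω M' → ∀ x ∈ affineChart M ⁻¹' Ω,
        projMap (M'⁻¹ * M) x ∈ affineChart M' ⁻¹' Ω := fun M M' hM' x hx => by
      rw [mem_preimage, affineChart_projMap (hd M M' hM' x hx)]; exact hx
    have hinv : (M'⁻¹ * M)⁻¹ = M⁻¹ * M' := by rw [mul_inv_rev, inv_inv]
    refine finslerMeasure_projMap (N := M'⁻¹ * M) (hd M M' hM') (hm M M' hM')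
      (hinv ▸ hd M' M hM) (hinv ▸ hm M' M hM) (ho.preimage (continuous_affineChart M))
      (ho.preimage (continuous_affineChart M')) hM.2 hM'.2
      ((continuous_affineChart M).measurable hA) ((continuous_affineChart M').measurable hA)
      fun x hx => ?_
    rw [mem_preimage, mem_preimage, affineChart_projMap (hd M M' hM' x hx)]
  ext A hA
  rw [Measure.map_apply (continuous_affineChart _).measurable hA,
    Measure.map_apply (continuous_affineChart _).measurable hA]
  exact key _ h.choose_spec A hA

theorem IsBoundedInChart.smul {Ω : Set RP2} {M : SL(3, ℝ)} (hM : IsBoundedInChart Ω M)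
    (g : SL(3, ℝ)) : IsBoundedInChart (g • Ω) (g * M) ∧
      affineChart (g * M) ⁻¹' (g • Ω) = affineChart M ⁻¹' Ω := by
  have h : affineChart (g * M) ⁻¹' (g • Ω) = affineChart M ⁻¹' Ω := by
    ext x
    rw [mem_preimage, affineChart_smul, smul_mem_smul_set_iff, mem_preimage]
  refine ⟨⟨?_, h ▸ hM.2⟩, h⟩
  rintro _ ⟨y, hy, rfl⟩
  obtain ⟨x, rfl⟩ := hM.1 hy
  exact ⟨x, affineChart_smul g M x⟩

theorem hilbertMeasure_smul {Ω : Set RP2} {M : SL(3, ℝ)} (hM : IsBoundedInChart Ω M)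
    (ho : IsOpen Ω) (g : SL(3, ℝ)) {A : Set RP2} (hA : MeasurableSet A) :
    hilbertMeasure (g • Ω) A = hilbertMeasure Ω ((g • ·) ⁻¹' A) := by
  have h := hM.smul g
  have hA' : MeasurableSet ((g • ·) ⁻¹' A : Set RP2) :=
    (continuous_const_smul g).measurable hA
  rw [hilbertMeasure_eq_map hM ho, hilbertMeasure_eq_map h.1 (ho.smul g),
    Measure.map_apply (continuous_affineChart _).measurable hA,
    Measure.map_apply (continuous_affineChart _).measurable hA', h.2]
  congr 1
  ext x
  simp only [mem_preimage, affineChart_smul]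

/-! ### A lower bound for the Busemann measure of a thin domain -/

/-- One of the rays in directions `v` and `-v` descends towards the line z_i = -δ, and it leaves `U`
no later than it reaches that line. The corresponding inverse exit time alone gives the bound. -/
theorem le_two_mul_finslerNorm {U : Set (EuclideanSpace ℝ (Fin 2))} (ho : IsOpen U)
    (hb : Bornology.IsBounded U) (i : Fin 2) {δ : ℝ} (hpos : ∀ z ∈ U, 0 < z i + δ)
    {x : EuclideanSpace ℝ (Fin 2)} (hx : x ∈ U) (v : EuclideanSpace ℝ (Fin 2)) :
    |v i| ≤ 2 * (x i + δ) * finslerNorm U x v := by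
  rcases eq_or_ne v 0 with rfl | hv
  · simp [finslerNorm_zero]
  have hx0 := hpos x hx
  have key : ∀ w : EuclideanSpace ℝ (Fin 2), w ≠ 0 →
      -w i ≤ (x i + δ) * (1 / sSup (rayTimes U x w)) := by
    intro w hw
    have hs := sSup_rayTimes_pos ho hb hx hw
    rcases le_or_gt 0 (w i) with h0 | h0
    · have : 0 ≤ (x i + δ) * (1 / sSup (rayTimes U x w)) := by positivity
      linarith
    have hle : sSup (rayTimes U x w) ≤ (x i + δ) / (-w i) := by
      refine csSup_le ?_ fun t ht => ?_
      · obtain ⟨t, ht, -⟩ := exists_pos_mem_rayTimes ho hx w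
        exact ⟨t, ht⟩
      · have h1 := hpos _ (ht.2 (right_mem_segment ℝ _ _))
        rw [le_div_iff₀ (by linarith)]
        simp at h1
        nlinarith
    rw [le_div_iff₀ (by linarith)] at hle
    rw [mul_one_div, le_div_iff₀ hs]
    linarith
  have hp : 0 < 1 / sSup (rayTimes U x v) := by
    have := sSup_rayTimes_pos ho hb hx hv; positivity
  have hn : 0 < 1 / sSup (rayTimes U x (-v)) := by
    have := sSup_rayTimes_pos ho hb hx (neg_ne_zero.2 hv); positivity
  have h1 := key v hv
  have h2 := key (-v) (neg_ne_zero.2 hv)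
  rw [finslerNorm_eq x hv, abs_le]
  simp at h2
  rw [← one_div] at h2
  constructor <;> nlinarith [mul_pos hx0 hp, mul_pos hx0 hn]

theorem volume_box_le (a b : ℝ) :
    volume {v : EuclideanSpace ℝ (Fin 2) | |v 0| < a ∧ |v 1| < b} ≤
      ENNReal.ofReal (2 * a) * ENNReal.ofReal (2 * b) := by
  have h := (EuclideanSpace.volume_preserving_symm_measurableEquiv_toLp (Fin 2)).symm
  have hset : {v : EuclideanSpace ℝ (Fin 2) | |v 0| < a ∧ |v 1| < b} =
      (MeasurableEquiv.toLp 2 (Fin 2 → ℝ)).symm ⁻¹' (Set.pi univ ![Ioo (-a) a, Ioo (-b) b]) := by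
    ext v
    simp [Set.mem_pi, Fin.forall_fin_two, abs_lt]
  rw [hset, (EuclideanSpace.volume_preserving_symm_measurableEquiv_toLp (Fin 2)).measure_preimage_equiv,
    volume_pi_pi]
  simp only [Fin.prod_univ_two, Matrix.cons_val_zero, Matrix.cons_val_one, Real.volume_Ioo,
    sub_neg_eq_add, ← two_mul, le_refl]

/-- The unit ball is contained in a box with half sides 2 and 2(x₁ + δ), of area 16(x₁ + δ). The
first half side comes from 0 < z₀ < 1, the second from the line z₁ = -δ. -/
theorem finslerDensity_ge {U : Set (EuclideanSpace ℝ (Fin 2))} (ho : IsOpen U)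
    (hb : Bornology.IsBounded U) {δ : ℝ} (h0 : ∀ z ∈ U, 0 < z 0) (h1 : ∀ z ∈ U, z 0 < 1)
    (h2 : ∀ z ∈ U, 0 < z 1 + δ) {x : EuclideanSpace ℝ (Fin 2)} (hx : x ∈ U) :
    (ENNReal.ofReal (16 * (x 1 + δ)))⁻¹ ≤ (volume {v | finslerNorm U x v < 1})⁻¹ := by
  rw [ENNReal.inv_le_inv]
  have hsub : {v | finslerNorm U x v < 1} ⊆
      {v : EuclideanSpace ℝ (Fin 2) | |v 0| < 2 ∧ |v 1| < 2 * (x 1 + δ)} := by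
    intro v hv
    have a0 := le_two_mul_finslerNorm ho hb 0 (δ := 0) (by simpa using h0) hx v
    have a1 := le_two_mul_finslerNorm ho hb 1 h2 hx v
    have p0 := h0 x hx
    have p1 := h1 x hx
    have p2 := h2 x hx
    have hv' : finslerNorm U x v < 1 := hv
    constructor
    · nlinarith
    · nlinarith
  refine (measure_mono hsub).trans ((volume_box_le _ _).trans ?_)
  rw [← ENNReal.ofReal_mul (by norm_num)]
  refine ENNReal.ofReal_le_ofReal (by linarith)

/-- The integral is (log(ε + δ) - log δ)/16. This logarithm is the source of the infinite area. -/
theorem tendsto_lintegral_inv_add {ε : ℝ} (hε : 0 < ε) :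
    Tendsto (fun δ : ℝ => ∫⁻ y in Ioo 0 ε, (ENNReal.ofReal (16 * (y + δ)))⁻¹) (𝓝[>] 0) (𝓝 ⊤) := by
  have heq : ∀ δ ∈ Ioi (0 : ℝ), ENNReal.ofReal (1 / 16 * (Real.log (ε + δ) - Real.log δ)) =
      ∫⁻ y in Ioo 0 ε, (ENNReal.ofReal (16 * (y + δ)))⁻¹ := by
    intro δ hδ
    have hδ : 0 < δ := hδ
    have hint : IntervalIntegrable (fun y : ℝ => 1 / 16 * (1 / (y + δ))) volume 0 ε := by
      apply ContinuousOn.intervalIntegrable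
      rw [uIcc_of_le hε.le]
      refine continuousOn_const.mul (continuousOn_const.div (by fun_prop) fun y hy => ?_)
      have := hy.1
      positivity
    have h1 : ∫ y in (0 : ℝ)..ε, 1 / 16 * (1 / (y + δ)) =
        1 / 16 * (Real.log (ε + δ) - Real.log δ) := by
      rw [intervalIntegral.integral_const_mul,
        intervalIntegral.integral_comp_add_right (fun y => 1 / y), zero_add,
        integral_one_div_of_pos hδ (by positivity), Real.log_div (by positivity) hδ.ne']
    rw [← h1, intervalIntegral.integral_of_le hε.le,
      ofReal_integral_eq_lintegral_ofReal
        ((intervalIntegrable_iff_integrableOn_Ioc_of_le hε.le).1 hint),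
      ← restrict_Ioo_eq_restrict_Ioc]
    · refine setLIntegral_congr_fun measurableSet_Ioo fun y hy => ?_
      have : 0 < y + δ := add_pos hy.1 hδ
      rw [← ENNReal.ofReal_inv_of_pos (by positivity)]
      congr 1
      field_simp
    · filter_upwards [ae_restrict_mem measurableSet_Ioc] with y hy
      have : 0 < y + δ := add_pos hy.1 hδ
      simp only [Pi.zero_apply]
      positivity
  refine Tendsto.congr' (eventually_nhdsWithin_of_forall heq) ?_
  refine ENNReal.tendsto_ofReal_nhds_top.2 ?_
  refine Tendsto.const_mul_atTop (by norm_num) ?_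
  simp_rw [sub_eq_add_neg]
  refine Tendsto.add_atTop (C := Real.log ε) ?_ ?_
  · have : Tendsto (fun δ : ℝ => ε + δ) (𝓝[>] 0) (𝓝 ε) := by
      have : Tendsto (fun δ : ℝ => ε + δ) (𝓝 0) (𝓝 (ε + 0)) :=
        (continuous_const.add continuous_id).tendsto 0
      rw [add_zero] at this
      exact this.mono_left nhdsWithin_le_nhds
    exact (Real.continuousAt_log hε.ne').tendsto.comp this
  · exact tendsto_neg_atBot_atTop.comp Real.tendsto_log_nhdsGT_zero

/-- The open rectangle `|x₀ - a| < ε`, `0 < x₁ < ε`. -/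
def halfSquare (a ε : ℝ) : Set (EuclideanSpace ℝ (Fin 2)) :=
  {x | x 0 ∈ Ioo (a - ε) (a + ε) ∧ x 1 ∈ Ioo 0 ε}

theorem lintegral_halfSquare (a : ℝ) {ε : ℝ} (f : ℝ → ENNReal) (hf : Measurable f) :
    ∫⁻ x in halfSquare a ε, f (x 1) = ENNReal.ofReal (2 * ε) * ∫⁻ y in Ioo 0 ε, f y := by
  have h1 := EuclideanSpace.volume_preserving_symm_measurableEquiv_toLp (Fin 2)
  have h2 := (measurePreserving_finTwoArrow (volume : Measure ℝ))
  have h3 := h2.comp h1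
  have hset : halfSquare a ε = ((MeasurableEquiv.finTwoArrow : (Fin 2 → ℝ) ≃ᵐ ℝ × ℝ) ∘
      (MeasurableEquiv.toLp 2 (Fin 2 → ℝ)).symm) ⁻¹' (Ioo (a - ε) (a + ε) ×ˢ Ioo 0 ε) := by
    ext x
    simp [halfSquare, MeasurableEquiv.finTwoArrow]
  have hfun : ∀ x : EuclideanSpace ℝ (Fin 2), f (x 1) = (fun p : ℝ × ℝ => f p.2)
      (((MeasurableEquiv.finTwoArrow : (Fin 2 → ℝ) ≃ᵐ ℝ × ℝ) ∘
      (MeasurableEquiv.toLp 2 (Fin 2 → ℝ)).symm) x) := fun x => rfl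
  rw [lintegral_congr hfun, hset,
    h3.setLIntegral_comp_preimage (measurableSet_Ioo.prod measurableSet_Ioo)
    (f := fun p : ℝ × ℝ => f p.2) (by fun_prop), ← Measure.prod_restrict, lintegral_prod _ (by fun_prop)]
  simp only [lintegral_const, MeasurableSet.univ, Measure.restrict_apply, univ_inter,
    Real.volume_Ioo, add_sub_sub_cancel, ← two_mul]
  exact mul_comm _ _

theorem measurableSet_halfSquare (a ε : ℝ) : MeasurableSet (halfSquare a ε) := by
  have h0 : Measurable fun x : EuclideanSpace ℝ (Fin 2) => x 0 := by fun_prop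
  have h1 : Measurable fun x : EuclideanSpace ℝ (Fin 2) => x 1 := by fun_prop
  exact (h0 measurableSet_Ioo).inter (h1 measurableSet_Ioo)

theorem finslerMeasure_halfSquare_ge {U : Set (EuclideanSpace ℝ (Fin 2))} (ho : IsOpen U)
    (hb : Bornology.IsBounded U) {δ : ℝ} (h0 : ∀ z ∈ U, 0 < z 0) (h1 : ∀ z ∈ U, z 0 < 1)
    (h2 : ∀ z ∈ U, 0 < z 1 + δ) {a ε : ℝ} (hU : halfSquare a ε ⊆ U) :
    ENNReal.ofReal (2 * ε) * ∫⁻ y in Ioo 0 ε, (ENNReal.ofReal (16 * (y + δ)))⁻¹ ≤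
      finslerMeasure U (halfSquare a ε) := by
  rw [finslerMeasure_apply (measurableSet_halfSquare a ε), inter_eq_left.2 hU,
    ← lintegral_halfSquare a _ (by fun_prop)]
  exact setLIntegral_mono' (measurableSet_halfSquare a ε) fun x hx =>
    finslerDensity_ge ho hb h0 h1 h2 (hU hx)

end

noncomputable section

/-! ### Coordinates in a frame -/

/-- The `i`-th coordinate in the basis formed by the columns of `F`. -/
def coord (F : SL(3, ℝ)) (i : Fin 3) : (Fin 3 → ℝ) →ₗ[ℝ] ℝ :=
  LinearMap.proj i ∘ₗ Matrix.mulVecLin ((F⁻¹ : SL(3, ℝ)) : Matrix (Fin 3) (Fin 3) ℝ)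

/-- The `i`-th column of `F`. -/
def frameVec (F : SL(3, ℝ)) (i : Fin 3) : Fin 3 → ℝ := F • Pi.single i 1

theorem coord_apply (F : SL(3, ℝ)) (i : Fin 3) (v : Fin 3 → ℝ) : coord F i v = (F⁻¹ • v) i := rfl

theorem coord_mul (g F : SL(3, ℝ)) (i : Fin 3) (v : Fin 3 → ℝ) :
    coord (g * F) i v = coord F i (g⁻¹ • v) := by
  rw [coord_apply, coord_apply, smul_smul, mul_inv_rev]

theorem coord_mul_smul (g F : SL(3, ℝ)) (i : Fin 3) (v : Fin 3 → ℝ) :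
    coord (g * F) i (g • v) = coord F i v := by
  rw [coord_mul, inv_smul_smul]

theorem frameVec_mul (g F : SL(3, ℝ)) (i : Fin 3) : frameVec (g * F) i = g • frameVec F i :=
  mul_smul _ _ _

theorem coord_frameVec (F : SL(3, ℝ)) (i j : Fin 3) :
    coord F i (frameVec F j) = if i = j then 1 else 0 := by
  rw [coord_apply, frameVec, inv_smul_smul, Pi.single_apply]

@[simp] theorem coord_frameVec_self (F : SL(3, ℝ)) (i : Fin 3) : coord F i (frameVec F i) = 1 := by
  simp [coord_frameVec]

theorem coord_frameVec_ne (F : SL(3, ℝ)) {i j : Fin 3} (h : i ≠ j) :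
    coord F i (frameVec F j) = 0 := by simp [coord_frameVec, h]

theorem continuous_coord (F : SL(3, ℝ)) (i : Fin 3) : Continuous (coord F i) :=
  LinearMap.continuous_of_finiteDimensional _

theorem coord_ext (F : SL(3, ℝ)) {v w : Fin 3 → ℝ} (h : ∀ i, coord F i v = coord F i w) :
    v = w := by
  have : F⁻¹ • v = F⁻¹ • w := funext h
  exact smul_left_cancel _ this

theorem eq_sum_frameVec (F : SL(3, ℝ)) (v : Fin 3 → ℝ) :
    v = coord F 0 v • frameVec F 0 + coord F 1 v • frameVec F 1 + coord F 2 v • frameVec F 2 := by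
  apply coord_ext F
  intro i
  fin_cases i <;> simp [coord_frameVec]

theorem apply_eq_sum_coord (F : SL(3, ℝ)) (f : (Fin 3 → ℝ) →ₗ[ℝ] ℝ) (v : Fin 3 → ℝ) :
    f v = coord F 0 v * f (frameVec F 0) + coord F 1 v * f (frameVec F 1) +
      coord F 2 v * f (frameVec F 2) := by
  conv_lhs => rw [eq_sum_frameVec F v]
  simp

theorem frameVec_ne_zero (F : SL(3, ℝ)) (i : Fin 3) : frameVec F i ≠ 0 := fun h => by
  have := coord_frameVec_self F i
  rw [h, map_zero] at this
  exact zero_ne_one this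

theorem coord_bulge (F : SL(3, ℝ)) (s : ℝ) (i : Fin 3) (v : Fin 3 → ℝ) :
    coord F i (bulge F s • v) =
      ![Real.exp (-s / 3), Real.exp (2 * s / 3), Real.exp (-s / 3)] i * coord F i v := by
  have h : F⁻¹ • bulge F s • v = bulgeDiagonal s • F⁻¹ • v := by
    simp only [bulge, smul_smul]
    congr 1
    group
  rw [coord_apply, coord_apply, h]
  change (Matrix.diagonal _).mulVec _ i = _
  rw [Matrix.mulVec_diagonal]

theorem bulge_mul (g F : SL(3, ℝ)) (s : ℝ) : bulge (g * F) s = g * bulge F s * g⁻¹ := by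
  simp only [bulge]; group

theorem bulgeDiagonal_mul_neg (s : ℝ) : bulgeDiagonal s * bulgeDiagonal (-s) = 1 := by
  apply Subtype.ext
  change Matrix.diagonal _ * Matrix.diagonal _ = (1 : Matrix (Fin 3) (Fin 3) ℝ)
  rw [Matrix.diagonal_mul_diagonal, ← Matrix.diagonal_one]
  congr 1
  funext i
  fin_cases i <;> simp [← Real.exp_add] <;> ring

theorem bulge_inv (F : SL(3, ℝ)) (s : ℝ) : (bulge F s)⁻¹ = bulge F (-s) := by
  rw [inv_eq_iff_mul_eq_one]
  simp only [bulge]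
  calc F * bulgeDiagonal s * F⁻¹ * (F * bulgeDiagonal (-s) * F⁻¹)
      = F * (bulgeDiagonal s * bulgeDiagonal (-s)) * F⁻¹ := by group
    _ = 1 := by rw [bulgeDiagonal_mul_neg]; group

theorem exists_pos_coord_bulge (F : SL(3, ℝ)) (s : ℝ) (i : Fin 3) :
    ∃ k : ℝ, 0 < k ∧ ∀ v, coord F i (bulge F s • v) = k * coord F i v := by
  refine ⟨_, ?_, coord_bulge F s i⟩
  fin_cases i <;> exact Real.exp_pos _

/-- An affine function without zeros on an interval has the same sign at its ends. -/
theorem mul_pos_of_affine_ne_zero {p q a b : ℝ} (hab : a ≤ b)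
    (h : ∀ t, a ≤ t → t ≤ b → p + t * q ≠ 0) : 0 < (p + a * q) * (p + b * q) := by
  by_contra hcon
  push Not at hcon
  have ha := h a le_rfl hab
  have hb := h b hab le_rfl
  have hq : q ≠ 0 := by
    rintro rfl
    simp only [mul_zero, add_zero] at hcon ha
    exact absurd hcon (not_le.2 (mul_self_pos.2 ha))
  have key : (a + p / q) * (b + p / q) ≤ 0 := by
    have : (p + a * q) * (p + b * q) = q ^ 2 * ((a + p / q) * (b + p / q)) := by
      field_simp; ring
    rw [this] at hcon
    have hq2 : 0 < q ^ 2 := by positivity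
    nlinarith
  refine h (-(p / q)) ?_ ?_ (by field_simp; ring)
  · by_contra h1
    push Not at h1
    nlinarith
  · by_contra h1
    push Not at h1
    nlinarith

theorem pos_of_mul_pos_of_mul_pos {a b c : ℝ} (h1 : 0 < a * b) (h2 : 0 < a * c) : 0 < b * c := by
  have ha : a ≠ 0 := by rintro rfl; simp at h1
  have : 0 < a ^ 2 * (b * c) := by nlinarith [mul_pos h1 h2]
  exact pos_of_mul_pos_right this (sq_nonneg a)

theorem neg_of_mul_pos_of_mul_neg {a b c : ℝ} (h1 : 0 < a * b) (h2 : a * c < 0) : b * c < 0 := by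
  have := pos_of_mul_pos_of_mul_pos h1 (c := -c) (by linarith)
  linarith

/-! ### Wall systems -/

/-- A group acting on a strictly convex cone `C`, such that the translates of the plane spanned by
the first and third column of the frame `P` do not cross inside `C`. -/
structure WallSystem {G : Type*} [Group G] (C : Set (Fin 3 → ℝ)) (ρ : G →* SL(3, ℝ))
    (P : SL(3, ℝ)) : Prop where
  isOpen : IsOpen C
  convex : Convex ℝ C
  smul_mem : ∀ t : ℝ, 0 < t → ∀ v ∈ C, t • v ∈ C
  exists_pos : ∃ α : (Fin 3 → ℝ) →L[ℝ] ℝ, ∀ v ∈ closure C, v ≠ 0 → 0 < α v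
  add_mem : ∀ p ∈ closure C, ∀ q ∈ closure C, LinearIndependent ℝ ![p, q] → p + q ∈ C
  map_mem : ∀ h : G, ∀ v ∈ C, ρ h • v ∈ C
  coord_zero_pos : ∀ v ∈ C, 0 < coord P 0 v
  coord_two_pos : ∀ v ∈ C, 0 < coord P 2 v
  frameVec_zero_mem : frameVec P 0 ∈ closure C
  frameVec_two_mem : frameVec P 2 ∈ closure C
  free : ∀ h : G, ∀ v ∈ C, ∀ t : ℝ, 0 < t → ρ h • v = t • v → h = 1
  proper : ∀ S ⊆ C, IsCompact S →
    {h : G | ∃ v ∈ S, ∃ w ∈ S, ∃ t : ℝ, 0 < t ∧ ρ h • v = t • w}.Finite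
  noncrossing : ∀ h : G, ∀ a c : ℝ, 0 < a → 0 < c →
    coord (ρ h * P) 1 (a • frameVec P 0 + c • frameVec P 2) = 0 →
      coord (ρ h * P) 1 (frameVec P 0) = 0 ∧ coord (ρ h * P) 1 (frameVec P 2) = 0
  exists_axial : ∃ γ : G, ∃ t : Fin 3 → ℝ, t 1 < t 0 ∧ t 2 < t 1 ∧
    ∀ i v, coord P i (ρ γ • v) = Real.exp (t i) * coord P i v

namespace WallSystem

variable {G : Type*} [Group G] {C : Set (Fin 3 → ℝ)} {ρ : G →* SL(3, ℝ)} {P : SL(3, ℝ)}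

theorem map_mem_iff (W : WallSystem C ρ P) (h : G) {v : Fin 3 → ℝ} : ρ h • v ∈ C ↔ v ∈ C := by
  refine ⟨fun hv => ?_, W.map_mem h v⟩
  have := W.map_mem h⁻¹ _ hv
  rwa [map_inv, inv_smul_smul] at this

theorem map_mem_closure (W : WallSystem C ρ P) (h : G) {v : Fin 3 → ℝ} (hv : v ∈ closure C) :
    ρ h • v ∈ closure C :=
  _root_.map_mem_closure (continuous_const_smul (ρ h)) hv fun _ hx => W.map_mem h _ hx

theorem coord_wall_zero_pos (W : WallSystem C ρ P) (h : G) {v : Fin 3 → ℝ} (hv : v ∈ C) :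
    0 < coord (ρ h * P) 0 v := by
  rw [coord_mul, ← map_inv]; exact W.coord_zero_pos _ (W.map_mem _ _ hv)

theorem coord_wall_two_pos (W : WallSystem C ρ P) (h : G) {v : Fin 3 → ℝ} (hv : v ∈ C) :
    0 < coord (ρ h * P) 2 v := by
  rw [coord_mul, ← map_inv]; exact W.coord_two_pos _ (W.map_mem _ _ hv)

theorem nonneg_of_mem_closure {f : (Fin 3 → ℝ) →ₗ[ℝ] ℝ} (hf : ∀ v ∈ C, 0 ≤ f v) {v : Fin 3 → ℝ}
    (hv : v ∈ closure C) : 0 ≤ f v :=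
  closure_minimal (fun v hv => hf v hv)
    (isClosed_le continuous_const (LinearMap.continuous_of_finiteDimensional f)) hv

theorem coord_wall_zero_nonneg (W : WallSystem C ρ P) (h : G) {v : Fin 3 → ℝ}
    (hv : v ∈ closure C) : 0 ≤ coord (ρ h * P) 0 v :=
  nonneg_of_mem_closure (fun _ hv => (W.coord_wall_zero_pos h hv).le) hv

theorem coord_wall_two_nonneg (W : WallSystem C ρ P) (h : G) {v : Fin 3 → ℝ}
    (hv : v ∈ closure C) : 0 ≤ coord (ρ h * P) 2 v :=
  nonneg_of_mem_closure (fun _ hv => (W.coord_wall_two_pos h hv).le) hv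

theorem frameVec_wall_zero_mem (W : WallSystem C ρ P) (h : G) :
    frameVec (ρ h * P) 0 ∈ closure C := by
  rw [frameVec_mul]; exact W.map_mem_closure h W.frameVec_zero_mem

theorem frameVec_wall_two_mem (W : WallSystem C ρ P) (h : G) :
    frameVec (ρ h * P) 2 ∈ closure C := by
  rw [frameVec_mul]; exact W.map_mem_closure h W.frameVec_two_mem

theorem smul_mem_closure (W : WallSystem C ρ P) {t : ℝ} (ht : 0 < t) {v : Fin 3 → ℝ}
    (hv : v ∈ closure C) : t • v ∈ closure C :=
  closure_mono (image_subset_iff.2 (W.smul_mem t ht))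
    ((continuous_const_smul t).continuousWithinAt.mem_closure_image hv)

/-- A point of the axis. -/
def axisPt (P : SL(3, ℝ)) (a c : ℝ) : Fin 3 → ℝ := a • frameVec P 0 + c • frameVec P 2

theorem coord_axisPt (P : SL(3, ℝ)) (a c : ℝ) (i : Fin 3) :
    coord P i (axisPt P a c) = ![a, 0, c] i := by
  fin_cases i <;> simp [axisPt, coord_frameVec]

theorem axisPt_mem (W : WallSystem C ρ P) {a c : ℝ} (ha : 0 < a) (hc : 0 < c) :
    axisPt P a c ∈ C := by
  refine W.add_mem _ (W.smul_mem_closure ha W.frameVec_zero_mem) _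
    (W.smul_mem_closure hc W.frameVec_two_mem) ?_
  rw [LinearIndependent.pair_iff]
  intro s t hst
  have h0 := congrArg (coord P 0) hst
  have h2 := congrArg (coord P 2) hst
  simp [coord_frameVec, ha.ne', hc.ne'] at h0 h2
  exact ⟨h0, h2⟩

theorem eq_axisPt {v : Fin 3 → ℝ} (h : coord P 1 v = 0) :
    v = axisPt P (coord P 0 v) (coord P 2 v) := by
  conv_lhs => rw [eq_sum_frameVec P v, h]
  simp [axisPt]

/-- `h` preserves the axis, its ends and its sides. -/
def Aligned (ρ : G →* SL(3, ℝ)) (P : SL(3, ℝ)) (h : G) : Prop :=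
  ∀ i, ∃ k : ℝ, 0 < k ∧ ∀ v, coord (ρ h * P) i v = k * coord P i v

theorem coord_inv_mul (g h : G) (i : Fin 3) (v : Fin 3 → ℝ) :
    coord (ρ (g⁻¹ * h) * P) i v = coord (ρ h * P) i (ρ g • v) := by
  rw [map_mul, mul_assoc, coord_mul, map_inv, inv_inv]

theorem Aligned.coord_eq {g h : G} (hg : Aligned ρ P (g⁻¹ * h)) (i : Fin 3) :
    ∃ k : ℝ, 0 < k ∧ ∀ v, coord (ρ h * P) i v = k * coord (ρ g * P) i v := by
  obtain ⟨k, hk, hg⟩ := hg i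
  refine ⟨k, hk, fun v => ?_⟩
  have := hg ((ρ g)⁻¹ • v)
  rwa [coord_inv_mul, smul_inv_smul, ← coord_mul] at this

/-- The commutator of `g` with the axial element γ fixes a point of the axis, so it is trivial by
freeness. As `g` commutes with γ, whose eigenvalues are distinct, it also preserves the third
eigenline. The remaining eigenvalue is positive because the determinant is 1 and the other two
eigenvalues are positive. -/
theorem fixes_of_axial (W : WallSystem C ρ P) {g : G} {a c : ℝ} (ha : 0 < a) (hc : 0 < c)
    (h0 : ρ g • frameVec P 0 = a • frameVec P 0) (h2 : ρ g • frameVec P 2 = c • frameVec P 2) :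
    Aligned ρ P g⁻¹ := by
  obtain ⟨γ, t, ht0, ht1, hγ⟩ := W.exists_axial
  have hγv : ∀ i, ρ γ • frameVec P i = Real.exp (t i) • frameVec P i := by
    intro i
    refine coord_ext P fun j => ?_
    rw [hγ, map_smul, coord_frameVec]
    split_ifs with h
    · simp [h]
    · simp
  have hcomm : g * γ * (γ * g)⁻¹ = 1 := by
    have hk : ∀ i, ∀ k : ℝ, k ≠ 0 → ρ g • frameVec P i = k • frameVec P i →
        ρ (g * γ * (γ * g)⁻¹) • frameVec P i = frameVec P i := by
      intro i k hk hgi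
      have h1 : ρ (γ * g) • frameVec P i = ρ (g * γ) • frameVec P i := by
        rw [map_mul, map_mul, mul_smul, mul_smul, hgi, hγv, smul_comm (ρ γ), hγv,
          smul_comm (ρ g), hgi, smul_comm]
      rw [map_mul, map_inv, mul_smul, ← eq_inv_smul_iff, ← map_inv]
      have h2 : (ρ (γ * g))⁻¹ • frameVec P i = (ρ (g * γ))⁻¹ • frameVec P i := by
        have : ρ (γ * g) • frameVec P i = (k * Real.exp (t i)) • frameVec P i := by
          rw [map_mul, mul_smul, hgi, smul_comm (ρ γ), hγv, smul_smul]
        have hne : k * Real.exp (t i) ≠ 0 := mul_ne_zero hk (Real.exp_pos _).ne'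
        have e1 : (ρ (γ * g))⁻¹ • frameVec P i = (k * Real.exp (t i))⁻¹ • frameVec P i := by
          rw [inv_smul_eq_iff, smul_comm, this, smul_smul, inv_mul_cancel₀ hne, one_smul]
        have e2 : (ρ (g * γ))⁻¹ • frameVec P i = (k * Real.exp (t i))⁻¹ • frameVec P i := by
          rw [inv_smul_eq_iff, smul_comm, ← h1, this, smul_smul, inv_mul_cancel₀ hne, one_smul]
        rw [e1, e2]
      rw [map_inv]; exact h2
    refine W.free _ (axisPt P 1 1) (W.axisPt_mem one_pos one_pos) 1 one_pos ?_
    rw [one_smul, axisPt, one_smul, one_smul, smul_add, hk 0 a ha.ne' h0, hk 2 c hc.ne' h2]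
  have hcomm' : g * γ = γ * g := by rwa [mul_inv_eq_one] at hcomm
  set b := coord P 1 (ρ g • frameVec P 1) with hb
  have h1 : ρ g • frameVec P 1 = b • frameVec P 1 := by
    have key : ∀ i, Real.exp (t i) * coord P i (ρ g • frameVec P 1) =
        Real.exp (t 1) * coord P i (ρ g • frameVec P 1) := by
      intro i
      rw [← hγ, ← mul_smul, ← map_mul, ← hcomm', map_mul, mul_smul, hγv, smul_comm (ρ g), map_smul,
        smul_eq_mul]
    have hz : ∀ i, t i ≠ t 1 → coord P i (ρ g • frameVec P 1) = 0 := by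
      intro i hi
      have := key i
      rw [mul_eq_mul_right_iff, Real.exp_eq_exp] at this
      exact this.resolve_left hi
    refine coord_ext P fun i => ?_
    fin_cases i
    · simpa [coord_frameVec] using hz 0 ht0.ne'
    · simp [hb]
    · simpa [coord_frameVec] using hz 2 ht1.ne
  have hdet : a * b * c = 1 := by
    have hm : ((P⁻¹ * ρ g * P : SL(3, ℝ)) : Matrix (Fin 3) (Fin 3) ℝ) =
        Matrix.diagonal ![a, b, c] := by
      have hcol : ∀ j, (P⁻¹ * ρ g * P) • (Pi.single j (1 : ℝ) : Fin 3 → ℝ) =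
          (![a, b, c] j) • (Pi.single j (1 : ℝ) : Fin 3 → ℝ) := by
        intro j
        rw [mul_smul, mul_smul, inv_smul_eq_iff, smul_comm P]
        fin_cases j
        · exact h0
        · exact h1
        · exact h2
      ext i j
      have := congrFun (hcol j) i
      change Matrix.mulVec _ _ i = _ at this
      rw [Matrix.mulVec_single_one] at this
      change _ = _ at this
      rw [Matrix.diagonal_apply]
      simp only [Matrix.col_apply, Pi.smul_apply, smul_eq_mul, Pi.single_apply] at this
      rw [this]
      split_ifs with h
      · rw [h]; simp
      · simp
    have := (P⁻¹ * ρ g * P).2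
    rw [hm, Matrix.det_diagonal, Fin.prod_univ_three] at this
    simpa using this
  have hbpos : 0 < b := by
    have : 0 < (a * c) * b := by nlinarith
    exact pos_of_mul_pos_right this (by positivity)
  have hdiag : ∀ v i, coord P i (ρ g • v) = ![a, b, c] i * coord P i v := by
    intro v i
    conv_lhs => rw [eq_sum_frameVec P v]
    simp only [smul_add]
    rw [smul_comm (ρ g), smul_comm (ρ g), smul_comm (ρ g), h0, h1, h2]
    fin_cases i <;> simp [coord_frameVec] <;> ring
  intro i
  refine ⟨![a, b, c] i, ?_, fun v => ?_⟩
  · fin_cases i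
    · exact ha
    · exact hbpos
    · exact hc
  · rw [coord_mul, map_inv, inv_inv]; exact hdiag v i

end WallSystem
end

/-! ### Noncrossing walls, their local finiteness and their ends -/

noncomputable section
namespace WallSystem

variable {G : Type*} [Group G] {C : Set (Fin 3 → ℝ)} {ρ : G →* SL(3, ℝ)} {P : SL(3, ℝ)}

theorem frameVec_notMem (W : WallSystem C ρ P) {i : Fin 3} : frameVec P i ∉ C := fun h => by
  have h0 := W.coord_zero_pos _ h
  have h2 := W.coord_two_pos _ h
  fin_cases i <;> simp [coord_frameVec] at h0 h2

/-- The image lies in the closed cone and in the plane of the axis, so its two coordinates there are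
nonnegative. If both were positive it would be in `C`, but an end of the axis is not. -/
theorem axis_ray_cases (W : WallSystem C ρ P) (g : G) {i : Fin 3}
    (hi : frameVec P i ∈ closure C) (h : coord P 1 (ρ g • frameVec P i) = 0) :
    (∃ a : ℝ, 0 < a ∧ ρ g • frameVec P i = a • frameVec P 0) ∨
      ∃ c : ℝ, 0 < c ∧ ρ g • frameVec P i = c • frameVec P 2 := by
  have heq := eq_axisPt h
  have hcl := W.map_mem_closure g hi
  have h0 : 0 ≤ coord P 0 (ρ g • frameVec P i) :=
    nonneg_of_mem_closure (fun _ hv => (W.coord_zero_pos _ hv).le) hcl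
  have h2 : 0 ≤ coord P 2 (ρ g • frameVec P i) :=
    nonneg_of_mem_closure (fun _ hv => (W.coord_two_pos _ hv).le) hcl
  rcases h0.eq_or_lt with h0 | h0 <;> rcases h2.eq_or_lt with h2 | h2
  · rw [← h0, ← h2] at heq
    simp only [axisPt, zero_smul, add_zero] at heq
    exact absurd heq (smul_vec_ne_zero _ (frameVec_ne_zero P i))
  · rw [← h0] at heq
    exact Or.inr ⟨_, h2, by simpa [axisPt] using heq⟩
  · rw [← h2] at heq
    exact Or.inl ⟨_, h0, by simpa [axisPt] using heq⟩
  · have hm := W.axisPt_mem h0 h2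
    rw [← heq] at hm
    exact absurd ((W.map_mem_iff g).1 hm) W.frameVec_notMem

/-- By noncrossing both ends of the axis lie on the wall, so `h⁻¹` permutes the two ends. It cannot
exchange them, since it would then fix a point of the axis, against freeness. -/
theorem aligned_of_axisPt (W : WallSystem C ρ P) {h : G} {a c : ℝ} (ha : 0 < a) (hc : 0 < c)
    (hz : coord (ρ h * P) 1 (axisPt P a c) = 0) : Aligned ρ P h := by
  obtain ⟨hz0, hz2⟩ := W.noncrossing h a c ha hc hz
  rw [coord_mul, ← map_inv] at hz0 hz2
  rcases W.axis_ray_cases _ W.frameVec_zero_mem hz0 with ⟨p, hp, h0⟩ | ⟨p, hp, h0⟩ <;>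
    rcases W.axis_ray_cases _ W.frameVec_two_mem hz2 with ⟨q, hq, h2⟩ | ⟨q, hq, h2⟩
  · exfalso
    have h3 : ρ h⁻¹ • (q • frameVec P 0) = ρ h⁻¹ • (p • frameVec P 2) := by
      rw [smul_comm, h0, smul_comm (ρ h⁻¹), h2, smul_comm]
    have := congrArg (coord P 0) (smul_left_cancel _ h3)
    simp [coord_frameVec, hq.ne'] at this
  · have := W.fixes_of_axial hp hq h0 h2
    rwa [inv_inv] at this
  · exfalso
    have hg : h⁻¹ = 1 := by
      -- If the ends are exchanged with factors p and q, the fixed direction is √q v₀ + √p v₂, with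
      -- eigenvalue √(pq).
      refine W.free _ (axisPt P (Real.sqrt q) (Real.sqrt p))
        (W.axisPt_mem (Real.sqrt_pos.2 hq) (Real.sqrt_pos.2 hp)) (Real.sqrt p * Real.sqrt q)
        (by positivity) ?_
      rw [axisPt, smul_add, smul_comm (ρ h⁻¹), h0, smul_comm (ρ h⁻¹), h2]
      refine coord_ext P fun i => ?_
      have hp' := Real.mul_self_sqrt hp.le
      have hq' := Real.mul_self_sqrt hq.le
      fin_cases i
      · simp [coord_frameVec]
        linear_combination (-Real.sqrt p) * hq'
      · simp [coord_frameVec]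
      · simp [coord_frameVec]
        linear_combination (-Real.sqrt q) * hp'
    rw [hg, map_one, one_smul] at h0
    have := congrArg (coord P 0) h0
    simp [coord_frameVec] at this
  · exfalso
    have h3 : ρ h⁻¹ • (q • frameVec P 0) = ρ h⁻¹ • (p • frameVec P 2) := by
      rw [smul_comm, h0, smul_comm (ρ h⁻¹), h2, smul_comm]
    have := congrArg (coord P 0) (smul_left_cancel _ h3)
    simp [coord_frameVec, hq.ne'] at this

/-- Two walls that meet inside `C` are equal. -/
theorem aligned_of_mem (W : WallSystem C ρ P) {g h : G} {v : Fin 3 → ℝ} (hv : v ∈ C)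
    (hg : coord (ρ g * P) 1 v = 0) (hh : coord (ρ h * P) 1 v = 0) : Aligned ρ P (g⁻¹ * h) := by
  rw [coord_mul] at hg
  have heq := eq_axisPt hg
  have hm : (ρ g)⁻¹ • v ∈ C := by rw [← map_inv]; exact W.map_mem _ _ hv
  refine W.aligned_of_axisPt (W.coord_zero_pos _ hm) (W.coord_two_pos _ hm) ?_
  rw [← heq, coord_inv_mul, smul_inv_smul]; exact hh

theorem not_aligned_of_ne {g h : G} {v : Fin 3 → ℝ}
    (hg : coord (ρ g * P) 1 v = 0) (hh : coord (ρ h * P) 1 v ≠ 0) : ¬ Aligned ρ P (g⁻¹ * h) := by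
  intro ha
  obtain ⟨k, -, hk⟩ := ha.coord_eq 1
  exact hh (by rw [hk, hg, mul_zero])

theorem coord_zpow {γ : G} {t : Fin 3 → ℝ}
    (hγ : ∀ i v, coord P i (ρ γ • v) = Real.exp (t i) * coord P i v) (n : ℤ) (i : Fin 3)
    (v : Fin 3 → ℝ) : coord P i (ρ (γ ^ n) • v) = Real.exp (t i) ^ n * coord P i v := by
  have hnat : ∀ n : ℕ, ∀ i v, coord P i (ρ (γ ^ n) • v) = Real.exp (t i) ^ n * coord P i v := by
    intro n
    induction n with
    | zero => simp
    | succ n ih =>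
      intro i v
      rw [pow_succ', map_mul, mul_smul, hγ, ih, ← mul_assoc, ← pow_succ']
  obtain ⟨m, rfl | rfl⟩ := n.eq_nat_or_neg
  · simpa using hnat m i v
  · have := hnat m i (ρ (γ ^ (-(m : ℤ))) • v)
    rw [zpow_neg, zpow_natCast, map_inv, smul_inv_smul] at this
    rw [zpow_neg, zpow_natCast, map_inv, this, ← mul_assoc, zpow_neg, zpow_natCast,
      inv_mul_cancel₀ (pow_ne_zero _ (Real.exp_pos _).ne'), one_mul]

/-- Every point of the axis is moved by a power of the axial element into a fixed segment. -/
theorem exists_aligned_mem_segment (W : WallSystem C ρ P) :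
    ∃ R : ℝ, ∀ v ∈ C, coord P 1 v = 0 → ∃ k : G, Aligned ρ P k ∧ ∃ r ∈ Icc 1 R, ∃ c : ℝ, 0 < c ∧
      ρ k • v = c • axisPt P r 1 := by
  obtain ⟨γ, t, ht0, ht1, hγ⟩ := W.exists_axial
  -- The axial element multiplies the ratio of the two coordinates on the axis by this number, which
  -- exceeds 1. Some power of it therefore brings the ratio into the interval from 1 to this number.
  refine ⟨Real.exp (t 0 - t 2), fun v hv hz => ?_⟩
  have h0 := W.coord_zero_pos _ hv
  have h2 := W.coord_two_pos _ hv
  have hlt : 1 < Real.exp (t 0 - t 2) := by rw [Real.one_lt_exp_iff]; linarith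
  obtain ⟨n, hn⟩ := exists_mem_Ico_zpow (x := coord P 0 v / coord P 2 v) (by positivity) hlt
  have hw0 : coord P 0 (ρ (γ ^ (-n)) • v) = Real.exp (t 0) ^ (-n) * coord P 0 v := coord_zpow hγ _ _ _
  have hw2 : coord P 2 (ρ (γ ^ (-n)) • v) = Real.exp (t 2) ^ (-n) * coord P 2 v := coord_zpow hγ _ _ _
  have hw1 : coord P 1 (ρ (γ ^ (-n)) • v) = 0 := by rw [coord_zpow hγ, hz, mul_zero]
  have hk : Aligned ρ P (γ ^ (-n)) := by
    intro i
    refine ⟨Real.exp (t i) ^ n, by positivity, fun v => ?_⟩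
    rw [coord_mul, ← map_inv, ← zpow_neg, neg_neg, coord_zpow hγ]
  generalize γ ^ (-n) = k at hw0 hw1 hw2 hk
  have hw0p : 0 < coord P 0 (ρ k • v) := by rw [hw0]; positivity
  have hw2p : 0 < coord P 2 (ρ k • v) := by rw [hw2]; positivity
  have hratio : coord P 0 (ρ k • v) / coord P 2 (ρ k • v) = (Real.exp (t 0 - t 2) ^ n)⁻¹ *
      (coord P 0 v / coord P 2 v) := by
    rw [hw0, hw2, Real.exp_sub, div_zpow, zpow_neg, zpow_neg, inv_div, mul_div_mul_comm,
      inv_div_inv]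
  have hpos : 0 < Real.exp (t 0 - t 2) ^ n := by positivity
  refine ⟨k, hk, coord P 0 (ρ k • v) / coord P 2 (ρ k • v), ?_, _, hw2p, ?_⟩
  · rw [hratio, ← div_eq_inv_mul]
    constructor
    · rw [le_div_iff₀ hpos, one_mul]; exact hn.1
    · rw [div_le_iff₀ hpos, ← zpow_one_add₀ (Real.exp_pos _).ne', add_comm]; exact hn.2.le
  · refine coord_ext P fun i => ?_
    refine Eq.trans ?_ ((coord P i).map_smul _ _).symm
    rw [coord_axisPt]
    fin_cases i
    · exact (mul_div_cancel₀ _ hw2p.ne').symm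
    · exact hw1.trans (mul_zero _).symm
    · exact (mul_one _).symm

/-- Only finitely many walls meet a compact part of the cone. -/
theorem finite_walls (W : WallSystem C ρ P) {S : Set (Fin 3 → ℝ)} (hS : S ⊆ C)
    (hc : IsCompact S) :
    ∃ F : Set G, F.Finite ∧ ∀ h, (∃ v ∈ S, coord (ρ h * P) 1 v = 0) →
      ∃ h' ∈ F, Aligned ρ P (h'⁻¹ * h) := by
  obtain ⟨R, hR⟩ := W.exists_aligned_mem_segment
  have hIc : IsCompact ((fun r => axisPt P r 1) '' Icc 1 R) := by
    refine isCompact_Icc.image ?_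
    unfold axisPt
    fun_prop
  have hIC : ((fun r => axisPt P r 1) '' Icc 1 R) ⊆ C := by
    rintro _ ⟨r, hr, rfl⟩
    exact W.axisPt_mem (by linarith [hr.1]) one_pos
  have hfin := W.proper _ (union_subset hS hIC) (hc.union hIc)
  -- A wall `h` that meets `S` is pulled back to the axis by `h⁻¹`, and then a power `k` of the
  -- axial element moves the meeting point into the fixed segment. Thus `k * h⁻¹` moves a point of
  -- `S` to the segment, and proper discontinuity on their union leaves finitely many such elements.
  refine ⟨_, hfin.image (·⁻¹), fun h hh => ?_⟩
  obtain ⟨v, hv, hz⟩ := hh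
  rw [coord_mul, ← map_inv] at hz
  obtain ⟨k, hk, r, hr, c, hc, he⟩ := hR _ (W.map_mem h⁻¹ v (hS hv)) hz
  refine ⟨(k * h⁻¹)⁻¹, mem_image_of_mem _ ⟨v, Or.inl hv, axisPt P r 1, Or.inr ⟨r, hr, rfl⟩,
    c, hc, ?_⟩, ?_⟩
  · rw [map_mul, mul_smul]; exact he
  · rw [inv_inv, inv_mul_cancel_right]; exact hk

theorem mul_pos_of_segment {f : (Fin 3 → ℝ) →ₗ[ℝ] ℝ} {p v : Fin 3 → ℝ} {a b : ℝ} (hab : a ≤ b)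
    (h : ∀ t, a ≤ t → t ≤ b → f (p + t • v) ≠ 0) :
    0 < f (p + a • v) * f (p + b • v) := by
  simp only [map_add, map_smul, smul_eq_mul] at h ⊢
  exact mul_pos_of_affine_ne_zero hab h

/-- The parameters at which a segment in `C` crosses a wall. -/
def crossings (ρ : G →* SL(3, ℝ)) (P : SL(3, ℝ)) (p v : Fin 3 → ℝ) : Set ℝ :=
  {t : ℝ | ∃ h : G, coord (ρ h * P) 1 (p + t • v) = 0}

/-- Up to alignment finitely many walls meet the segment, and a wall that does not contain the line
meets it at most once. -/
theorem finite_crossings (W : WallSystem C ρ P) {p v : Fin 3 → ℝ} {a b : ℝ}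
    (hC : ∀ t ∈ Icc a b, p + t • v ∈ C)
    (hne : ∀ h : G, coord (ρ h * P) 1 p = 0 → coord (ρ h * P) 1 v ≠ 0) :
    (Icc a b ∩ crossings ρ P p v).Finite := by
  obtain ⟨F, hF, hFw⟩ := W.finite_walls (S := (fun t : ℝ => p + t • v) '' Icc a b)
    (image_subset_iff.2 hC) (isCompact_Icc.image (by fun_prop))
  refine (hF.biUnion (t := fun h => {t : ℝ | coord (ρ h * P) 1 (p + t • v) = 0})
    fun h _ => ?_).subset ?_
  · refine Set.Subsingleton.finite fun t ht u hu => ?_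
    simp only [mem_ofPred_eq, map_add, map_smul, smul_eq_mul] at ht hu
    by_cases hv : coord (ρ h * P) 1 v = 0
    · rw [hv, mul_zero, add_zero] at ht
      exact absurd hv (hne h ht)
    · have : (t - u) * coord (ρ h * P) 1 v = 0 := by linarith
      rcases mul_eq_zero.1 this with h1 | h1
      · linarith
      · exact absurd h1 hv
  · rintro t ⟨ht, h, hz⟩
    obtain ⟨h', hh', ha⟩ := hFw h ⟨_, ⟨t, ht, rfl⟩, hz⟩
    refine mem_biUnion hh' ?_
    obtain ⟨k, hk, he⟩ := ha.coord_eq 1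
    rw [he] at hz
    exact (mul_eq_zero.1 hz).resolve_left hk.ne'

/-- Translates of such a wall by powers of the axial element `δ` all pass through the shared end and
accumulate at the axis. A short transversal to the axis would then be crossed infinitely often,
against local finiteness. -/
theorem no_shared_endpoint (W : WallSystem C ρ P) {g δ : G} (hg : ¬ Aligned ρ P g)
    {s : Fin 3 → ℝ} (hδ : ∀ i v, coord P i (ρ δ • v) = Real.exp (s i) * coord P i v)
    {i j : Fin 3} (hj : s 1 < s j) (hij : (i = 0 ∧ j = 2) ∨ (i = 2 ∧ j = 0))
    (hz : coord (ρ g * P) 1 (frameVec P i) = 0) : False := by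
  set f := coord (ρ g * P) 1 with hf
  have hp0 : f (axisPt P 1 1) ≠ 0 := fun h => hg (W.aligned_of_axisPt one_pos one_pos h)
  have hk : f (frameVec P j) ≠ 0 := by
    intro h
    apply hp0
    rcases hij with ⟨rfl, rfl⟩ | ⟨rfl, rfl⟩ <;> simp [axisPt, h, hz]
  have hform : ∀ v, f v = coord P 1 v * f (frameVec P 1) + coord P j v * f (frameVec P j) := by
    intro v
    rw [apply_eq_sum_coord P f v]
    rcases hij with ⟨rfl, rfl⟩ | ⟨rfl, rfl⟩ <;> rw [hz] <;> ring
  have hm : f (frameVec P 1) ≠ 0 := by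
    intro h
    have h1 := hform (ρ g • axisPt P 1 1)
    have hC := W.map_mem g _ (W.axisPt_mem one_pos one_pos)
    rw [h, hf, coord_mul_smul, coord_axisPt, mul_zero, zero_add] at h1
    rcases hij with ⟨rfl, rfl⟩ | ⟨rfl, rfl⟩
    · exact hk ((mul_eq_zero.1 h1.symm).resolve_left (W.coord_two_pos _ hC).ne')
    · exact hk ((mul_eq_zero.1 h1.symm).resolve_left (W.coord_zero_pos _ hC).ne')
  have hδn : ∀ n : ℕ, ∀ i v, coord P i (ρ (δ ^ n)⁻¹ • v) = Real.exp (-(n * s i)) * coord P i v := by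
    intro n
    induction n with
    | zero => simp
    | succ n ih =>
      intro i v
      have := hδ i (ρ δ⁻¹ • v)
      rw [map_inv, smul_inv_smul] at this
      have he : Real.exp (-(↑(n + 1) * s i)) * Real.exp (s i) = Real.exp (-(n * s i)) := by
        rw [← Real.exp_add]; congr 1; push_cast; ring
      rw [pow_succ', mul_inv_rev, map_mul, mul_smul, ih, this, ← mul_assoc, he, map_inv]
  -- The parameter at which the wall of `δ ^ n * g` crosses the transversal: the functional `f` has
  -- only two terms there, and `δ ^ n` scales them by different exponentials.
  set b : ℕ → ℝ := fun n => -(f (frameVec P j) / f (frameVec P 1)) * Real.exp (n * (s 1 - s j))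
    with hb
  have hbz : ∀ n, b n ∈ crossings ρ P (axisPt P 1 1) (frameVec P 1) := by
    intro n
    refine ⟨δ ^ n * g, ?_⟩
    rw [map_mul, mul_assoc, coord_mul, ← hf, hform, ← map_inv, hδn, hδn]
    have hj1 : coord P j (axisPt P 1 1 + b n • frameVec P 1) = 1 := by
      rcases hij with ⟨rfl, rfl⟩ | ⟨rfl, rfl⟩ <;> simp [coord_axisPt, coord_frameVec_ne]
    have h11 : coord P 1 (axisPt P 1 1 + b n • frameVec P 1) = b n := by
      simp [coord_axisPt]
    rw [hj1, h11, hb]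
    have he : Real.exp (-(n * s j)) = Real.exp (-(n * s 1)) * Real.exp (n * (s 1 - s j)) := by
      rw [← Real.exp_add]; congr 1; ring
    rw [he]
    field_simp
    ring
  have hinj : Function.Injective b := by
    intro n m hnm
    have hne : -(f (frameVec P j) / f (frameVec P 1)) ≠ 0 := neg_ne_zero.2 (div_ne_zero hk hm)
    have := Real.exp_injective (mul_left_cancel₀ hne hnm)
    have hs : s 1 - s j ≠ 0 := by linarith
    exact_mod_cast mul_right_cancel₀ hs this
  have hlim : Tendsto b atTop (𝓝 0) := by
    have h1 : Tendsto (fun n : ℕ => Real.exp (n * (s 1 - s j))) atTop (𝓝 0) := by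
      refine Real.tendsto_exp_atBot.comp ?_
      exact tendsto_natCast_atTop_atTop.atTop_mul_const_of_neg (by linarith)
    have h2 := h1.const_mul (-(f (frameVec P j) / f (frameVec P 1)))
    rwa [mul_zero] at h2
  have hopen : ∀ᶠ t in 𝓝 (0 : ℝ), axisPt P 1 1 + t • frameVec P 1 ∈ C := by
    have hc : Continuous fun t : ℝ => axisPt P 1 1 + t • frameVec P 1 := by fun_prop
    refine hc.continuousAt.eventually_mem (W.isOpen.mem_nhds ?_)
    simpa using W.axisPt_mem one_pos one_pos
  obtain ⟨ε, hε, hball⟩ := Metric.eventually_nhds_iff_ball.1 hopen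
  have hfin : (Icc (-(ε / 2)) (ε / 2) ∩ crossings ρ P (axisPt P 1 1) (frameVec P 1)).Finite := by
    refine W.finite_crossings (fun t ht => hball t ?_) fun h h0 => ?_
    · rw [Metric.mem_ball, Real.dist_0_eq_abs, abs_lt]
      constructor <;> linarith [ht.1, ht.2]
    · obtain ⟨k, hk, he⟩ := W.aligned_of_axisPt one_pos one_pos h0 1
      rw [he]; simpa using hk.ne'
  obtain ⟨N, hN⟩ := eventually_atTop.1 (hlim.eventually_mem
    (Icc_mem_nhds (a := -(ε / 2)) (b := ε / 2) (by linarith) (by linarith)))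
  refine infinite_of_injective_forall_mem (f := fun n => b (n + N))
    (fun n m h => by simpa using hinj h) (fun n => ?_) hfin
  exact ⟨hN _ (by lia), hbz _⟩

/-- The ends of the axis lie strictly on the same side of another wall as the axis. -/
theorem axis_endpoint_sign (W : WallSystem C ρ P) {g : G} (hg : ¬ Aligned ρ P g) {a c : ℝ}
    (ha : 0 < a) (hc : 0 < c) {i : Fin 3} (hi : i ≠ 1) :
    0 < coord (ρ g * P) 1 (axisPt P a c) * coord (ρ g * P) 1 (frameVec P i) := by
  set f := coord (ρ g * P) 1 with hf
  have hne : ∀ a c : ℝ, 0 < a → 0 < c → f (axisPt P a c) ≠ 0 := fun a c ha hc h =>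
    hg (W.aligned_of_axisPt ha hc h)
  obtain ⟨γ, t, ht0, ht1, hγ⟩ := W.exists_axial
  have hγ' : ∀ i v, coord P i (ρ γ⁻¹ • v) = Real.exp ((-t) i) * coord P i v := by
    intro i v
    have := hγ i (ρ γ⁻¹ • v)
    rw [map_inv, smul_inv_smul] at this
    rw [this, map_inv, ← mul_assoc, ← Real.exp_add]; simp
  have hf0 : f (frameVec P 0) ≠ 0 := fun h =>
    W.no_shared_endpoint hg hγ' (i := 0) (j := 2) (by simpa using ht1) (by simp) h
  have hf2 : f (frameVec P 2) ≠ 0 := fun h =>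
    W.no_shared_endpoint hg hγ (i := 2) (j := 0) ht0 (by simp) h
  have hform : ∀ a c, f (axisPt P a c) = a * f (frameVec P 0) + c * f (frameVec P 2) := by
    intro a c; simp [axisPt]
  have hsame : 0 < f (frameVec P 0) * f (frameVec P 2) := by
    by_contra hcon
    have hneg : f (frameVec P 0) * f (frameVec P 2) < 0 :=
      lt_of_le_of_ne (not_lt.1 hcon) (mul_ne_zero hf0 hf2)
    -- Opposite signs at the two ends would give a zero of `f` at this point of the open axis.
    refine hne |f (frameVec P 2)| |f (frameVec P 0)| (abs_pos.2 hf2) (abs_pos.2 hf0) ?_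
    rw [hform]
    rcases mul_neg_iff.1 hneg with ⟨h1, h2⟩ | ⟨h1, h2⟩
    · rw [abs_of_neg h2, abs_of_pos h1]; ring
    · rw [abs_of_pos h2, abs_of_neg h1]; ring
  rw [hform]
  have q0 : 0 < f (frameVec P 0) * f (frameVec P 0) := mul_self_pos.2 hf0
  have q2 : 0 < f (frameVec P 2) * f (frameVec P 2) := mul_self_pos.2 hf2
  fin_cases i
  · change 0 < (_ : ℝ) * f (frameVec P 0)
    have := mul_pos ha q0
    have := mul_pos hc hsame
    nlinarith
  · exact absurd rfl hi
  · change 0 < (_ : ℝ) * f (frameVec P 2)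
    have := mul_pos ha hsame
    have := mul_pos hc q2
    nlinarith

/-- The ends of a wall lie strictly on the same side of another wall as its points in `C`. -/
theorem endpoint_sign (W : WallSystem C ρ P) {g h : G} {p : Fin 3 → ℝ} (hp : p ∈ C)
    (hg : coord (ρ g * P) 1 p = 0) (hh : coord (ρ h * P) 1 p ≠ 0) {i : Fin 3} (hi : i ≠ 1) :
    0 < coord (ρ h * P) 1 p * coord (ρ h * P) 1 (frameVec (ρ g * P) i) := by
  have hna := not_aligned_of_ne hg hh
  have hm : (ρ g)⁻¹ • p ∈ C := by rw [← map_inv]; exact W.map_mem _ _ hp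
  rw [coord_mul] at hg
  have := W.axis_endpoint_sign hna (W.coord_zero_pos _ hm) (W.coord_two_pos _ hm) hi
  rwa [← eq_axisPt hg, coord_inv_mul, coord_inv_mul, smul_inv_smul, ← frameVec_mul] at this

end WallSystem
end

/-! ### Pieces, the developing map and ping-pong -/

noncomputable section
namespace WallSystem

variable {G : Type*} [Group G] {C : Set (Fin 3 → ℝ)} {ρ : G →* SL(3, ℝ)} {P : SL(3, ℝ)}

/-- `y` is a point of `C` that lies on no wall. -/
def OffWall (C : Set (Fin 3 → ℝ)) (ρ : G →* SL(3, ℝ)) (P : SL(3, ℝ)) (y : Fin 3 → ℝ) : Prop :=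
  y ∈ C ∧ ∀ h : G, coord (ρ h * P) 1 y ≠ 0

/-- The piece of `C` adjacent to the axis on the side given by the sign of `σ`. -/
def piece (C : Set (Fin 3 → ℝ)) (ρ : G →* SL(3, ℝ)) (P : SL(3, ℝ)) (σ : ℝ) :
    Set (Fin 3 → ℝ) :=
  {y ∈ C | 0 < σ * coord P 1 y ∧ ∀ h : G, ¬ Aligned ρ P h →
    0 < coord (ρ h * P) 1 (axisPt P 1 1) * coord (ρ h * P) 1 y}

theorem map_segment_mem (W : WallSystem C ρ P) {x y : Fin 3 → ℝ} (hx : x ∈ C) (hy : y ∈ C) {t : ℝ}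
    (ht : t ∈ Icc 0 1) : x + t • (y - x) ∈ C := by
  have := W.convex.add_smul_sub_mem hx hy ht
  exact this

/-- The first wall met on a segment. -/
theorem exists_first_wall (W : WallSystem C ρ P) {p v : Fin 3 → ℝ} {a b : ℝ} (hab : a ≤ b)
    (hC : ∀ t ∈ Icc a b, p + t • v ∈ C) (ha : ∀ h : G, coord (ρ h * P) 1 (p + a • v) ≠ 0)
    {h₀ : G} (h0 : coord (ρ h₀ * P) 1 (p + a • v) * coord (ρ h₀ * P) 1 (p + b • v) ≤ 0) :
    ∃ t ∈ Ioc a b, ∃ h : G, coord (ρ h * P) 1 (p + t • v) = 0 ∧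
      ∀ u, a ≤ u → u < t → ∀ h' : G, coord (ρ h' * P) 1 (p + u • v) ≠ 0 := by
  have hfin : (Icc a b ∩ crossings ρ P p v).Finite := by
    refine W.finite_crossings hC fun h h1 h2 => ha h ?_
    simp [h1, h2]
  have hne : (Icc a b ∩ crossings ρ P p v).Nonempty := by
    by_contra hcon
    rw [not_nonempty_iff_eq_empty] at hcon
    have := mul_pos_of_segment (f := coord (ρ h₀ * P) 1) (p := p) (v := v) hab fun t hat htb hz => by
      have : t ∈ Icc a b ∩ crossings ρ P p v := ⟨⟨hat, htb⟩, h₀, hz⟩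
      rw [hcon] at this
      exact this
    linarith
  obtain ⟨t, ⟨ht, h, hz⟩, hmin⟩ := Set.exists_min_image _ id hfin hne
  refine ⟨t, ⟨lt_of_le_of_ne ht.1 ?_, ht.2⟩, h, hz, fun u hau hut h' hz' => ?_⟩
  · rintro rfl
    exact ha h hz
  · have := hmin u ⟨⟨hau, hut.le.trans ht.2⟩, h', hz'⟩
    simp only [id] at this
    linarith

theorem axis_sign (W : WallSystem C ρ P) {g : G} (hg : ¬ Aligned ρ P g) {a c : ℝ}
    (ha : 0 < a) (hc : 0 < c) :
    0 < coord (ρ g * P) 1 (axisPt P 1 1) * coord (ρ g * P) 1 (axisPt P a c) := by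
  have h1 := W.axis_endpoint_sign hg ha hc (i := 0) (by decide)
  have h2 := W.axis_endpoint_sign hg one_pos one_pos (i := 0) (by decide)
  rw [mul_comm] at h1 h2
  exact pos_of_mul_pos_of_mul_pos h2 h1

/-- A point from which a wall is reached without crossing other walls is adjacent to it. -/
theorem inv_smul_mem_piece (W : WallSystem C ρ P) {h : G} {x p : Fin 3 → ℝ} (hx : x ∈ C)
    (hp : p ∈ C) (hz : coord (ρ h * P) 1 p = 0) {σ : ℝ} (hσ : 0 < σ * coord (ρ h * P) 1 x)
    (hs : ∀ h' : G, coord (ρ h' * P) 1 p ≠ 0 →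
      0 < coord (ρ h' * P) 1 x * coord (ρ h' * P) 1 p) :
    (ρ h)⁻¹ • x ∈ piece C ρ P σ := by
  refine ⟨by rw [← map_inv]; exact W.map_mem _ _ hx, by rwa [← coord_mul], fun g hg => ?_⟩
  have heq : ∀ v, coord (ρ g * P) 1 ((ρ h)⁻¹ • v) = coord (ρ (h * g) * P) 1 v := by
    intro v
    rw [map_mul, mul_assoc, coord_mul (ρ h)]
  have hne : coord (ρ (h * g) * P) 1 p ≠ 0 := fun h0 => hg (by
    have := W.aligned_of_mem hp hz h0
    rwa [inv_mul_cancel_left] at this)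
  have h1 := hs _ hne
  have hm : (ρ h)⁻¹ • p ∈ C := by rw [← map_inv]; exact W.map_mem _ _ hp
  have h2 := W.axis_sign hg (W.coord_zero_pos _ hm) (W.coord_two_pos _ hm)
  rw [coord_mul] at hz
  rw [← eq_axisPt hz, heq, mul_comm] at h2
  rw [mul_comm] at h1
  rw [heq]
  exact pos_of_mul_pos_of_mul_pos h2 h1

/-- The conditions for `ρ'` to be the bulging deformation of `ρ`, in terms of vectors. -/
structure IsConeBulging (C : Set (Fin 3 → ℝ)) (ρ : G →* SL(3, ℝ)) (P : SL(3, ℝ)) (s : ℝ)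
    (ρ' : G →* SL(3, ℝ)) : Prop where
  left : ∀ h : G, ∀ y ∈ piece C ρ P (-1), ρ h • y ∈ piece C ρ P (-1) → ρ' h = ρ h
  right : ∀ h : G, ∀ y ∈ piece C ρ P 1, ρ h • y ∈ piece C ρ P 1 →
    ρ' h = bulge P s * ρ h * (bulge P s)⁻¹
  stable : ∀ h : G, ∀ y ∈ piece C ρ P (-1), ρ h • y ∈ piece C ρ P 1 → ρ' h = bulge P s * ρ h

/-- The developing map of the bulged structure is given by the matrix `B` near `y`. -/
def IsDev (C : Set (Fin 3 → ℝ)) (ρ : G →* SL(3, ℝ)) (P : SL(3, ℝ)) (s : ℝ) (ρ' : G →* SL(3, ℝ))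
    (y : Fin 3 → ℝ) (B : SL(3, ℝ)) : Prop :=
  ∃ h : G, ((ρ h)⁻¹ • y ∈ piece C ρ P (-1) ∧ B = ρ' h * (ρ h)⁻¹) ∨
    ((ρ h)⁻¹ • y ∈ piece C ρ P 1 ∧ B = ρ' h * bulge P s * (ρ h)⁻¹)

variable {s : ℝ} {ρ' : G →* SL(3, ℝ)}

/-- Two representations of `y` differ by a group element that takes one adjacent piece to itself or
to the other. The three conditions in `IsConeBulging` are the corresponding compatibilities. -/
theorem IsDev.unique (hb : IsConeBulging C ρ P s ρ') {y : Fin 3 → ℝ} {B B' : SL(3, ℝ)}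
    (h1 : IsDev C ρ P s ρ' y B) (h2 : IsDev C ρ P s ρ' y B') : B = B' := by
  have key : ∀ g h : G, ρ (g⁻¹ * h) • (ρ h)⁻¹ • y = (ρ g)⁻¹ • y := by
    intro g h
    rw [map_mul, mul_smul, smul_inv_smul, map_inv]
  have mixed : ∀ g h : G, (ρ g)⁻¹ • y ∈ piece C ρ P 1 → (ρ h)⁻¹ • y ∈ piece C ρ P (-1) →
      ρ' h * (ρ h)⁻¹ = ρ' g * bulge P s * (ρ g)⁻¹ := by
    intro g h hg hh
    have := hb.stable (g⁻¹ * h) _ hh (by rw [key]; exact hg)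
    rw [map_mul, map_mul, map_inv, map_inv, inv_mul_eq_iff_eq_mul] at this
    rw [this]; group
  obtain ⟨g, ⟨hg, rfl⟩ | ⟨hg, rfl⟩⟩ := h1 <;> obtain ⟨h, ⟨hh, rfl⟩ | ⟨hh, rfl⟩⟩ := h2
  · have := hb.left (g⁻¹ * h) _ hh (by rw [key]; exact hg)
    rw [map_mul, map_mul, map_inv, map_inv, inv_mul_eq_iff_eq_mul] at this
    rw [this]; group
  · exact mixed h g hh hg
  · exact (mixed g h hg hh).symm
  · have := hb.right (g⁻¹ * h) _ hh (by rw [key]; exact hg)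
    rw [map_mul, map_mul, map_inv, map_inv, inv_mul_eq_iff_eq_mul] at this
    rw [this]; group

/-- Across a wall, the developing map changes by a positive diagonal matrix in its frame. -/
theorem coord_dev_across (hb : IsConeBulging C ρ P s ρ') {h : G} {x y : Fin 3 → ℝ}
    {B B' : SL(3, ℝ)} (hx : IsDev C ρ P s ρ' x B) (hy : IsDev C ρ P s ρ' y B')
    (hside : ((ρ h)⁻¹ • x ∈ piece C ρ P (-1) ∧ (ρ h)⁻¹ • y ∈ piece C ρ P 1) ∨
      ((ρ h)⁻¹ • x ∈ piece C ρ P 1 ∧ (ρ h)⁻¹ • y ∈ piece C ρ P (-1))) (i : Fin 3) :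
    ∃ k : ℝ, 0 < k ∧ ∀ v, coord (ρ h * P) i ((B⁻¹ * B') • v) = k * coord (ρ h * P) i v := by
  rcases hside with ⟨h1, h2⟩ | ⟨h1, h2⟩
  · rw [hx.unique hb ⟨h, Or.inl ⟨h1, rfl⟩⟩, hy.unique hb ⟨h, Or.inr ⟨h2, rfl⟩⟩]
    have : (ρ' h * (ρ h)⁻¹)⁻¹ * (ρ' h * bulge P s * (ρ h)⁻¹) = bulge (ρ h * P) s := by
      rw [bulge_mul]; group
    rw [this]
    exact exists_pos_coord_bulge _ _ i
  · rw [hx.unique hb ⟨h, Or.inr ⟨h1, rfl⟩⟩, hy.unique hb ⟨h, Or.inl ⟨h2, rfl⟩⟩]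
    have : (ρ' h * bulge P s * (ρ h)⁻¹)⁻¹ * (ρ' h * (ρ h)⁻¹) = bulge (ρ h * P) (-s) := by
      rw [bulge_mul, ← bulge_inv]; group
    rw [this]
    exact exists_pos_coord_bulge _ _ i

/-- `z` lies in the open triangle cut out by the supporting lines at the ends of the wall `h`, on
the same side of the wall as `y`. -/
def InTriangle (ρ : G →* SL(3, ℝ)) (P : SL(3, ℝ)) (h : G) (y z : Fin 3 → ℝ) : Prop :=
  0 < coord (ρ h * P) 0 z ∧ 0 < coord (ρ h * P) 2 z ∧
    0 < coord (ρ h * P) 1 y * coord (ρ h * P) 1 z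

/-- A functional that is nonnegative at the ends of a wall and vanishes at a point of the closed
cone on the near side is nonnegative at the vertex of the triangle on the far side. -/
theorem vertex_nonneg (W : WallSystem C ρ P) {f : (Fin 3 → ℝ) →ₗ[ℝ] ℝ} {h : G} {c : ℝ}
    (hf0 : 0 ≤ f (frameVec (ρ h * P) 0)) (hf2 : 0 ≤ f (frameVec (ρ h * P) 2)) {u : Fin 3 → ℝ}
    (hu : u ∈ closure C) (hfu : f u = 0) (hcu : c * coord (ρ h * P) 1 u < 0) :
    0 ≤ c * f (frameVec (ρ h * P) 1) := by
  by_contra hcon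
  push Not at hcon
  have h1 := apply_eq_sum_coord (ρ h * P) f u
  have h2 := mul_nonneg (W.coord_wall_zero_nonneg h hu) hf0
  have h3 := mul_nonneg (W.coord_wall_two_nonneg h hu) hf2
  have h4 : 0 < coord (ρ h * P) 1 u * f (frameVec (ρ h * P) 1) := by
    have h5 : 0 < (c * coord (ρ h * P) 1 u) * (c * f (frameVec (ρ h * P) 1)) :=
      mul_pos_of_neg_of_neg hcu hcon
    have h6 : 0 < c ^ 2 * (coord (ρ h * P) 1 u * f (frameVec (ρ h * P) 1)) := by linarith
    exact pos_of_mul_pos_right h6 (sq_nonneg c)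
  linarith

/-- The functional is nonnegative at all three vertices of the triangle, the far one by
`vertex_nonneg`. A zero in the open triangle would make it vanish at the vertices, which form a
basis. -/
theorem pos_of_inTriangle (W : WallSystem C ρ P) {f : (Fin 3 → ℝ) →ₗ[ℝ] ℝ} (hf : f ≠ 0) {h : G}
    (hf0 : 0 ≤ f (frameVec (ρ h * P) 0)) (hf2 : 0 ≤ f (frameVec (ρ h * P) 2)) {u y : Fin 3 → ℝ}
    (hu : u ∈ closure C) (hfu : f u = 0) (hcu : coord (ρ h * P) 1 y * coord (ρ h * P) 1 u < 0)
    {z : Fin 3 → ℝ} (hz : InTriangle ρ P h y z) : 0 < f z := by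
  have h1 := W.vertex_nonneg hf0 hf2 hu hfu hcu
  obtain ⟨z0, z2, z1⟩ := hz
  have hyne : coord (ρ h * P) 1 y ≠ 0 := by rintro h0; simp [h0] at z1
  have e := apply_eq_sum_coord (ρ h * P) f z
  have h2 : 0 ≤ coord (ρ h * P) 1 z * f (frameVec (ρ h * P) 1) := by
    have h5 := mul_nonneg z1.le h1
    have h6 : 0 ≤ (coord (ρ h * P) 1 y) ^ 2 *
      (coord (ρ h * P) 1 z * f (frameVec (ρ h * P) 1)) := by linarith
    exact nonneg_of_mul_nonneg_right h6 (by positivity)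
  have h3 := mul_nonneg z0.le hf0
  have h4 := mul_nonneg z2.le hf2
  refine lt_of_le_of_ne (by linarith) fun hzero => hf ?_
  have e0 : f (frameVec (ρ h * P) 0) = 0 := by
    have : coord (ρ h * P) 0 z * f (frameVec (ρ h * P) 0) = 0 := by linarith
    exact (mul_eq_zero.1 this).resolve_left z0.ne'
  have e2 : f (frameVec (ρ h * P) 2) = 0 := by
    have : coord (ρ h * P) 2 z * f (frameVec (ρ h * P) 2) = 0 := by linarith
    exact (mul_eq_zero.1 this).resolve_left z2.ne'
  have e1 : f (frameVec (ρ h * P) 1) = 0 := by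
    have h7 : coord (ρ h * P) 1 z * f (frameVec (ρ h * P) 1) = 0 := by linarith
    exact (mul_eq_zero.1 h7).resolve_left fun h0 => by simp [h0] at z1
  refine LinearMap.ext fun w => ?_
  rw [apply_eq_sum_coord (ρ h * P) f w, e0, e1, e2]
  simp

theorem coord_ne_zero_map (F : SL(3, ℝ)) (i : Fin 3) : coord F i ≠ 0 := fun h => by
  have := coord_frameVec_self F i
  rw [h] at this
  exact zero_ne_one this

/-- The coordinates along a wall at its ends are positive on the triangles beyond other walls. -/
theorem coord_pos_of_inTriangle (W : WallSystem C ρ P) {g h : G} {p y z : Fin 3 → ℝ} (hp : p ∈ C)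
    (hg : coord (ρ g * P) 1 p = 0) (hy : coord (ρ h * P) 1 y * coord (ρ h * P) 1 p < 0)
    (hz : InTriangle ρ P h y z) : 0 < coord (ρ g * P) 0 z ∧ 0 < coord (ρ g * P) 2 z := by
  have hne : coord (ρ h * P) 1 p ≠ 0 := by rintro h0; simp [h0] at hy
  have hs : ∀ i : Fin 3, i ≠ 1 →
      -- The ends of the wall `g` lie, like its point `p`, on the side of `h` opposite to `y`. Each
      -- of the two coordinates of `g` vanishes at one of these ends, which serves as the point `u`
      -- of `pos_of_inTriangle`.
      coord (ρ h * P) 1 y * coord (ρ h * P) 1 (frameVec (ρ g * P) i) < 0 := by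
    intro i hi
    have := neg_of_mul_pos_of_mul_neg (W.endpoint_sign hp hg hne hi) (by rwa [mul_comm] at hy)
    rwa [mul_comm]
  constructor
  · exact W.pos_of_inTriangle (coord_ne_zero_map _ _)
      (W.coord_wall_zero_nonneg g (W.frameVec_wall_zero_mem h))
      (W.coord_wall_zero_nonneg g (W.frameVec_wall_two_mem h)) (W.frameVec_wall_two_mem g)
      (coord_frameVec_ne _ (by decide)) (hs 2 (by decide)) hz
  · exact W.pos_of_inTriangle (coord_ne_zero_map _ _)
      (W.coord_wall_two_nonneg g (W.frameVec_wall_zero_mem h))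
      (W.coord_wall_two_nonneg g (W.frameVec_wall_two_mem h)) (W.frameVec_wall_zero_mem g)
      (coord_frameVec_ne _ (by decide)) (hs 0 (by decide)) hz

/-- The triangles beyond consecutive walls are nested. -/
theorem inTriangle_of_inTriangle (W : WallSystem C ρ P) {g h : G} {p q y z : Fin 3 → ℝ}
    (hp : p ∈ C) (hg : coord (ρ g * P) 1 p = 0) (hq : q ∈ C) (hh : coord (ρ h * P) 1 q = 0)
    (hy : coord (ρ h * P) 1 y * coord (ρ h * P) 1 p < 0)
    (hy' : 0 < coord (ρ g * P) 1 y * coord (ρ g * P) 1 q) (hz : InTriangle ρ P h y z) :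
    InTriangle ρ P g y z := by
  obtain ⟨h0, h2⟩ := W.coord_pos_of_inTriangle hp hg hy hz
  refine ⟨h0, h2, ?_⟩
  have hne : coord (ρ g * P) 1 q ≠ 0 := by rintro h0; simp [h0] at hy'
  have hs : ∀ i : Fin 3, i ≠ 1 →
      0 < coord (ρ g * P) 1 y * coord (ρ g * P) 1 (frameVec (ρ h * P) i) := fun i hi =>
    pos_of_mul_pos_of_mul_pos (by rwa [mul_comm] at hy') (W.endpoint_sign hq hh hne hi)
  have hf : coord (ρ g * P) 1 y • coord (ρ g * P) 1 ≠ 0 := by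
    refine smul_ne_zero ?_ (coord_ne_zero_map _ _)
    rintro h0
    simp [h0] at hy'
  have := W.pos_of_inTriangle hf (h := h) (u := p) (y := y) (hs 0 (by decide)).le
    (hs 2 (by decide)).le (subset_closure hp) (by simp [hg]) hy hz
  simpa using this

/-- Ping-pong: the developed image of a point, seen from another piece, lies in the triangle beyond
the first wall that separates them. -/
theorem dev_inTriangle (W : WallSystem C ρ P) (hb : IsConeBulging C ρ P s ρ') {p v : Fin 3 → ℝ}
    (hC : ∀ t ∈ Icc (0 : ℝ) 1, p + t • v ∈ C) (hy : OffWall C ρ P (p + (1 : ℝ) • v)) {B' : SL(3, ℝ)}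
    (hB' : IsDev C ρ P s ρ' (p + (1 : ℝ) • v) B') (n : ℕ) :
    ∀ a : ℝ, 0 ≤ a → a < 1 → (∀ h : G, coord (ρ h * P) 1 (p + a • v) ≠ 0) → ∀ B : SL(3, ℝ),
      IsDev C ρ P s ρ' (p + a • v) B → (Icc a 1 ∩ crossings ρ P p v).ncard ≤ n →
      ∀ t : ℝ, a < t → t < 1 → ∀ h : G, coord (ρ h * P) 1 (p + t • v) = 0 →
        (∀ u, a ≤ u → u < t → ∀ h' : G, coord (ρ h' * P) 1 (p + u • v) ≠ 0) →
        InTriangle ρ P h (p + (1 : ℝ) • v) ((B⁻¹ * B') • (p + (1 : ℝ) • v)) := by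
  -- The induction is on the number of crossings left on the segment after the parameter `a`.
  -- Without crossings the first wall assumed to exist is a contradiction.
  induction n with
  | zero =>
    intro a ha0 ha1 ha B hB hcard t hat ht1 h hz _
    have hfin : (Icc a 1 ∩ crossings ρ P p v).Finite :=
      W.finite_crossings (fun u hu => hC u ⟨ha0.trans hu.1, hu.2⟩) fun h h1 h2 => ha h (by simp [h1, h2])
    rw [Nat.le_zero, Set.ncard_eq_zero hfin] at hcard
    have : t ∈ Icc a 1 ∩ crossings ρ P p v := ⟨⟨hat.le, ht1.le⟩, h, hz⟩
    rw [hcard] at this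
    exact absurd this (notMem_empty _)
  | succ n ih =>
    intro a ha0 ha1 ha B hB hcard t hat ht1 h hz hfirst
    have hfin : (Icc a 1 ∩ crossings ρ P p v).Finite :=
      W.finite_crossings (fun u hu => hC u ⟨ha0.trans hu.1, hu.2⟩) fun h h1 h2 => ha h (by simp [h1, h2])
    have hxC := hC a ⟨ha0, ha1.le⟩
    have hpC := hC t ⟨ha0.trans hat.le, ht1.le⟩
    have hform : ∀ (g : G) (u : ℝ), coord (ρ g * P) 1 (p + u • v) =
        coord (ρ g * P) 1 p + u * coord (ρ g * P) 1 v := by intro g u; simp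
    -- the slope of the coordinate transverse to the wall
    set q := coord (ρ h * P) 1 v with hq
    have hline : ∀ u, coord (ρ h * P) 1 (p + u • v) = (u - t) * q := by
      intro u
      have := hform h t
      rw [hz] at this
      rw [hform]; linarith
    have hq0 : q ≠ 0 := fun h0 => ha h (by rw [hline, h0, mul_zero])
    have hqq : 0 < q * q := mul_self_pos.2 hq0
    -- the near side of the wall
    have hnear : (ρ h)⁻¹ • (p + a • v) ∈ piece C ρ P (-q) := by
      refine W.inv_smul_mem_piece hxC hpC hz ?_ fun h' hne => ?_
      · rw [hline]; nlinarith
      · exact mul_pos_of_segment hat.le fun u hau hut => by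
          rcases hut.lt_or_eq with hlt | rfl
          · exact hfirst u hau hlt h'
          · exact hne
    -- points after the wall and before the next one lie on its far side
    have hfar : ∀ b, t < b → b ≤ 1 → (∀ u, t < u → u ≤ b → ∀ h', coord (ρ h' * P) 1 (p + u • v) ≠ 0) →
        (ρ h)⁻¹ • (p + b • v) ∈ piece C ρ P q := by
      intro b htb hb1 hoff
      refine W.inv_smul_mem_piece (hC b ⟨by linarith, hb1⟩) hpC hz ?_ fun h' hne => ?_
      · rw [hline]; nlinarith
      · rw [mul_comm]
        exact mul_pos_of_segment htb.le fun u htu hub => by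
          rcases htu.lt_or_eq with hlt | rfl
          · exact hoff u hlt hub h'
          · exact hne
    have hsign : ∀ x : Fin 3 → ℝ, ∀ σ : ℝ, x ∈ piece C ρ P σ → (0 < σ → x ∈ piece C ρ P 1) ∧
        (σ < 0 → x ∈ piece C ρ P (-1)) := by
      intro x σ hx
      obtain ⟨h1, h2, h3⟩ := hx
      refine ⟨fun hσ => ⟨h1, ?_, h3⟩, fun hσ => ⟨h1, ?_, h3⟩⟩
      · rw [one_mul]; exact pos_of_mul_pos_right h2 hσ.le
      · nlinarith
    have hacross : ∀ b, t < b → b ≤ 1 →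
        (∀ u, t < u → u ≤ b → ∀ h', coord (ρ h' * P) 1 (p + u • v) ≠ 0) →
        ∃ B₁, IsDev C ρ P s ρ' (p + b • v) B₁ ∧ ∀ i, ∃ k : ℝ, 0 < k ∧
          ∀ w, coord (ρ h * P) i ((B⁻¹ * B₁) • w) = k * coord (ρ h * P) i w := by
      intro b htb hb1 hoff
      have hf := hfar b htb hb1 hoff
      rcases lt_or_gt_of_ne hq0 with hneg | hpos
      · have h1 := (hsign _ _ hnear).1 (by linarith)
        have h2 := (hsign _ _ hf).2 hneg
        exact ⟨_, ⟨h, Or.inl ⟨h2, rfl⟩⟩, fun i =>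
          coord_dev_across hb hB ⟨h, Or.inl ⟨h2, rfl⟩⟩ (Or.inr ⟨h1, h2⟩) i⟩
      · have h1 := (hsign _ _ hnear).2 (by linarith)
        have h2 := (hsign _ _ hf).1 hpos
        exact ⟨_, ⟨h, Or.inr ⟨h2, rfl⟩⟩, fun i =>
          coord_dev_across hb hB ⟨h, Or.inr ⟨h2, rfl⟩⟩ (Or.inl ⟨h1, h2⟩) i⟩
    have htrans : ∀ B₁ : SL(3, ℝ), (∀ i, ∃ k : ℝ, 0 < k ∧
          ∀ w, coord (ρ h * P) i ((B⁻¹ * B₁) • w) = k * coord (ρ h * P) i w) → ∀ y z,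
          InTriangle ρ P h y z → InTriangle ρ P h y ((B⁻¹ * B₁) • z) := by
      intro B₁ hk y z ⟨z0, z2, z1⟩
      obtain ⟨k0, hk0, e0⟩ := hk 0
      obtain ⟨k1, hk1, e1⟩ := hk 1
      obtain ⟨k2, hk2, e2⟩ := hk 2
      refine ⟨(e0 z).symm ▸ mul_pos hk0 z0, (e2 z).symm ▸ mul_pos hk2 z2, ?_⟩
      rw [e1 z, mul_left_comm]
      exact mul_pos hk1 z1
    by_cases hlast : ∀ u, t < u → u ≤ 1 → ∀ h', coord (ρ h' * P) 1 (p + u • v) ≠ 0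
    · obtain ⟨B₁, hB₁, hk⟩ := hacross 1 ht1 le_rfl hlast
      rw [hB'.unique hb hB₁]
      exact htrans _ hk _ _ ⟨W.coord_wall_zero_pos _ hy.1, W.coord_wall_two_pos _ hy.1,
        mul_self_pos.2 (hy.2 h)⟩
    · push Not at hlast
      obtain ⟨u₁, htu₁, hu₁, h₁, hz₁⟩ := hlast
      -- the next crossing
      have hfin' : (Ioc t 1 ∩ crossings ρ P p v).Finite :=
        hfin.subset (inter_subset_inter_left _ fun u hu => ⟨by linarith [hu.1], hu.2⟩)
      obtain ⟨t₂, ⟨ht₂, h₂, hz₂⟩, hmin⟩ := Set.exists_min_image _ id hfin' ⟨u₁, ⟨htu₁, hu₁⟩, h₁, hz₁⟩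
      have hoff : ∀ u, t < u → u < t₂ → ∀ h', coord (ρ h' * P) 1 (p + u • v) ≠ 0 := by
        intro u htu hut h' h0
        have := hmin u ⟨⟨htu, hut.le.trans ht₂.2⟩, h', h0⟩
        simp only [id] at this
        linarith
      have ht₂1 : t₂ < 1 := lt_of_le_of_ne ht₂.2 (by rintro rfl; exact hy.2 h₂ hz₂)
      have hmid1 : t < (t + t₂) / 2 := by linarith [ht₂.1]
      have hmid2 : (t + t₂) / 2 < t₂ := by linarith [ht₂.1]
      -- The midpoint of two consecutive crossings lies in the piece just beyond the wall `h`.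
      -- Viewed from there the crossing at `t` is no longer counted.
      obtain ⟨B₁, hB₁, hk⟩ := hacross ((t + t₂) / 2) hmid1 (by linarith)
        fun u h1 h2 => hoff u h1 (h2.trans_lt hmid2)
      have hcard' : (Icc ((t + t₂) / 2) 1 ∩ crossings ρ P p v).ncard ≤ n := by
        have hlt : (Icc ((t + t₂) / 2) 1 ∩ crossings ρ P p v).ncard <
            (Icc a 1 ∩ crossings ρ P p v).ncard := by
          refine Set.ncard_lt_ncard ⟨inter_subset_inter_left _ fun u hu =>
            ⟨by linarith [hu.1], hu.2⟩, fun hsub => ?_⟩ hfin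
          have := hsub ⟨⟨hat.le, ht1.le⟩, h, hz⟩
          linarith [this.1.1]
        lia
      have hT := ih ((t + t₂) / 2) (by linarith) (by linarith) (hoff _ hmid1 hmid2) B₁ hB₁ hcard' t₂
        hmid2 ht₂1 h₂ hz₂ fun u h1 h2 => hoff u (hmid1.trans_le h1) h2
      -- The first factor is the jump across `h`, positive and diagonal in its frame. The second
      -- puts `y` in the triangle beyond `h₂`, which is contained in the triangle beyond `h`, and
      -- the jump preserves the latter.
      have hsplit : B⁻¹ * B' = (B⁻¹ * B₁) * (B₁⁻¹ * B') := by group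
      rw [hsplit, mul_smul]
      refine htrans _ hk _ _ ?_
      refine W.inTriangle_of_inTriangle hpC hz (hC t₂ ⟨by linarith, ht₂1.le⟩) hz₂ ?_ ?_ hT
      · have hline₂ : ∀ u, coord (ρ h₂ * P) 1 (p + u • v) = (u - t₂) * coord (ρ h₂ * P) 1 v := by
          intro u
          have := hform h₂ t₂
          rw [hz₂] at this
          rw [hform]; linarith
        have hne : coord (ρ h₂ * P) 1 v ≠ 0 := fun h0 => ha h₂ (by rw [hline₂, h0, mul_zero])
        rw [hline₂, hline₂]
        have h3 : 0 < coord (ρ h₂ * P) 1 v * coord (ρ h₂ * P) 1 v := mul_self_pos.2 hne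
        have h4 : 0 < (1 - t₂) * (t₂ - t) := mul_pos (by linarith) (by linarith [ht₂.1])
        nlinarith [mul_pos h3 h4]
      · rw [hline, hline]
        have h4 : 0 < (1 - t) * (t₂ - t) := mul_pos (by linarith) (by linarith [ht₂.1])
        nlinarith [mul_pos hqq h4]

end WallSystem
end

/-! ### Injectivity of the developing map and the fixed triangle -/

noncomputable section
namespace WallSystem

variable {G : Type*} [Group G] {C : Set (Fin 3 → ℝ)} {ρ : G →* SL(3, ℝ)} {P : SL(3, ℝ)}

theorem coord_map_one (i : Fin 3) : coord (ρ (1 : G) * P) i = coord P i := by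
  rw [map_one, one_mul]

theorem OffWall.smul (W : WallSystem C ρ P) {y : Fin 3 → ℝ} (hy : OffWall C ρ P y) (g : G) :
    OffWall C ρ P (ρ g • y) := by
  refine ⟨W.map_mem g y hy.1, fun h h0 => hy.2 (g⁻¹ * h) ?_⟩
  rw [coord_inv_mul]; exact h0

theorem offWall_of_mem_piece {σ : ℝ} {y : Fin 3 → ℝ} (hy : y ∈ piece C ρ P σ) :
    OffWall C ρ P y := by
  refine ⟨hy.1, fun h h0 => ?_⟩
  by_cases ha : Aligned ρ P h
  · obtain ⟨k, hk, he⟩ := ha 1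
    rw [he] at h0
    have := hy.2.1
    rw [(mul_eq_zero.1 h0).resolve_left hk.ne', mul_zero] at this
    exact lt_irrefl _ this
  · have := hy.2.2 h ha
    rw [h0, mul_zero] at this
    exact lt_irrefl _ this

theorem mem_piece_congr {σ : ℝ} {y z : Fin 3 → ℝ} (hz : z ∈ C)
    (h : ∀ h : G, 0 < coord (ρ h * P) 1 y * coord (ρ h * P) 1 z) (hy : y ∈ piece C ρ P σ) :
    z ∈ piece C ρ P σ := by
  refine ⟨hz, ?_, fun g hg => ?_⟩
  · have h1 := h 1
    rw [coord_map_one] at h1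
    have h2 := hy.2.1
    rw [mul_comm] at h2
    rw [mul_comm]
    have := pos_of_mul_pos_of_mul_pos h1 h2
    linarith
  · have := hy.2.2 g hg
    rw [mul_comm] at this
    exact pos_of_mul_pos_of_mul_pos this (h g)

theorem IsDev.congr {s : ℝ} {ρ' : G →* SL(3, ℝ)} (W : WallSystem C ρ P) {y z : Fin 3 → ℝ}
    (hz : z ∈ C) (h : ∀ h : G, 0 < coord (ρ h * P) 1 y * coord (ρ h * P) 1 z) {B : SL(3, ℝ)}
    (hy : IsDev C ρ P s ρ' y B) : IsDev C ρ P s ρ' z B := by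
  obtain ⟨g, hg⟩ := hy
  have hsgn : ∀ h : G, 0 < coord (ρ h * P) 1 ((ρ g)⁻¹ • y) * coord (ρ h * P) 1 ((ρ g)⁻¹ • z) := by
    intro k
    have := h (g * k)
    rwa [map_mul, mul_assoc, coord_mul (ρ g), coord_mul (ρ g)] at this
  have hzg : (ρ g)⁻¹ • z ∈ C := by rw [← map_inv]; exact W.map_mem _ _ hz
  exact ⟨g, hg.imp (fun h => ⟨mem_piece_congr hzg hsgn h.1, h.2⟩)
    fun h => ⟨mem_piece_congr hzg hsgn h.1, h.2⟩⟩

/-- Equivariance: the developed image of `ρ g • y` is `ρ' g` applied to the developed image of `y`.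
-/
theorem IsDev.smul {s : ℝ} {ρ' : G →* SL(3, ℝ)} {y : Fin 3 → ℝ} {B : SL(3, ℝ)}
    (hy : IsDev C ρ P s ρ' y B) (g : G) :
    IsDev C ρ P s ρ' (ρ g • y) (ρ' g * B * (ρ g)⁻¹) := by
  obtain ⟨h, hh⟩ := hy
  have e : (ρ (g * h))⁻¹ • ρ g • y = (ρ h)⁻¹ • y := by
    rw [map_mul, mul_inv_rev, mul_smul, inv_smul_smul]
  refine ⟨g * h, ?_⟩
  rw [e, map_mul, map_mul]
  refine hh.imp ?_ ?_
  · rintro ⟨h1, rfl⟩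
    exact ⟨h1, by group⟩
  · rintro ⟨h1, rfl⟩
    exact ⟨h1, by group⟩

/-- Either two points lie in the same piece, or a first wall `h` separates them and the developed
image of the second, seen from the first, lies in the triangle beyond `h`. -/
theorem dev_dichotomy {s : ℝ} {ρ' : G →* SL(3, ℝ)} (W : WallSystem C ρ P)
    (hb : IsConeBulging C ρ P s ρ') {x y : Fin 3 → ℝ} {B B' : SL(3, ℝ)} (hx : OffWall C ρ P x)
    (hy : OffWall C ρ P y) (hB : IsDev C ρ P s ρ' x B) (hB' : IsDev C ρ P s ρ' y B') :
    (∀ h : G, 0 < coord (ρ h * P) 1 x * coord (ρ h * P) 1 y) ∨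
      ∃ h : G, ∃ p ∈ C, coord (ρ h * P) 1 p = 0 ∧
        coord (ρ h * P) 1 x * coord (ρ h * P) 1 y < 0 ∧
        (∀ h' : G, coord (ρ h' * P) 1 p ≠ 0 →
          0 < coord (ρ h' * P) 1 x * coord (ρ h' * P) 1 p) ∧
        InTriangle ρ P h y ((B⁻¹ * B') • y) := by
  by_cases hall : ∀ h : G, 0 < coord (ρ h * P) 1 x * coord (ρ h * P) 1 y
  · exact Or.inl hall
  right
  push Not at hall
  obtain ⟨h₀, h0⟩ := hall
  have hC : ∀ t ∈ Icc (0 : ℝ) 1, x + t • (y - x) ∈ C := fun t ht => W.map_segment_mem hx.1 hy.1 ht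
  have e0 : x + (0 : ℝ) • (y - x) = x := by simp
  have e1 : x + (1 : ℝ) • (y - x) = y := by simp
  obtain ⟨t, ht, h, hz, hfirst⟩ := W.exists_first_wall zero_le_one hC (by rw [e0]; exact hx.2)
    (h₀ := h₀) (by rwa [e0, e1])
  have ht1 : t < 1 := lt_of_le_of_ne ht.2 (by rintro rfl; rw [e1] at hz; exact hy.2 h hz)
  refine ⟨h, _, hC t ⟨ht.1.le, ht.2⟩, hz, ?_, fun h' hne => ?_, ?_⟩
  · simp only [map_add, map_smul, map_sub, smul_eq_mul] at hz
    have hxne := hx.2 h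
    have h3 : t * coord (ρ h * P) 1 y = -((1 - t) * coord (ρ h * P) 1 x) := by linarith
    have h4 : 0 < (1 - t) * (coord (ρ h * P) 1 x * coord (ρ h * P) 1 x) :=
      mul_pos (by linarith) (mul_self_pos.2 hxne)
    have h5 : t * (coord (ρ h * P) 1 x * coord (ρ h * P) 1 y) < 0 := by
      rw [mul_left_comm, h3]; linarith
    exact neg_of_mul_neg_right h5 ht.1.le
  · have := mul_pos_of_segment (f := coord (ρ h' * P) 1) (p := x) (v := y - x) ht.1.le
      fun u hu hut => by
        rcases hut.lt_or_eq with hlt | rfl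
        · exact hfirst u hu hlt h'
        · exact hne
    rwa [e0] at this
  · have := W.dev_inTriangle hb hC (by rwa [e1]) (B' := B') (by rwa [e1]) _ 0 le_rfl zero_lt_one
      (by rw [e0]; exact hx.2) B (by rwa [e0]) le_rfl t ht.1 ht1 h hz hfirst
    rwa [e1] at this

/-- The developing map of the bulged structure is injective off the walls. -/
theorem dev_injective {s : ℝ} {ρ' : G →* SL(3, ℝ)} (W : WallSystem C ρ P)
    (hb : IsConeBulging C ρ P s ρ') {x y : Fin 3 → ℝ} {B B' : SL(3, ℝ)} (hx : OffWall C ρ P x)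
    (hy : OffWall C ρ P y) (hB : IsDev C ρ P s ρ' x B) (hB' : IsDev C ρ P s ρ' y B') {t : ℝ}
    (ht : B' • y = t • B • x) : B = B' ∧ y = t • x ∧ 0 < t := by
  have hz : (B⁻¹ * B') • y = t • x := by
    rw [mul_smul, ht, smul_comm, inv_smul_smul]
  -- In the second case a multiple of `x` would lie in the triangle beyond `h`. The positive end
  -- coordinate forces the multiple to be positive, and then `x` is on the side of `y`, which it is
  -- not.
  rcases W.dev_dichotomy hb hx hy hB hB' with hsame | ⟨h, p, -, -, hneg, -, h0, -, h1⟩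
  · have hBB := (hB.congr W hy.1 hsame).unique hb hB'
    rw [hBB, inv_mul_cancel, one_smul] at hz
    refine ⟨hBB, hz, ?_⟩
    have h1 := W.coord_zero_pos _ hy.1
    have h2 := W.coord_zero_pos _ hx.1
    rw [hz, map_smul, smul_eq_mul] at h1
    exact pos_of_mul_pos_left h1 h2.le
  · exfalso
    rw [hz, map_smul, smul_eq_mul] at h0 h1
    have ht0 : 0 < t := pos_of_mul_pos_left h0 (W.coord_wall_zero_pos h hx.1).le
    nlinarith

/-- Up to alignment finitely many walls meet a compact ball, and continuity handles these. A wall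
that misses the segment from `y` to `z` has a constant sign along it, so the neighbourhood works for
all walls at once. -/
theorem eventually_same_sign (W : WallSystem C ρ P) {y : Fin 3 → ℝ} (hy : y ∈ C) :
    ∀ᶠ z in 𝓝 y, z ∈ C ∧ ∀ h : G, coord (ρ h * P) 1 y ≠ 0 →
      0 < coord (ρ h * P) 1 y * coord (ρ h * P) 1 z := by
  obtain ⟨r, hr, hrC⟩ := Metric.nhds_basis_closedBall.mem_iff.1 (W.isOpen.mem_nhds hy)
  obtain ⟨F, hF, hFw⟩ := W.finite_walls hrC (isCompact_closedBall y r)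
  have hev : ∀ᶠ z in 𝓝 y, ∀ h ∈ F, coord (ρ h * P) 1 y ≠ 0 →
      0 < coord (ρ h * P) 1 y * coord (ρ h * P) 1 z := by
    rw [eventually_all_finite hF]
    intro h _
    by_cases h0 : coord (ρ h * P) 1 y = 0
    · simp [h0]
    · have hc : Continuous fun z => coord (ρ h * P) 1 y * coord (ρ h * P) 1 z :=
        continuous_const.mul (continuous_coord _ _)
      exact (hc.continuousAt.eventually (lt_mem_nhds (mul_self_pos.2 h0))).mono fun z hz _ => hz
  filter_upwards [hev, Metric.closedBall_mem_nhds y hr] with z hz hzb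
  refine ⟨hrC hzb, fun h h0 => ?_⟩
  by_cases hcr : ∃ t ∈ Icc (0 : ℝ) 1, coord (ρ h * P) 1 (y + t • (z - y)) = 0
  · obtain ⟨t, ht, htz⟩ := hcr
    have hmem : y + t • (z - y) ∈ Metric.closedBall y r :=
      (convex_closedBall y r).add_smul_sub_mem (Metric.mem_closedBall_self hr.le) hzb ht
    obtain ⟨h', hh', ha⟩ := hFw h ⟨_, hmem, htz⟩
    obtain ⟨k, hk, he⟩ := ha.coord_eq 1
    rw [he] at h0 ⊢
    rw [he]
    have := hz h' hh' (right_ne_zero_of_mul h0)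
    nlinarith [mul_pos (mul_pos hk hk) this]
  · push Not at hcr
    have := mul_pos_of_segment (f := coord (ρ h * P) 1) (p := y) (v := z - y) zero_le_one
      fun t h1 h2 => hcr t ⟨h1, h2⟩
    simpa using this

theorem isOpen_piece (W : WallSystem C ρ P) (σ : ℝ) : IsOpen (piece C ρ P σ) := by
  refine isOpen_iff_mem_nhds.2 fun y hy => ?_
  filter_upwards [W.eventually_same_sign hy.1] with z hz
  exact mem_piece_congr hz.1 (fun h => hz.2 h ((offWall_of_mem_piece hy).2 h)) hy

theorem eventually_axis (W : WallSystem C ρ P) {p : Fin 3 → ℝ} (hp : p ∈ C)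
    (hp1 : coord P 1 p = 0) : ∀ᶠ z in 𝓝 p, z ∈ C ∧ ∀ h : G, ¬ Aligned ρ P h →
      0 < coord (ρ h * P) 1 (axisPt P 1 1) * coord (ρ h * P) 1 z := by
  filter_upwards [W.eventually_same_sign hp] with z hz
  refine ⟨hz.1, fun h hh => ?_⟩
  have h1 := W.axis_sign hh (W.coord_zero_pos _ hp) (W.coord_two_pos _ hp)
  rw [← eq_axisPt hp1] at h1
  have hne : coord (ρ h * P) 1 p ≠ 0 := by rintro h0; simp [h0] at h1
  have h2 := hz.2 h hne
  rw [mul_comm] at h1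
  exact pos_of_mul_pos_of_mul_pos h1 h2

/-- Points of the axis are limits of points of the adjacent pieces. -/
theorem axis_subset_closure_piece (W : WallSystem C ρ P) {p : Fin 3 → ℝ} (hp : p ∈ C)
    (hp1 : coord P 1 p = 0) {σ : ℝ} (hσ : σ ≠ 0) : p ∈ closure (piece C ρ P σ) := by
  have hc : Tendsto (fun t : ℝ => p + (t * σ) • frameVec P 1) (𝓝[>] 0) (𝓝 p) := by
    have : Continuous fun t : ℝ => p + (t * σ) • frameVec P 1 := by fun_prop
    have := this.tendsto 0
    rw [zero_mul, zero_smul, add_zero] at this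
    exact this.mono_left nhdsWithin_le_nhds
  refine mem_closure_of_tendsto hc ?_
  filter_upwards [hc.eventually (W.eventually_axis hp hp1), self_mem_nhdsWithin] with t ht ht0
  refine ⟨ht.1, ?_, ht.2⟩
  have ht0 : 0 < t := ht0
  simp [hp1]
  have := mul_self_pos.2 hσ
  nlinarith [mul_pos ht0 this]

theorem piece_nonempty (W : WallSystem C ρ P) {σ : ℝ} (hσ : σ ≠ 0) : (piece C ρ P σ).Nonempty :=
  closure_nonempty_iff.1 ⟨_, W.axis_subset_closure_piece (W.axisPt_mem one_pos one_pos)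
    (by simp [coord_axisPt]) hσ⟩

/-- A point of the closed cone on a supporting line at an end of the axis is that end. -/
theorem coord_zero_pos_of_closure (W : WallSystem C ρ P) {u : Fin 3 → ℝ} (hu : u ∈ closure C)
    (h1 : coord P 1 u ≠ 0) : 0 < coord P 0 u ∧ 0 < coord P 2 u := by
  have key : ∀ i j : Fin 3, j ≠ 1 → i ≠ j → frameVec P j ∈ closure C →
      (∀ v ∈ C, 0 < coord P i v) → 0 < coord P i u := by
    intro i j hj hij hfj hpos
    refine lt_of_le_of_ne (nonneg_of_mem_closure (fun v hv => (hpos v hv).le) hu) fun h0 => ?_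
    have hli : LinearIndependent ℝ ![u, frameVec P j] := by
      rw [LinearIndependent.pair_iff]
      intro s t hst
      have e1 := congrArg (coord P 1) hst
      have ej := congrArg (coord P j) hst
      simp [coord_frameVec_ne P hj.symm, h1] at e1
      simp [e1] at ej
      exact ⟨e1, ej⟩
    -- Strict convexity: two independent vectors of the closed cone on the supporting plane would
    -- have their sum in `C`, where the coordinate is positive.
    have := hpos _ (W.add_mem _ hu _ hfj hli)
    rw [map_add, ← h0, coord_frameVec_ne P hij, add_zero] at this
    exact lt_irrefl _ this
  exact ⟨key 0 2 (by decide) (by decide) W.frameVec_two_mem W.coord_zero_pos,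
    key 2 0 (by decide) (by decide) W.frameVec_zero_mem W.coord_two_pos⟩

/-- The ratio |x₁|/(x₀ + x₂) is continuous on the compact spherical section of the closed cone,
where its denominator does not vanish. It is therefore bounded. -/
theorem exists_slope_bound (W : WallSystem C ρ P) :
    ∃ A : ℝ, 0 < A ∧ ∀ v ∈ C, 0 < coord P 1 v + A * (coord P 0 v + coord P 2 v) := by
  have hKc : IsCompact (closure C ∩ Metric.sphere 0 1) :=
    (isCompact_sphere 0 1).inter_left isClosed_closure
  have hnn : ∀ u ∈ closure C, u ≠ 0 → 0 < coord P 0 u + coord P 2 u := by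
    intro u hu hu0
    have h0 : 0 ≤ coord P 0 u := nonneg_of_mem_closure (fun v hv => (W.coord_zero_pos v hv).le) hu
    have h2 : 0 ≤ coord P 2 u := nonneg_of_mem_closure (fun v hv => (W.coord_two_pos v hv).le) hu
    refine lt_of_le_of_ne (by positivity) fun hz => ?_
    by_cases h1 : coord P 1 u = 0
    · refine hu0 (coord_ext P fun i => ?_)
      rw [map_zero]
      fin_cases i
      · change coord P 0 u = 0; linarith
      · exact h1
      · change coord P 2 u = 0; linarith
    · have := W.coord_zero_pos_of_closure hu h1
      linarith
  have hcont : ContinuousOn (fun u => |coord P 1 u| / (coord P 0 u + coord P 2 u))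
      (closure C ∩ Metric.sphere 0 1) := by
    refine ContinuousOn.div (continuous_coord P 1).abs.continuousOn
      ((continuous_coord P 0).add (continuous_coord P 2)).continuousOn fun u hu => ?_
    exact (hnn u hu.1 (by rintro rfl; simpa using hu.2)).ne'
  obtain ⟨A, hA⟩ := (hKc.image_of_continuousOn hcont).bddAbove
  -- The shift makes the constant positive and the inequality strict.
  refine ⟨max A 0 + 1, by positivity, fun v hv => ?_⟩
  have hpos : 0 < coord P 0 v + coord P 2 v := by
    have := W.coord_zero_pos v hv
    have := W.coord_two_pos v hv
    linarith
  have hv0 : v ≠ 0 := by rintro rfl; simp at hpos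
  have hn : 0 < ‖v‖ := norm_pos_iff.2 hv0
  have hmem : ‖v‖⁻¹ • v ∈ closure C ∩ Metric.sphere 0 1 :=
    ⟨W.smul_mem_closure (by positivity) (subset_closure hv), by simp [norm_smul, hn.ne']⟩
  have hle : |coord P 1 (‖v‖⁻¹ • v)| / (coord P 0 (‖v‖⁻¹ • v) + coord P 2 (‖v‖⁻¹ • v)) ≤ A :=
    hA (mem_image_of_mem _ hmem)
  have heq : |coord P 1 (‖v‖⁻¹ • v)| / (coord P 0 (‖v‖⁻¹ • v) + coord P 2 (‖v‖⁻¹ • v)) =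
      |coord P 1 v| / (coord P 0 v + coord P 2 v) := by
    simp only [map_smul, smul_eq_mul, abs_mul, abs_inv, abs_norm, ← mul_add]
    exact mul_div_mul_left _ _ (by positivity)
  rw [heq, div_le_iff₀ hpos] at hle
  have h1 : A ≤ max A 0 := le_max_left _ _
  have h2 := neg_abs_le (coord P 1 v)
  nlinarith

theorem isDev_one {s : ℝ} {ρ' : G →* SL(3, ℝ)} {x : Fin 3 → ℝ} (hx : x ∈ piece C ρ P (-1)) :
    IsDev C ρ P s ρ' x 1 :=
  ⟨1, Or.inl ⟨by simpa using hx, by simp⟩⟩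

/-- Turns an arbitrary supporting line that stays away from the far vertex into a line of the form
x₁ + A(x₀ + x₂) = 0, which `O_s` scales in a simple way. -/
theorem exists_slope_of_functional {f : (Fin 3 → ℝ) →ₗ[ℝ] ℝ} (hf0 : 0 ≤ f (frameVec P 0))
    (hf1 : 0 < f (frameVec P 1)) (hf2 : 0 ≤ f (frameVec P 2)) :
    ∃ A : ℝ, 0 < A ∧ ∀ z, 0 < coord P 0 z → 0 < coord P 2 z → 0 < f z →
      0 < coord P 1 z + A * (coord P 0 z + coord P 2 z) := by
  refine ⟨(f (frameVec P 0) + f (frameVec P 2) + 1) / f (frameVec P 1), by positivity,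
    fun z b0 b2 h3 => ?_⟩
  rw [apply_eq_sum_coord P f] at h3
  generalize coord P 0 z = z0 at *
  generalize coord P 1 z = z1 at *
  generalize coord P 2 z = z2 at *
  have h5 : z1 + (f (frameVec P 0) + f (frameVec P 2) + 1) / f (frameVec P 1) * (z0 + z2) =
      (z1 * f (frameVec P 1) + (f (frameVec P 0) + f (frameVec P 2) + 1) * (z0 + z2)) /
        f (frameVec P 1) := by field_simp
  rw [h5]
  refine div_pos ?_ hf1
  nlinarith [mul_nonneg b0.le hf2, mul_nonneg b2.le hf0]

/-- Triangles beyond walls lie between the supporting lines at the ends of the axis. -/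
theorem strip_of_inTriangle (W : WallSystem C ρ P) {x y z : Fin 3 → ℝ}
    (hx : x ∈ piece C ρ P (-1)) {h : G} (hxy : coord (ρ h * P) 1 x * coord (ρ h * P) 1 y < 0)
    (hz : InTriangle ρ P h y z) :
    0 < coord P 0 z ∧ 0 < coord P 2 z ∧ (Aligned ρ P h → 0 < coord P 1 z) := by
  have hx1 : coord P 1 x < 0 := by have := hx.2.1; linarith
  by_cases ha : Aligned ρ P h
  · obtain ⟨z0, z2, z1⟩ := hz
    obtain ⟨k0, hk0, e0⟩ := ha 0
    obtain ⟨k1, hk1, e1⟩ := ha 1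
    obtain ⟨k2, hk2, e2⟩ := ha 2
    rw [e0] at z0
    rw [e2] at z2
    refine ⟨pos_of_mul_pos_right z0 hk0.le, pos_of_mul_pos_right z2 hk2.le, fun _ => ?_⟩
    rw [mul_comm] at hxy
    have h3 := neg_of_mul_pos_of_mul_neg z1 hxy
    rw [e1, e1] at h3
    have h4 : 0 < (k1 * k1) * coord P 1 z * (-coord P 1 x) := by nlinarith
    have h5 : 0 < (k1 * k1) * coord P 1 z := pos_of_mul_pos_left h4 (by linarith)
    exact pos_of_mul_pos_right h5 (by positivity)
  · have h1 := hx.2.2 h ha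
    have h2 : coord (ρ h * P) 1 y * coord (ρ h * P) 1 (axisPt P 1 1) < 0 := by
      rw [mul_comm] at h1 ⊢
      exact neg_of_mul_pos_of_mul_neg h1 hxy
    have h3 := W.coord_pos_of_inTriangle (g := 1) (W.axisPt_mem one_pos one_pos)
      (by simp [coord_axisPt]) h2 hz
    rw [coord_map_one, coord_map_one] at h3
    exact ⟨h3.1, h3.2, fun h => absurd h ha⟩

/-- Seen from the unbulged piece K₁, an image either stays in `C` or lies in a triangle beyond some
wall, and those triangles are between the supporting lines at the ends of the axis. -/
theorem dev_strip {s : ℝ} {ρ' : G →* SL(3, ℝ)} (W : WallSystem C ρ P)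
    (hb : IsConeBulging C ρ P s ρ') {y : Fin 3 → ℝ} {B : SL(3, ℝ)} (hy : OffWall C ρ P y)
    (hB : IsDev C ρ P s ρ' y B) : 0 < coord P 0 (B • y) ∧ 0 < coord P 2 (B • y) := by
  obtain ⟨x, hx⟩ := W.piece_nonempty (σ := -1) (by norm_num)
  rcases W.dev_dichotomy hb (offWall_of_mem_piece hx) hy (isDev_one hx) hB with
    hsame | ⟨h, q, hq, hqz, hneg, hqs, hT⟩
  · rw [← (isDev_one hx).congr W hy.1 hsame |>.unique hb hB, one_smul]
    exact ⟨W.coord_zero_pos _ hy.1, W.coord_two_pos _ hy.1⟩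
  · rw [inv_one, one_mul] at hT
    obtain ⟨h0, h2, -⟩ := W.strip_of_inTriangle hx hneg hT
    exact ⟨h0, h2⟩

/-- If a wall `g` bounds the piece of `x` besides the axis, then the developed image lies on one
side of the supporting line at an end of `g`. -/
theorem dev_coord_pos {s : ℝ} {ρ' : G →* SL(3, ℝ)} (W : WallSystem C ρ P)
    (hb : IsConeBulging C ρ P s ρ') {x p y : Fin 3 → ℝ} (hx : x ∈ piece C ρ P (-1)) {g : G}
    (hpC : p ∈ C) (hz : coord (ρ g * P) 1 p = 0)
    (hs : ∀ h' : G, coord (ρ h' * P) 1 p ≠ 0 → 0 < coord (ρ h' * P) 1 x * coord (ρ h' * P) 1 p)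
    {B : SL(3, ℝ)} (hy : OffWall C ρ P y) (hB : IsDev C ρ P s ρ' y B) :
    0 < coord (ρ g * P) 0 (B • y) := by
  rcases W.dev_dichotomy hb (offWall_of_mem_piece hx) hy (isDev_one hx) hB with
    hsame | ⟨h, q, hq, hqz, hneg, hqs, hT⟩
  · rw [← (isDev_one hx).congr W hy.1 hsame |>.unique hb hB, one_smul]
    exact W.coord_wall_zero_pos g hy.1
  · rw [inv_one, one_mul] at hT
    by_cases hh : coord (ρ h * P) 1 p = 0
    · obtain ⟨k, hk, e⟩ := (W.aligned_of_mem hpC hh hz).coord_eq 0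
      rw [e]
      exact mul_pos hk hT.1
    · refine (W.coord_pos_of_inTriangle hpC hz ?_ hT).1
      have := neg_of_mul_pos_of_mul_neg (hs h hh) hneg
      rwa [mul_comm]

/-- The functional vanishes at the second end of `g`, whose coordinates on the axis ends are
positive and whose middle coordinate is negative. As it is nonnegative at the axis ends and not
zero, it must be positive at the middle vertex. This is the hypothesis of
`exists_slope_of_functional`. -/
theorem coord_wall_frameVec_one_pos (W : WallSystem C ρ P) {g : G} {p : Fin 3 → ℝ} (hpC : p ∈ C)
    (hz : coord (ρ g * P) 1 p = 0) (hp1 : coord P 1 p < 0) :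
    0 < coord (ρ g * P) 0 (frameVec P 1) := by
  have huC : frameVec (ρ g * P) 2 ∈ closure C := W.frameVec_wall_two_mem g
  have hfu : coord (ρ g * P) 0 (frameVec (ρ g * P) 2) = 0 := coord_frameVec_ne _ (by decide)
  have hne := coord_ne_zero_map (ρ g * P) 0
  have hf0 : 0 ≤ coord (ρ g * P) 0 (frameVec P 0) :=
    W.coord_wall_zero_nonneg g W.frameVec_zero_mem
  have hf2 : 0 ≤ coord (ρ g * P) 0 (frameVec P 2) :=
    W.coord_wall_zero_nonneg g W.frameVec_two_mem
  have hu1 : coord P 1 (frameVec (ρ g * P) 2) < 0 := by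
    have := W.endpoint_sign (g := g) (h := 1) hpC hz (by rw [coord_map_one]; exact hp1.ne)
      (i := 2) (by decide)
    rw [coord_map_one] at this
    nlinarith
  generalize coord (ρ g * P) 0 = f at *
  generalize frameVec (ρ g * P) 2 = u at *
  have huv := W.coord_zero_pos_of_closure huC hu1.ne
  have hsum := apply_eq_sum_coord P f u
  by_contra hcon
  push Not at hcon
  have a0 := mul_nonneg huv.1.le hf0
  have a2 := mul_nonneg huv.2.le hf2
  have a1 : 0 ≤ coord P 1 u * f (frameVec P 1) := mul_nonneg_of_nonpos_of_nonpos hu1.le hcon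
  have e0 : f (frameVec P 0) = 0 :=
    (mul_eq_zero.1 (show coord P 0 u * f (frameVec P 0) = 0 by linarith)).resolve_left huv.1.ne'
  have e2 : f (frameVec P 2) = 0 :=
    (mul_eq_zero.1 (show coord P 2 u * f (frameVec P 2) = 0 by linarith)).resolve_left huv.2.ne'
  have e1 : f (frameVec P 1) = 0 :=
    (mul_eq_zero.1 (show coord P 1 u * f (frameVec P 1) = 0 by linarith)).resolve_left hu1.ne
  refine hne (LinearMap.ext fun w => ?_)
  rw [apply_eq_sum_coord P f w, e0, e1, e2]
  simp

/-- If the side of the axis is a single piece, the slope bound for `C` holds for the developed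
image as well. -/
theorem dev_slope {s : ℝ} {ρ' : G →* SL(3, ℝ)} (W : WallSystem C ρ P)
    (hb : IsConeBulging C ρ P s ρ') (hside : ∀ y ∈ C, coord P 1 y < 0 → y ∈ piece C ρ P (-1))
    {A : ℝ} (hA : 0 < A) (hAC : ∀ v ∈ C, 0 < coord P 1 v + A * (coord P 0 v + coord P 2 v))
    {y : Fin 3 → ℝ} {B : SL(3, ℝ)} (hy : OffWall C ρ P y) (hB : IsDev C ρ P s ρ' y B) :
    0 < coord P 1 (B • y) + A * (coord P 0 (B • y) + coord P 2 (B • y)) := by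
  obtain ⟨x, hx⟩ := W.piece_nonempty (σ := -1) (by norm_num)
  have hx1 : coord P 1 x < 0 := by have := hx.2.1; linarith
  rcases W.dev_dichotomy hb (offWall_of_mem_piece hx) hy (isDev_one hx) hB with
    hsame | ⟨h, p, hp, hz, hneg, hs, hT⟩
  · rw [← (isDev_one hx).congr W hy.1 hsame |>.unique hb hB, one_smul]
    exact hAC y hy.1
  · rw [inv_one, one_mul] at hT
    obtain ⟨h0, h2, h1⟩ := W.strip_of_inTriangle hx hneg hT
    -- A first wall other than the axis would be met at a point on the same side of the axis as `x`.
    -- That side is a single piece, which no wall meets.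
    have ha : Aligned ρ P h := by
      by_contra ha
      by_cases hp1 : coord P 1 p = 0
      · have := W.aligned_of_mem (g := 1) hp (by rwa [coord_map_one]) hz
        rw [inv_one, one_mul] at this
        exact ha this
      · have h3 := hs 1 (by rwa [coord_map_one])
        rw [coord_map_one] at h3
        have h4 := (hside p hp (by nlinarith)).2.2 h ha
        rw [hz, mul_zero] at h4
        exact lt_irrefl _ h4
    have h1 := h1 ha
    exact add_pos h1 (mul_pos hA (add_pos h0 h2))

/-- The developed image is contained in a triangle that does not depend on the deformation. -/
theorem exists_triangle (W : WallSystem C ρ P) :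
    ∃ A : ℝ, 0 < A ∧ ∀ (s : ℝ) (ρ' : G →* SL(3, ℝ)), IsConeBulging C ρ P s ρ' →
      ∀ (y : Fin 3 → ℝ) (B : SL(3, ℝ)), OffWall C ρ P y → IsDev C ρ P s ρ' y B →
        0 < coord P 0 (B • y) ∧ 0 < coord P 2 (B • y) ∧
          0 < coord P 1 (B • y) + A * (coord P 0 (B • y) + coord P 2 (B • y)) := by
  obtain ⟨x, hx⟩ := W.piece_nonempty (σ := -1) (by norm_num)
  have hxo := offWall_of_mem_piece hx
  have hx1 : coord P 1 x < 0 := by have := hx.2.1; linarith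
  -- If the K₁ side of the axis is one piece, the slope bound of `C` itself works. Otherwise another
  -- wall `g` bounds K₁, and the supporting line of `C` at an end of `g` closes the triangle. In
  -- both cases the bound involves only data independent of s.
  by_cases hside : ∀ y ∈ C, coord P 1 y < 0 → y ∈ piece C ρ P (-1)
  · obtain ⟨A, hA, hAC⟩ := W.exists_slope_bound
    refine ⟨A, hA, fun s ρ' hb y B hy hB => ?_⟩
    obtain ⟨h0, h2⟩ := W.dev_strip hb hy hB
    exact ⟨h0, h2, W.dev_slope hb hside hA hAC hy hB⟩
  · push Not at hside
    obtain ⟨y₀, hy₀, hy₀1, hy₀p⟩ := hside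
    have hex : ∃ h₀ : G, coord (ρ h₀ * P) 1 x * coord (ρ h₀ * P) 1 y₀ ≤ 0 := by
      by_contra hcon
      push Not at hcon
      exact hy₀p (mem_piece_congr hy₀ hcon hx)
    obtain ⟨h₀, hh₀⟩ := hex
    obtain ⟨t, ht, g, hz, hfirst⟩ := W.exists_first_wall (p := x) (v := y₀ - x) zero_le_one
      (fun t ht => W.map_segment_mem hxo.1 hy₀ ht) (fun h => by simpa using hxo.2 h) (h₀ := h₀)
      (by simpa using hh₀)
    have hpC : x + t • (y₀ - x) ∈ C := W.map_segment_mem hxo.1 hy₀ ⟨ht.1.le, ht.2⟩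
    have hs : ∀ h' : G, coord (ρ h' * P) 1 (x + t • (y₀ - x)) ≠ 0 →
        0 < coord (ρ h' * P) 1 x * coord (ρ h' * P) 1 (x + t • (y₀ - x)) := fun h' hne => by
      have := mul_pos_of_segment (f := coord (ρ h' * P) 1) (p := x) (v := y₀ - x) ht.1.le
        fun u hu hut => by
          rcases hut.lt_or_eq with hlt | rfl
          · exact hfirst u hu hlt h'
          · exact hne
      rwa [zero_smul, add_zero] at this
    have hp1 : coord P 1 (x + t • (y₀ - x)) < 0 := by
      have : coord P 1 (x + t • (y₀ - x)) = (1 - t) * coord P 1 x + t * coord P 1 y₀ := by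
        simp; ring
      rw [this]
      nlinarith [ht.1, ht.2]
    obtain ⟨A, hA, hAf⟩ := exists_slope_of_functional (P := P) (f := coord (ρ g * P) 0)
      (W.coord_wall_zero_nonneg g W.frameVec_zero_mem) (W.coord_wall_frameVec_one_pos hpC hz hp1)
      (W.coord_wall_zero_nonneg g W.frameVec_two_mem)
    refine ⟨A, hA, fun s ρ' hb y B hy hB => ?_⟩
    obtain ⟨h0, h2⟩ := W.dev_strip hb hy hB
    exact ⟨h0, h2, hAf _ h0 h2 (W.dev_coord_pos hb hx hpC hz hs hy hB)⟩

end WallSystem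
end

/-! ### The cone over the bulged domain and separation of orbits -/

noncomputable section
namespace WallSystem

variable {G : Type*} [Group G] {C : Set (Fin 3 → ℝ)} {ρ : G →* SL(3, ℝ)} {P : SL(3, ℝ)}

/-- The cone over two adjacent pieces and the axis, with the second piece bulged. -/
def bulgedPiece (C : Set (Fin 3 → ℝ)) (ρ : G →* SL(3, ℝ)) (P : SL(3, ℝ)) (s : ℝ) :
    Set (Fin 3 → ℝ) :=
  piece C ρ P (-1) ∪ {v ∈ C | coord P 1 v = 0} ∪ bulge P s • piece C ρ P 1

/-- The cone over the bulged domain. -/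
def bulgedCone (C : Set (Fin 3 → ℝ)) (ρ : G →* SL(3, ℝ)) (P : SL(3, ℝ)) (s : ℝ)
    (ρ' : G →* SL(3, ℝ)) : Set (Fin 3 → ℝ) :=
  ⋃ h : G, ρ' h • bulgedPiece C ρ P s

/-- The two eigenvalues of `O_s` at the ends coincide, so the axis is fixed pointwise in the
projective plane. This is why the bulged side can be glued back along it. -/
theorem _root_.bulge_smul_axis {P : SL(3, ℝ)} (s : ℝ) {v : Fin 3 → ℝ}
    (h1 : coord P 1 v = 0) : bulge P s • v = Real.exp (-s / 3) • v := by
  refine coord_ext P fun i => ?_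
  rw [coord_bulge, LinearMap.map_smul, smul_eq_mul]
  fin_cases i
  · rfl
  · change _ * coord P 1 v = _ * coord P 1 v
    rw [h1, mul_zero, mul_zero]
  · rfl

/-- Only points of the axis need an argument. A nearby point on the negative side is in K₁, and one
on the positive side becomes a point of K₂ after `O_s⁻¹`, which keeps it near the axis. -/
theorem isOpen_bulgedPiece (W : WallSystem C ρ P) (s : ℝ) : IsOpen (bulgedPiece C ρ P s) := by
  refine isOpen_iff_mem_nhds.2 fun z hz => ?_
  rcases hz with (hz | ⟨hz, hz1⟩) | hz
  · exact mem_of_superset ((W.isOpen_piece _).mem_nhds hz) fun w hw => Or.inl (Or.inl hw)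
  · have hz' : bulge P (-s) • z ∈ C := by
      rw [bulge_smul_axis (-s) hz1]
      exact W.smul_mem _ (Real.exp_pos _) _ hz
    have hz1' : coord P 1 (bulge P (-s) • z) = 0 := by
      rw [coord_bulge, hz1, mul_zero]
    have hc : Continuous fun w : Fin 3 → ℝ => bulge P (-s) • w := continuous_const_smul _
    filter_upwards [W.eventually_axis hz hz1,
      hc.continuousAt.eventually (W.eventually_axis hz' hz1')] with w hw hw'
    rcases lt_trichotomy (coord P 1 w) 0 with h | h | h
    · exact Or.inl (Or.inl ⟨hw.1, by linarith, hw.2⟩)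
    · exact Or.inl (Or.inr ⟨hw.1, h⟩)
    · refine Or.inr ⟨bulge P (-s) • w, ⟨hw'.1, ?_, hw'.2⟩, ?_⟩
      · rw [one_mul, coord_bulge]
        exact mul_pos (Real.exp_pos _) h
      · change bulge P s • bulge P (-s) • w = w
        rw [← bulge_inv, smul_inv_smul]
  · exact mem_of_superset (((W.isOpen_piece 1).smul _).mem_nhds hz) fun w hw => Or.inr hw

theorem isOpen_bulgedCone (W : WallSystem C ρ P) (s : ℝ) (ρ' : G →* SL(3, ℝ)) :
    IsOpen (bulgedCone C ρ P s ρ') :=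
  isOpen_iUnion fun _ => (W.isOpen_bulgedPiece s).smul _

/-- The points of the bulged cone off the walls. -/
def devCone (C : Set (Fin 3 → ℝ)) (ρ : G →* SL(3, ℝ)) (P : SL(3, ℝ)) (s : ℝ)
    (ρ' : G →* SL(3, ℝ)) : Set (Fin 3 → ℝ) :=
  {z | ∃ y B, OffWall C ρ P y ∧ IsDev C ρ P s ρ' y B ∧ z = B • y}

variable {s : ℝ} {ρ' : G →* SL(3, ℝ)}

theorem isDev_of_mem_piece_one {y : Fin 3 → ℝ} (hy : y ∈ piece C ρ P 1) :
    IsDev C ρ P s ρ' y (bulge P s) :=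
  ⟨1, Or.inr ⟨by simpa using hy, by simp⟩⟩

theorem smul_mem_devCone (W : WallSystem C ρ P) {z : Fin 3 → ℝ} (hz : z ∈ devCone C ρ P s ρ')
    (g : G) : ρ' g • z ∈ devCone C ρ P s ρ' := by
  obtain ⟨y, B, hy, hB, rfl⟩ := hz
  refine ⟨_, _, hy.smul W g, hB.smul g, ?_⟩
  rw [mul_smul, mul_smul, inv_smul_smul]

theorem mem_bulgedCone_cases (W : WallSystem C ρ P) {z : Fin 3 → ℝ}
    (hz : z ∈ bulgedCone C ρ P s ρ') :
    z ∈ devCone C ρ P s ρ' ∨ ∃ h : G, ∃ v ∈ C, coord P 1 v = 0 ∧ z = ρ' h • v := by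
  obtain ⟨h, w, hw, rfl⟩ := mem_iUnion.1 hz
  rcases hw with (hw | hw) | ⟨y, hy, rfl⟩
  · exact Or.inl (smul_mem_devCone W ⟨w, 1, offWall_of_mem_piece hw, isDev_one hw,
      (one_smul _ _).symm⟩ h)
  · exact Or.inr ⟨h, w, hw.1, hw.2, rfl⟩
  · exact Or.inl (smul_mem_devCone W ⟨y, _, offWall_of_mem_piece hy, isDev_of_mem_piece_one hy,
      rfl⟩ h)

theorem bulgedCone_subset_closure (W : WallSystem C ρ P) :
    bulgedCone C ρ P s ρ' ⊆ closure (devCone C ρ P s ρ') := by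
  intro z hz
  rcases W.mem_bulgedCone_cases hz with h | ⟨h, v, hv, hv1, rfl⟩
  · exact subset_closure h
  · have := W.axis_subset_closure_piece hv hv1 (σ := -1) (by norm_num)
    refine _root_.map_mem_closure (continuous_const_smul (ρ' h)) this fun w hw => ?_
    exact smul_mem_devCone W ⟨w, 1, offWall_of_mem_piece hw, isDev_one hw, (one_smul _ _).symm⟩ h

/-- Density of the points off the walls gives a weak inequality. It is strict because the cone is
open: subtracting a small multiple of a point where `f` is positive stays in the cone. -/
theorem pos_on_bulgedCone (W : WallSystem C ρ P) {f : (Fin 3 → ℝ) →ₗ[ℝ] ℝ}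
    (hf : ∀ z ∈ devCone C ρ P s ρ', 0 < f z) {z : Fin 3 → ℝ} (hz : z ∈ bulgedCone C ρ P s ρ') :
    0 < f z := by
  have hcont : Continuous f := LinearMap.continuous_of_finiteDimensional f
  have hnn : ∀ z ∈ bulgedCone C ρ P s ρ', 0 ≤ f z := fun z hz =>
    closure_minimal (fun w hw => (hf w hw).le) (isClosed_le continuous_const hcont)
      (W.bulgedCone_subset_closure hz)
  obtain ⟨x, hx⟩ := W.piece_nonempty (σ := -1) (by norm_num)
  have hfx : 0 < f x := hf x ⟨x, 1, offWall_of_mem_piece hx, isDev_one hx, (one_smul _ _).symm⟩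
  have hc : Tendsto (fun t : ℝ => z - t • x) (𝓝[>] 0) (𝓝 z) := by
    have : Continuous fun t : ℝ => z - t • x := by fun_prop
    have := this.tendsto 0
    rw [zero_smul, sub_zero] at this
    exact this.mono_left nhdsWithin_le_nhds
  obtain ⟨t, ht, ht0⟩ := ((hc.eventually ((W.isOpen_bulgedCone s ρ').mem_nhds hz)).and
    self_mem_nhdsWithin).exists
  have ht0 : 0 < t := ht0
  have := hnn _ ht
  simp at this
  have := mul_pos ht0 hfx
  linarith

/-- The action is free and properly discontinuous on rays. -/
theorem exists_separated_nhds (W : WallSystem C ρ P) {y : Fin 3 → ℝ} (hy : y ∈ C) :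
    ∃ N : Set (Fin 3 → ℝ), IsOpen N ∧ y ∈ N ∧ N ⊆ C ∧
      ∀ h : G, h ≠ 1 → ∀ w ∈ N, ∀ t : ℝ, 0 < t → t • ρ h • w ∉ N := by
  obtain ⟨α, hα⟩ := W.exists_pos
  have hα' : ∀ v ∈ C, 0 < α v := fun v hv => hα v (subset_closure hv) (by
    rintro rfl
    simpa using W.coord_zero_pos 0 hv)
  obtain ⟨r, hr, hrC⟩ := Metric.nhds_basis_closedBall.mem_iff.1 (W.isOpen.mem_nhds hy)
  have hfin := W.proper _ hrC (isCompact_closedBall y r)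
  set Φ := {h : G | ∃ v ∈ Metric.closedBall y r, ∃ w ∈ Metric.closedBall y r, ∃ t : ℝ, 0 < t ∧
    ρ h • v = t • w}
  -- Dividing by the positive functional `α` picks one vector on each ray. Equality of rays becomes
  -- equality of vectors, and continuity applies to the finitely many remaining group elements.
  have hev : ∀ᶠ q : (Fin 3 → ℝ) × (Fin 3 → ℝ) in 𝓝 (y, y), ∀ h ∈ Φ, h ≠ 1 →
      (α (ρ h • q.1))⁻¹ • ρ h • q.1 ≠ (α q.2)⁻¹ • q.2 := by
    rw [eventually_all_finite hfin]
    intro h _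
    by_cases h1 : h = 1
    · simp [h1]
    have c1 : ContinuousAt (fun q : (Fin 3 → ℝ) × (Fin 3 → ℝ) =>
        (α (ρ h • q.1))⁻¹ • ρ h • q.1) (y, y) := by
      have hc : Continuous fun q : (Fin 3 → ℝ) × (Fin 3 → ℝ) => ρ h • q.1 :=
        (continuous_const_smul (ρ h)).comp continuous_fst
      have ha : ContinuousAt (fun q : (Fin 3 → ℝ) × (Fin 3 → ℝ) => α (ρ h • q.1)) (y, y) :=
        (α.continuous.comp hc).continuousAt
      exact (ha.inv₀ (hα' _ (W.map_mem h y hy)).ne').smul hc.continuousAt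
    have c2 : ContinuousAt (fun q : (Fin 3 → ℝ) × (Fin 3 → ℝ) => (α q.2)⁻¹ • q.2) (y, y) := by
      have ha : ContinuousAt (fun q : (Fin 3 → ℝ) × (Fin 3 → ℝ) => α q.2) (y, y) :=
        (α.continuous.comp continuous_snd).continuousAt
      exact (ha.inv₀ (hα' _ hy).ne').smul continuous_snd.continuousAt
    have hne : (α (ρ h • y))⁻¹ • ρ h • y ≠ (α y)⁻¹ • y := by
      intro heq
      have hp := hα' _ (W.map_mem h y hy)
      refine h1 (W.free h y hy (α (ρ h • y) * (α y)⁻¹) (mul_pos hp (inv_pos.2 (hα' _ hy))) ?_)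
      rw [mul_smul, ← heq, smul_inv_smul₀ hp.ne']
    exact ((c1.sub c2).eventually_ne (sub_ne_zero.2 hne)).mono fun q hq _ => sub_ne_zero.1 hq
  obtain ⟨U, hU, V, hV, hUV⟩ := mem_nhds_prod_iff.1 hev
  obtain ⟨N, hNsub, hNo, hyN⟩ := mem_nhds_iff.1
    (inter_mem (inter_mem hU hV) (Metric.closedBall_mem_nhds y hr))
  refine ⟨N, hNo, hyN, fun w hw => hrC (hNsub hw).2, fun h h1 w hw t ht hmem => ?_⟩
  have hΦ : h ∈ Φ := ⟨w, (hNsub hw).2, _, (hNsub hmem).2, t⁻¹, inv_pos.2 ht, by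
    rw [inv_smul_smul₀ ht.ne']⟩
  have := hUV (mk_mem_prod (hNsub hw).1.1 (hNsub hmem).1.2) h hΦ h1
  apply this
  simp only [map_smul, smul_eq_mul, mul_inv, mul_smul]
  rw [smul_comm (α (ρ h • w))⁻¹ t, smul_smul t⁻¹ t, inv_mul_cancel₀ ht.ne', one_smul]

/-- The translates of a separated neighbourhood are disjoint nonempty open sets in a separable
space. -/
theorem countable_group (W : WallSystem C ρ P) : Countable G := by
  have hp0 := W.axisPt_mem one_pos one_pos
  obtain ⟨N, hNo, hyN, hNC, hsep⟩ := W.exists_separated_nhds hp0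
  have : (univ : Set G).Countable := by
    refine Set.PairwiseDisjoint.countable_of_isOpen (s := fun h => ρ h • N) ?_
      (fun h _ => hNo.smul _) fun h _ => ⟨_, smul_mem_smul_set hyN⟩
    intro g _ h _ hgh
    refine Set.disjoint_left.2 ?_
    rintro _ ⟨w, hw, rfl⟩ ⟨w', hw', heq⟩
    refine hsep (h⁻¹ * g) (fun h1 => hgh (inv_mul_eq_one.1 h1).symm) w hw 1 one_pos ?_
    have heq : ρ h • w' = ρ g • w := heq
    rw [one_smul, map_mul, map_inv, mul_smul, ← heq, inv_smul_smul]
    exact hw'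
  exact countable_univ_iff.1 this

end WallSystem
end

/-! ### Fundamental domains, projectivized cones and a chart for the triangle -/

noncomputable section

/-- Disjointness from its translates and countable covering yield a fundamental domain. -/
theorem exists_isFundamentalDomain {Γ X : Type*} [Group Γ] [Countable Γ] [MulAction Γ X]
    [MeasurableSpace X] [MeasurableConstSMul Γ X] (μ : Measure X) [SMulInvariantMeasure Γ X μ]
    (V : ℕ → Set X) (hV : ∀ n, MeasurableSet (V n))
    (hdisj : ∀ n, ∀ g : Γ, g ≠ 1 → Disjoint (g • V n) (V n))
    (hcov : ∀ᵐ x ∂μ, ∃ n, ∃ g : Γ, g • x ∈ V n) : ∃ F, IsFundamentalDomain Γ F μ := by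
  -- Each `V n` loses all translates of its predecessors. An orbit then meets the union in the first
  -- `V n` that it reaches, and there only once.
  refine ⟨⋃ n, V n \ ⋃ m < n, ⋃ g : Γ, g • V m, IsFundamentalDomain.mk'' ?_ ?_ ?_ ?_⟩
  · refine (MeasurableSet.iUnion fun n => (hV n).diff ?_).nullMeasurableSet
    exact MeasurableSet.iUnion fun m => MeasurableSet.iUnion fun _ =>
      MeasurableSet.iUnion fun g => (hV m).const_smul g
  · filter_upwards [hcov] with x hx
    classical
    obtain ⟨g, hg⟩ := Nat.find_spec hx
    refine ⟨g, mem_iUnion.2 ⟨Nat.find hx, hg, fun hmem => ?_⟩⟩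
    obtain ⟨m, hm, h, y, hy, heq⟩ : ∃ m, ∃ _ : m < Nat.find hx, ∃ h : Γ, ∃ y ∈ V m,
        h • y = g • x := by
      simpa [mem_smul_set] using hmem
    refine Nat.find_min hx hm ⟨h⁻¹ * g, ?_⟩
    rw [mul_smul, ← heq, inv_smul_smul]
    exact hy
  · intro g hg
    refine Disjoint.aedisjoint (Set.disjoint_left.2 ?_)
    rintro _ ⟨y, hy, rfl⟩ hx
    change g • y ∈ _ at hx
    obtain ⟨m, hym, hy'⟩ := mem_iUnion.1 hy
    obtain ⟨n, hxn, hx'⟩ := mem_iUnion.1 hx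
    rcases lt_trichotomy m n with h | rfl | h
    · exact hx' (mem_iUnion₂.2 ⟨m, h, mem_iUnion.2 ⟨g, smul_mem_smul_set hym⟩⟩)
    · exact Set.disjoint_left.1 (hdisj m g hg) (smul_mem_smul_set hym) hxn
    · refine hy' (mem_iUnion₂.2 ⟨n, h, mem_iUnion.2 ⟨g⁻¹, ?_⟩⟩)
      rw [mem_smul_set_iff_inv_smul_mem, inv_inv]
      exact hxn
  · exact fun g => (measurePreserving_smul g μ).quasiMeasurePreserving

/-- The set of points of the projective plane represented by vectors of `S`. -/
def projSet (S : Set (Fin 3 → ℝ)) : Set RP2 :=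
  {x | ∃ v, ∃ hv : v ≠ 0, v ∈ S ∧ (Projectivization.mk ℝ v hv : RP2) = x}

theorem mk_mem_projSet {S : Set (Fin 3 → ℝ)} {v : Fin 3 → ℝ} (hv : v ≠ 0) :
    (Projectivization.mk ℝ v hv : RP2) ∈ projSet S ↔ ∃ c : ℝ, c ≠ 0 ∧ c • v ∈ S := by
  constructor
  · rintro ⟨w, hw, hwS, h⟩
    obtain ⟨c, hc, rfl⟩ := (mk_eq_mk_iff_smul hw hv).1 h
    exact ⟨c, hc, hwS⟩
  · rintro ⟨c, hc, h⟩
    exact ⟨c • v, smul_ne_zero hc hv, h, (mk_eq_mk_iff_smul _ _).2 ⟨c, hc, rfl⟩⟩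

theorem projSet_mono {S T : Set (Fin 3 → ℝ)} (h : S ⊆ T) : projSet S ⊆ projSet T :=
  fun _ ⟨v, hv, hS, hx⟩ => ⟨v, hv, h hS, hx⟩

theorem projSet_union (S T : Set (Fin 3 → ℝ)) : projSet (S ∪ T) = projSet S ∪ projSet T := by
  ext x
  constructor
  · rintro ⟨v, hv, h | h, hx⟩
    exacts [Or.inl ⟨v, hv, h, hx⟩, Or.inr ⟨v, hv, h, hx⟩]
  · rintro (⟨v, hv, h, hx⟩ | ⟨v, hv, h, hx⟩)
    exacts [⟨v, hv, Or.inl h, hx⟩, ⟨v, hv, Or.inr h, hx⟩]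

theorem projSet_iUnion {ι : Sort*} (S : ι → Set (Fin 3 → ℝ)) :
    projSet (⋃ i, S i) = ⋃ i, projSet (S i) := by
  ext x
  constructor
  · rintro ⟨v, hv, h, hx⟩
    obtain ⟨i, hi⟩ := mem_iUnion.1 h
    exact mem_iUnion.2 ⟨i, v, hv, hi, hx⟩
  · intro h
    obtain ⟨i, v, hv, hi, hx⟩ := mem_iUnion.1 h
    exact ⟨v, hv, mem_iUnion.2 ⟨i, hi⟩, hx⟩

theorem projSet_smul (g : SL(3, ℝ)) (S : Set (Fin 3 → ℝ)) : projSet (g • S) = g • projSet S := by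
  ext x
  constructor
  · rintro ⟨_, hv, ⟨v, h, rfl⟩, hx⟩
    have hv' : v ≠ 0 := by
      rintro rfl
      exact hv (smul_zero g)
    exact ⟨_, ⟨v, hv', h, rfl⟩, hx⟩
  · rintro ⟨_, ⟨v, hv, h, rfl⟩, hx⟩
    exact ⟨g • v, smul_vec_ne_zero g hv, smul_mem_smul_set h, hx⟩

theorem isOpen_projSet {S : Set (Fin 3 → ℝ)} (hS : IsOpen S) : IsOpen (projSet S) := by
  rw [isOpen_RP2_iff]
  have : {v | ∃ hv : v ≠ 0, (Projectivization.mk ℝ v hv : RP2) ∈ projSet S} =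
      (⋃ c : ℝ, ⋃ _ : c ≠ 0, (fun v => c • v) ⁻¹' S) ∩ {0}ᶜ := by
    ext v
    constructor
    · rintro ⟨hv, h⟩
      obtain ⟨c, hc, h⟩ := (mk_mem_projSet hv).1 h
      exact ⟨mem_iUnion₂.2 ⟨c, hc, h⟩, hv⟩
    · rintro ⟨h, hv⟩
      obtain ⟨c, hc, h⟩ := mem_iUnion₂.1 h
      exact ⟨hv, (mk_mem_projSet hv).2 ⟨c, hc, h⟩⟩
  rw [this]
  exact (isOpen_biUnion fun c _ => hS.preimage (continuous_const_smul c)).inter isOpen_compl_singleton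

/-- A chart adapted to a triangle with two vertices given by the frame. -/
theorem exists_triangle_chart (P : SL(3, ℝ)) {A : ℝ} (hA : 0 < A) :
    ∃ M : SL(3, ℝ), ∀ v, M⁻¹ • v = ![coord P 0 v / (A + 1), coord P 1 v,
      coord P 1 v + (A + 1) * (coord P 0 v + coord P 2 v)] := by
  have hA1 : A + 1 ≠ 0 := by positivity
  -- The third row is positive on the closed triangle away from the origin, so the triangle is
  -- bounded in the chart. The entry 1/(A + 1) normalizes the determinant.
  have hdet : (!![1 / (A + 1), 0, 0; 0, 1, 0; A + 1, 1, A + 1] : Matrix (Fin 3) (Fin 3) ℝ).det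
      = 1 := by
    rw [Matrix.det_fin_three]
    simp
    field_simp
  obtain ⟨R, hR⟩ : ∃ R : SL(3, ℝ), (R : Matrix (Fin 3) (Fin 3) ℝ) =
      !![1 / (A + 1), 0, 0; 0, 1, 0; A + 1, 1, A + 1] := ⟨⟨_, hdet⟩, rfl⟩
  refine ⟨P * R⁻¹, fun v => ?_⟩
  rw [mul_inv_rev, inv_inv, mul_smul]
  simp only [coord_apply]
  generalize P⁻¹ • v = w
  rw [Matrix.SpecialLinearGroup.smul_def, hR]
  ext i
  fin_cases i
  · simp [Matrix.smul_eq_mulVec, Matrix.mulVec, dotProduct, Fin.sum_univ_three]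
    ring
  · simp [Matrix.smul_eq_mulVec, Matrix.mulVec, dotProduct, Fin.sum_univ_three]
  · simp [Matrix.smul_eq_mulVec, Matrix.mulVec, dotProduct, Fin.sum_univ_three]
    ring

section TriangleChart

variable {P M : SL(3, ℝ)} {A δ : ℝ} {S : Set (Fin 3 → ℝ)}

/-- One chart serves every `δ` up to `A`. The last homogeneous coordinate exceeds x₀ + x₂, so the
third side of the triangle lies above the line z₁ = -δ. -/
theorem triangle_chart_bounds (hA : 0 < A)
    (hM : ∀ v, M⁻¹ • v = ![coord P 0 v / (A + 1), coord P 1 v,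
      coord P 1 v + (A + 1) * (coord P 0 v + coord P 2 v)]) (hδ : 0 < δ) (hδA : δ ≤ A)
    (hS : ∀ v ∈ S, 0 < coord P 0 v ∧ 0 < coord P 2 v ∧
      0 < coord P 1 v + δ * (coord P 0 v + coord P 2 v)) :
    projSet S ⊆ range (affineChart M) ∧ ∀ z, affineChart M z ∈ projSet S →
      0 < z 0 ∧ z 0 < 1 ∧ 0 < z 1 + δ ∧ z 1 < 1 := by
  have key : ∀ v ∈ S, 0 < (M⁻¹ • v) 2 := by
    intro v hv
    obtain ⟨h0, h2, h1⟩ := hS v hv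
    rw [hM]
    simp only [Matrix.cons_val]
    nlinarith [mul_le_mul_of_nonneg_right hδA (add_pos h0 h2).le]
  refine ⟨?_, ?_⟩
  · rintro _ ⟨v, hv, hvS, rfl⟩
    exact ⟨_, ((mk_eq_affineChart_iff M hv _).2 ⟨(key v hvS).ne', rfl⟩).symm⟩
  · rintro z ⟨v, hv, hvS, hz⟩
    obtain ⟨-, rfl⟩ := (mk_eq_affineChart_iff M hv z).1 hz
    obtain ⟨h0, h2, h1⟩ := hS v hvS
    have hk := key v hvS
    have e0 : dehomogenize (M⁻¹ • v) 0 = (M⁻¹ • v) 0 / (M⁻¹ • v) 2 := rfl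
    have e1 : dehomogenize (M⁻¹ • v) 1 = (M⁻¹ • v) 1 / (M⁻¹ • v) 2 := rfl
    have hgt : coord P 0 v + coord P 2 v < (M⁻¹ • v) 2 := by
      rw [hM]
      simp only [Matrix.cons_val]
      nlinarith [mul_le_mul_of_nonneg_right hδA (add_pos h0 h2).le]
    have f0 : (M⁻¹ • v) 0 = coord P 0 v / (A + 1) := by rw [hM]; rfl
    have f1 : (M⁻¹ • v) 1 = coord P 1 v := by rw [hM]; rfl
    have f2 : (M⁻¹ • v) 2 = coord P 1 v + (A + 1) * (coord P 0 v + coord P 2 v) := by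
      rw [hM]; rfl
    rw [e0, e1, f0, f1]
    refine ⟨by positivity, ?_, ?_, ?_⟩
    · rw [div_lt_one hk]
      have : coord P 0 v / (A + 1) < coord P 0 v := by
        rw [div_lt_iff₀ (by positivity)]
        nlinarith
      linarith
    · rw [← sub_neg_eq_add, sub_pos, lt_div_iff₀ hk]
      nlinarith
    · rw [div_lt_one hk, f2]
      have : 0 < (A + 1) * (coord P 0 v + coord P 2 v) := by positivity
      linarith

theorem triangle_isBoundedInChart (hA : 0 < A)
    (hM : ∀ v, M⁻¹ • v = ![coord P 0 v / (A + 1), coord P 1 v,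
      coord P 1 v + (A + 1) * (coord P 0 v + coord P 2 v)]) (hδ : 0 < δ) (hδA : δ ≤ A)
    (hS : ∀ v ∈ S, 0 < coord P 0 v ∧ 0 < coord P 2 v ∧
      0 < coord P 1 v + δ * (coord P 0 v + coord P 2 v)) :
    IsBoundedInChart (projSet S) M := by
  obtain ⟨h, h'⟩ := triangle_chart_bounds hA hM hδ hδA hS
  refine ⟨h, (Metric.isBounded_iff_subset_closedBall 0).2 ⟨1 + (1 + A), fun z hz => ?_⟩⟩
  obtain ⟨h0, h0', h1, h1'⟩ := h' z hz
  rw [mem_closedBall_zero_iff, EuclideanSpace.norm_eq, Fin.sum_univ_two]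
  refine (Real.sqrt_le_left (by positivity)).2 ?_
  rw [Real.norm_eq_abs, Real.norm_eq_abs, sq_abs, sq_abs]
  nlinarith

end TriangleChart

/-- A projective line is a null set in every affine chart. -/
theorem volume_line_eq_zero (M F : SL(3, ℝ)) (i : Fin 3) :
    volume {z : EuclideanSpace ℝ (Fin 2) | coord F i (M • affineVector z) = 0} = 0 := by
  set k : Fin 3 → ℝ := fun j => coord F i (M • Pi.single j 1) with hk
  have hform : ∀ z : EuclideanSpace ℝ (Fin 2),
      coord F i (M • affineVector z) = z 0 * k 0 + z 1 * k 1 + k 2 := by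
    intro z
    have : affineVector z = z 0 • Pi.single 0 1 + z 1 • Pi.single 1 1 + Pi.single 2 1 := by
      ext j
      fin_cases j <;> simp [affineVector]
    rw [this, smul_add, smul_add, smul_comm M (z 0), smul_comm M (z 1), map_add, map_add,
      LinearMap.map_smul, LinearMap.map_smul]
    rfl
  let L : EuclideanSpace ℝ (Fin 2) →ₗ[ℝ] ℝ :=
    { toFun := fun z => z 0 * k 0 + z 1 * k 1
      map_add' := fun x y => by simp; ring
      map_smul' := fun c x => by simp; ring }
  rcases eq_empty_or_nonempty {z : EuclideanSpace ℝ (Fin 2) | coord F i (M • affineVector z) = 0}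
    with he | ⟨z₀, hz₀⟩
  · rw [he, measure_empty]
  have hz₀' : L z₀ + k 2 = 0 := (hform z₀).symm.trans hz₀
  refine measure_mono_null ?_ (Measure.addHaar_affineSubspace volume
    (AffineSubspace.mk' z₀ (LinearMap.ker L)) ?_)
  · intro z hz
    have hz' : L z + k 2 = 0 := (hform z).symm.trans hz
    change z ∈ AffineSubspace.mk' z₀ (LinearMap.ker L)
    rw [AffineSubspace.mem_mk', LinearMap.mem_ker, vsub_eq_sub, map_sub]
    linarith
  · intro htop
    have hker : LinearMap.ker L = ⊤ := by
      rw [← AffineSubspace.direction_mk' z₀ (LinearMap.ker L), htop, AffineSubspace.direction_top]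
    have hL : ∀ z, L z = 0 := fun z => by
      have : z ∈ LinearMap.ker L := hker ▸ Submodule.mem_top
      exact this
    have k0 : k 0 = 0 := by simpa [L] using hL (EuclideanSpace.single 0 1)
    have k1 : k 1 = 0 := by simpa [L] using hL (EuclideanSpace.single 1 1)
    have k2 : k 2 = 0 := by linarith [hL z₀]
    have hall : ∀ v, coord F i (M • v) = 0 := by
      intro v
      have : v = v 0 • Pi.single 0 1 + v 1 • Pi.single 1 1 + v 2 • Pi.single 2 1 := by
        ext j
        fin_cases j <;> simp
      rw [this, smul_add, smul_add, smul_comm M (v 0), smul_comm M (v 1), smul_comm M (v 2),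
        map_add, map_add, LinearMap.map_smul, LinearMap.map_smul, LinearMap.map_smul]
      change v 0 • k 0 + v 1 • k 1 + v 2 • k 2 = 0
      rw [k0, k1, k2]
      simp
    have := hall (M⁻¹ • frameVec F i)
    rw [smul_inv_smul, coord_frameVec, if_pos rfl] at this
    exact one_ne_zero this

end

/-! ### Lower bound for the area of the quotient -/

noncomputable section
namespace WallSystem

variable {G : Type*} [Group G] {C : Set (Fin 3 → ℝ)} {ρ : G →* SL(3, ℝ)} {P : SL(3, ℝ)}
  {s : ℝ} {ρ' : G →* SL(3, ℝ)}

/-- The image of `N` under the developing map. -/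
def devImage (C : Set (Fin 3 → ℝ)) (ρ : G →* SL(3, ℝ)) (P : SL(3, ℝ)) (s : ℝ)
    (ρ' : G →* SL(3, ℝ)) (N : Set (Fin 3 → ℝ)) : Set (Fin 3 → ℝ) :=
  {z | ∃ y ∈ N, ∃ B, OffWall C ρ P y ∧ IsDev C ρ P s ρ' y B ∧ z = B • y}

/-- Off the walls the matrix of the developing map is locally constant, so the map is locally linear
and invertible. -/
theorem isOpen_devImage (W : WallSystem C ρ P) {N : Set (Fin 3 → ℝ)} (hN : IsOpen N) :
    IsOpen (devImage C ρ P s ρ' N) := by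
  refine isOpen_iff_mem_nhds.2 ?_
  rintro _ ⟨y, hy, B, hoff, hB, rfl⟩
  have hc : ContinuousAt (fun z : Fin 3 → ℝ => B⁻¹ • z) (B • y) :=
    (continuous_const_smul B⁻¹).continuousAt
  have hc' : Tendsto (fun z : Fin 3 → ℝ => B⁻¹ • z) (𝓝 (B • y)) (𝓝 y) := by
    have := hc.tendsto
    rwa [inv_smul_smul] at this
  filter_upwards [hc'.eventually (hN.mem_nhds hy),
    hc'.eventually (W.eventually_same_sign hoff.1)] with z hz hz'
  have hsign : ∀ h : G, 0 < coord (ρ h * P) 1 y * coord (ρ h * P) 1 (B⁻¹ • z) :=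
    fun h => hz'.2 h (hoff.2 h)
  exact ⟨B⁻¹ • z, hz, B, ⟨hz'.1, fun h h0 => by simpa [h0] using hsign h⟩,
    hB.congr W hz'.1 hsign, (smul_inv_smul _ _).symm⟩

/-- By equivariance and injectivity of the developing map, an overlap of translates downstairs comes
from an overlap of ρ-translates of `N`. -/
theorem disjoint_smul_projSet_devImage (W : WallSystem C ρ P) (hb : IsConeBulging C ρ P s ρ')
    {N : Set (Fin 3 → ℝ)} (hN : ∀ h : G, h ≠ 1 → ∀ w ∈ N, ∀ t : ℝ, 0 < t → t • ρ h • w ∉ N)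
    {g : G} (hg : g ≠ 1) : Disjoint (ρ' g • projSet (devImage C ρ P s ρ' N))
      (projSet (devImage C ρ P s ρ' N)) := by
  refine Set.disjoint_left.2 ?_
  rintro _ ⟨_, ⟨_, hz, ⟨y, hy, B, hoff, hB, rfl⟩, rfl⟩, rfl⟩ ⟨_, hz', ⟨y', hy', B', hoff', hB', rfl⟩,
    heq⟩
  obtain ⟨c, hc, h⟩ := (mk_eq_mk_iff_smul hz' (smul_vec_ne_zero (ρ' g) hz)).1 heq
  have h' : B' • y' = c • (ρ' g * B * (ρ g)⁻¹) • ρ g • y := by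
    rw [mul_smul, mul_smul, inv_smul_smul]
    exact h
  obtain ⟨-, he, ht⟩ := W.dev_injective hb (hoff.smul W g) hoff' (hB.smul g) hB' h'
  exact hN g hg y hy c ht (he ▸ hy')

theorem smul_projSet_bulgedCone (h : G) : ρ' h • projSet (bulgedCone C ρ P s ρ') =
    projSet (bulgedCone C ρ P s ρ') := by
  rw [← projSet_smul]
  congr 1
  rw [bulgedCone, smul_set_iUnion]
  refine Function.Surjective.iSup_congr (Equiv.mulLeft h) (Equiv.surjective _) fun k => ?_
  rw [smul_smul, ← map_mul]
  rfl

/-- The omitted points lie on the countably many lines through developed axes, and these lines are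
null sets in the chart. -/
theorem ae_mem_devCone (W : WallSystem C ρ P) {M : SL(3, ℝ)}
    (hM : IsBoundedInChart (projSet (bulgedCone C ρ P s ρ')) M) :
    ∀ᵐ x ∂hilbertMeasure (projSet (bulgedCone C ρ P s ρ')), x ∈ projSet (devCone C ρ P s ρ') := by
  have : Countable G := W.countable_group
  have hopen := isOpen_projSet (W.isOpen_bulgedCone s ρ')
  have hdev : devCone C ρ P s ρ' = devImage C ρ P s ρ' univ := by
    ext z
    simp [devCone, devImage]
  have hopen' : IsOpen (projSet (devCone C ρ P s ρ')) :=
    isOpen_projSet (hdev ▸ W.isOpen_devImage isOpen_univ)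
  rw [hilbertMeasure_eq_map hM hopen]
  refine (ae_map_iff (p := (· ∈ projSet (devCone C ρ P s ρ')))
    (continuous_affineChart M).aemeasurable hopen'.measurableSet).2 ?_
  refine (withDensity_absolutelyContinuous _ _).ae_le ?_
  refine (ae_restrict_iff' (hopen.preimage (continuous_affineChart M)).measurableSet).2 ?_
  have hwalls : ∀ᵐ z : EuclideanSpace ℝ (Fin 2), ∀ h : G,
      coord (ρ' h * P) 1 (M • affineVector z) ≠ 0 := by
    rw [ae_all_iff]
    intro h
    rw [ae_iff]
    simpa using volume_line_eq_zero M (ρ' h * P) 1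
  filter_upwards [hwalls] with z hz hmem
  obtain ⟨v, hv, hvS, heq⟩ := hmem
  rcases W.mem_bulgedCone_cases hvS with h | ⟨h, w, -, hw1, rfl⟩
  · exact ⟨v, hv, h, heq⟩
  · exfalso
    obtain ⟨c, hc, hcv⟩ := (mk_eq_mk_iff_smul hv (smul_vec_ne_zero M (affineVector_ne z))).1 heq
    have h0 : coord (ρ' h * P) 1 (ρ' h • w) = 0 := by rw [coord_mul_smul, hw1]
    rw [hcv, LinearMap.map_smul, smul_eq_mul] at h0
    exact (mul_ne_zero hc (hz h)) h0

/-- `covolume` takes the value 0 when there is no fundamental domain, so a lower bound for the area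
needs one to exist. -/
theorem exists_isFundamentalDomain_bulged (W : WallSystem C ρ P) (hb : IsConeBulging C ρ P s ρ')
    {M : SL(3, ℝ)} (hM : IsBoundedInChart (projSet (bulgedCone C ρ P s ρ')) M)
    [Countable ρ'.range] [MeasurableConstSMul ρ'.range RP2]
    [SMulInvariantMeasure ρ'.range RP2 (hilbertMeasure (projSet (bulgedCone C ρ P s ρ')))] :
    ∃ F, IsFundamentalDomain ρ'.range F (hilbertMeasure (projSet (bulgedCone C ρ P s ρ'))) := by
  -- The Lindelöf property reduces the separated neighbourhoods to a sequence whose developed images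
  -- cover the points off the walls.
  choose N hNo hyN hNC hsep using fun y : C => W.exists_separated_nhds y.2
  obtain ⟨T, hT, hTu⟩ := TopologicalSpace.isOpen_iUnion_countable
    (fun y => devImage C ρ P s ρ' (N y)) fun y => W.isOpen_devImage (hNo y)
  have hcov : devCone C ρ P s ρ' ⊆ ⋃ y ∈ T, devImage C ρ P s ρ' (N y) := by
    rw [hTu]
    rintro _ ⟨y, B, hoff, hB, rfl⟩
    exact mem_iUnion.2 ⟨⟨y, hoff.1⟩, y, hyN _, B, hoff, hB, rfl⟩
  have hTne : T.Nonempty := by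
    obtain ⟨x, hx⟩ := W.piece_nonempty (σ := -1) (by norm_num)
    have := hcov ⟨x, 1, offWall_of_mem_piece hx, isDev_one hx, (one_smul _ _).symm⟩
    obtain ⟨y, hy, -⟩ := mem_iUnion₂.1 this
    exact ⟨y, hy⟩
  obtain ⟨f, hf⟩ := hT.exists_eq_range hTne
  refine exists_isFundamentalDomain _ (fun n => projSet (devImage C ρ P s ρ' (N (f n))))
    (fun n => (isOpen_projSet (W.isOpen_devImage (hNo _))).measurableSet) ?_ ?_
  · rintro n ⟨_, g, rfl⟩ hg
    refine W.disjoint_smul_projSet_devImage hb (hsep (f n)) (g := g) ?_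
    rintro rfl
    exact hg (Subtype.ext (map_one ρ'))
  · filter_upwards [W.ae_mem_devCone hM] with x hx
    obtain ⟨v, hv, hvS, rfl⟩ := hx
    obtain ⟨y, hy, hvy⟩ := mem_iUnion₂.1 (hcov hvS)
    rw [hf] at hy
    obtain ⟨n, rfl⟩ := hy
    exact ⟨n, 1, by rw [one_smul]; exact ⟨v, hv, hvy, rfl⟩⟩

/-- A set with pairwise disjoint translates has at most the measure of a fundamental domain.
Distinct elements `ρ' g` and `ρ' h` force `h⁻¹ * g ≠ 1`, so faithfulness of `ρ'` is not presupposed.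
-/
theorem measure_le_hilbertArea (W : WallSystem C ρ P) (hb : IsConeBulging C ρ P s ρ')
    {M : SL(3, ℝ)} (hM : IsBoundedInChart (projSet (bulgedCone C ρ P s ρ')) M)
    {N : Set (Fin 3 → ℝ)} (hNo : IsOpen N)
    (hN : ∀ h : G, h ≠ 1 → ∀ w ∈ N, ∀ t : ℝ, 0 < t → t • ρ h • w ∉ N) :
    hilbertMeasure (projSet (bulgedCone C ρ P s ρ')) (projSet (devImage C ρ P s ρ' N)) ≤
      hilbertArea (projSet (bulgedCone C ρ P s ρ')) ρ' := by
  have : Countable G := W.countable_group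
  have hopen := isOpen_projSet (W.isOpen_bulgedCone s ρ')
  have hcount : Countable ρ'.range := ρ'.rangeRestrict_surjective.countable
  have hcts : ∀ g : ρ'.range, Continuous fun x : RP2 => g • x := fun g =>
    continuous_const_smul (g : SL(3, ℝ))
  have hmeas : MeasurableConstSMul ρ'.range RP2 := ⟨fun g => (hcts g).measurable⟩
  have hinv : SMulInvariantMeasure ρ'.range RP2
      (hilbertMeasure (projSet (bulgedCone C ρ P s ρ'))) := by
    refine ⟨?_⟩
    rintro ⟨_, g, rfl⟩ A hA
    have := hilbertMeasure_smul hM hopen (ρ' g) hA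
    rw [smul_projSet_bulgedCone] at this
    exact this.symm
  obtain ⟨F, hF⟩ := W.exists_isFundamentalDomain_bulged hb hM
  rw [hilbertArea, hF.covolume_eq_volume]
  refine hF.measure_le_of_pairwise_disjoint
    (isOpen_projSet (W.isOpen_devImage hNo)).measurableSet.nullMeasurableSet ?_
  rintro ⟨_, g, rfl⟩ ⟨_, h, rfl⟩ hgh
  refine Disjoint.aedisjoint (Disjoint.mono inter_subset_left inter_subset_left ?_)
  have hne : h⁻¹ * g ≠ 1 := by
    intro h1
    obtain rfl : h = g := inv_mul_eq_one.1 h1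
    exact hgh rfl
  have := W.disjoint_smul_projSet_devImage hb hN hne
  rw [map_mul, map_inv, mul_smul, Set.disjoint_left] at this
  refine Set.disjoint_left.2 ?_
  rintro _ ⟨x, hx, rfl⟩ ⟨y, hy, hxy⟩
  have hxy : ρ' h • y = ρ' g • x := hxy
  refine this (a := y) ⟨_, smul_mem_smul_set hx, ?_⟩ hy
  change (ρ' h)⁻¹ • ρ' g • x = y
  rw [← hxy, inv_smul_smul]

theorem tendsto_hilbertArea (W : WallSystem C ρ P) {σ : ℝ → G →* SL(3, ℝ)}
    (hb : ∀ s, IsConeBulging C ρ P s (σ s)) :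
    Tendsto (fun s => hilbertArea (projSet (bulgedCone C ρ P s (σ s))) (σ s)) atTop (𝓝 ⊤) := by
  obtain ⟨A, hA, htri⟩ := W.exists_triangle
  obtain ⟨M, hM⟩ := exists_triangle_chart P hA
  have hpos : ∀ s, ∀ z ∈ bulgedCone C ρ P s (σ s), 0 < coord P 0 z ∧ 0 < coord P 2 z ∧
      0 < coord P 1 z + A * (coord P 0 z + coord P 2 z) := by
    intro s z hz
    refine ⟨W.pos_on_bulgedCone ?_ hz, W.pos_on_bulgedCone ?_ hz,
      W.pos_on_bulgedCone (f := coord P 1 + A • (coord P 0 + coord P 2)) ?_ hz⟩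
    · rintro _ ⟨y, B, hy, hB, rfl⟩
      exact (htri s _ (hb s) y B hy hB).1
    · rintro _ ⟨y, B, hy, hB, rfl⟩
      exact (htri s _ (hb s) y B hy hB).2.1
    · rintro _ ⟨y, B, hy, hB, rfl⟩
      exact (htri s _ (hb s) y B hy hB).2.2
  have hbdd : ∀ s, IsBoundedInChart (projSet (bulgedCone C ρ P s (σ s))) M := fun s =>
    triangle_isBoundedInChart hA hM hA le_rfl (hpos s)
  -- the base point on the axis
  set a : ℝ := 1 / (2 * (A + 1) ^ 2) with ha
  have ha0 : 0 < a := by positivity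
  set p : Fin 3 → ℝ := M • affineVector !₂[a, 0] with hp
  have hcoord : ∀ z : EuclideanSpace ℝ (Fin 2), coord P 0 (M • affineVector z) = (A + 1) * z 0 ∧
      coord P 1 (M • affineVector z) = z 1 ∧
      z 1 + (A + 1) * (coord P 0 (M • affineVector z) + coord P 2 (M • affineVector z)) = 1 := by
    intro z
    have h := hM (M • affineVector z)
    rw [inv_smul_smul] at h
    have h0 := congrFun h 0
    have h1 := congrFun h 1
    have h2 := congrFun h 2
    change z 0 = coord P 0 _ / (A + 1) at h0
    change z 1 = coord P 1 _ at h1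
    change 1 = _ + _ at h2
    refine ⟨?_, h1.symm, ?_⟩
    · rw [h0]; field_simp
    · rw [h1]; exact h2.symm
  obtain ⟨hp0, hp1, hp2⟩ := hcoord !₂[a, 0]
  rw [← hp] at hp0 hp1 hp2
  simp only [Matrix.cons_val] at hp0 hp1 hp2
  have hpC : p ∈ C := by
    rw [eq_axisPt hp1]
    refine W.axisPt_mem (by rw [hp0]; positivity) ?_
    have : (A + 1) * ((A + 1) * a) = 1 / 2 := by
      rw [ha]; field_simp
    rw [hp0] at hp2
    have : 0 < (A + 1) * coord P 2 p := by nlinarith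
    exact (mul_pos_iff_of_pos_left (by positivity)).1 this
  obtain ⟨N, hNo, hpN, hNC, hsep⟩ := W.exists_separated_nhds hpC
  have hcont : Continuous fun z : EuclideanSpace ℝ (Fin 2) => M • affineVector z :=
    (continuous_const_smul M).comp continuous_affineVector
  obtain ⟨r, hr, hball⟩ := Metric.eventually_nhds_iff.1 (hcont.continuousAt.eventually
    ((hNo.eventually_mem hpN).and (W.eventually_axis hpC hp1)))
  -- Two coordinate differences below r/2 give a Euclidean distance below r.
  set ε := r / 2 with hε
  have hε0 : 0 < ε := by positivity
  have hsq : ∀ z ∈ halfSquare a ε, M • affineVector z ∈ N ∩ piece C ρ P 1 := by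
    rintro z ⟨hz0, hz1⟩
    have hd : dist z !₂[a, 0] < r := by
      rw [EuclideanSpace.dist_eq, Fin.sum_univ_two, Real.sqrt_lt' hr]
      simp only [Matrix.cons_val_zero, Matrix.cons_val_one, Real.dist_eq, sq_abs]
      have h0 : (z 0 - a) ^ 2 < ε ^ 2 := sq_lt_sq' (by linarith [hz0.1]) (by linarith [hz0.2])
      have h1 : (z 1 - 0) ^ 2 < ε ^ 2 := sq_lt_sq' (by linarith [hz1.1]) (by linarith [hz1.2])
      nlinarith
    obtain ⟨hzN, hzC, hzs⟩ := hball hd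
    refine ⟨hzN, hzC, ?_, hzs⟩
    rw [one_mul, (hcoord z).2.1]
    exact hz1.1
  have key : ∀ s : ℝ, 0 ≤ s → ENNReal.ofReal (2 * ε) *
      ∫⁻ y in Ioo 0 ε, (ENNReal.ofReal (16 * (y + A * Real.exp (-s))))⁻¹ ≤
      hilbertArea (projSet (bulgedCone C ρ P s (σ s))) (σ s) := by
    intro s hs
    refine le_trans ?_ (W.measure_le_hilbertArea (hb s) (hbdd s) hNo hsep)
    set E := projSet (devImage C ρ P s (σ s) N) with hE
    -- The bulged cone after `O_s⁻¹`. The end coordinates grow by e^{s/3} and the middle one shrinks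
    -- by e^{-2s/3}, so the slope A of the triangle becomes A e^{-s}.
    set T := bulge P (-s) • bulgedCone C ρ P s (σ s) with hTdef
    have hTtri : ∀ v ∈ T, 0 < coord P 0 v ∧ 0 < coord P 2 v ∧
        0 < coord P 1 v + A * Real.exp (-s) * (coord P 0 v + coord P 2 v) := by
      rintro _ ⟨w, hw, rfl⟩
      obtain ⟨h0, h2, h1⟩ := hpos s w hw
      have e0 : coord P 0 (bulge P (-s) • w) = Real.exp (-(-s) / 3) * coord P 0 w :=
        coord_bulge P (-s) 0 w
      have e1 : coord P 1 (bulge P (-s) • w) = Real.exp (2 * (-s) / 3) * coord P 1 w :=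
        coord_bulge P (-s) 1 w
      have e2 : coord P 2 (bulge P (-s) • w) = Real.exp (-(-s) / 3) * coord P 2 w :=
        coord_bulge P (-s) 2 w
      have hexp : Real.exp (-s) * Real.exp (-(-s) / 3) = Real.exp (2 * (-s) / 3) := by
        rw [← Real.exp_add]; congr 1; ring
      change 0 < coord P 0 (bulge P (-s) • w) ∧ 0 < coord P 2 (bulge P (-s) • w) ∧
        0 < coord P 1 (bulge P (-s) • w) +
          A * Real.exp (-s) * (coord P 0 (bulge P (-s) • w) + coord P 2 (bulge P (-s) • w))
      rw [e0, e1, e2]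
      refine ⟨by positivity, by positivity, ?_⟩
      have : Real.exp (2 * -s / 3) * coord P 1 w + A * Real.exp (-s) *
          (Real.exp (-(-s) / 3) * coord P 0 w + Real.exp (-(-s) / 3) * coord P 2 w) =
          Real.exp (2 * -s / 3) * (coord P 1 w + A * (coord P 0 w + coord P 2 w)) := by
        rw [← hexp]; ring
      rw [this]
      exact mul_pos (Real.exp_pos _) h1
    have hδ : 0 < A * Real.exp (-s) := by positivity
    have hδA : A * Real.exp (-s) ≤ A :=
      mul_le_of_le_one_right hA.le (Real.exp_le_one_iff.2 (by linarith))
    have hTb := triangle_isBoundedInChart hA hM hδ hδA hTtri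
    have hTbd := (triangle_chart_bounds hA hM hδ hδA hTtri).2
    have hTo : IsOpen (projSet T) := isOpen_projSet ((W.isOpen_bulgedCone s (σ s)).smul _)
    have hEo : IsOpen E := isOpen_projSet (W.isOpen_devImage hNo)
    -- On K₂ the developing map is `O_s`, which `O_s⁻¹` undoes. The half square is therefore
    -- independent of s.
    have hsub : halfSquare a ε ⊆ affineChart M ⁻¹' (bulge P (-s) • E) := by
      intro z hz
      obtain ⟨hzN, hzp⟩ := hsq z hz
      rw [mem_preimage, mem_smul_set_iff_inv_smul_mem, bulge_inv, neg_neg]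
      exact ⟨_, smul_vec_ne_zero _ (smul_vec_ne_zero M (affineVector_ne z)),
        ⟨_, hzN, _, offWall_of_mem_piece hzp, isDev_of_mem_piece_one hzp, rfl⟩, rfl⟩
    have hsub' : halfSquare a ε ⊆ affineChart M ⁻¹' projSet T := by
      intro z hz
      obtain ⟨-, hzp⟩ := hsq z hz
      refine ⟨_, smul_vec_ne_zero M (affineVector_ne z), ?_, rfl⟩
      refine ⟨bulge P s • M • affineVector z,
        mem_iUnion.2 ⟨1, ?_⟩, ?_⟩
      · rw [map_one, one_smul]
        exact Or.inr (smul_mem_smul_set hzp)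
      · change bulge P (-s) • bulge P s • _ = _
        rw [← bulge_inv, inv_smul_smul]
    calc ENNReal.ofReal (2 * ε) *
          ∫⁻ y in Ioo 0 ε, (ENNReal.ofReal (16 * (y + A * Real.exp (-s))))⁻¹
        ≤ finslerMeasure (affineChart M ⁻¹' projSet T) (halfSquare a ε) :=
          finslerMeasure_halfSquare_ge (hTo.preimage (continuous_affineChart M)) hTb.2
            (fun z hz => (hTbd z hz).1) (fun z hz => (hTbd z hz).2.1)
            (fun z hz => (hTbd z hz).2.2.1) hsub'
      _ ≤ finslerMeasure (affineChart M ⁻¹' projSet T)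
            (affineChart M ⁻¹' (bulge P (-s) • E)) := measure_mono hsub
      _ = hilbertMeasure (projSet T) (bulge P (-s) • E) := by
          rw [hilbertMeasure_eq_map hTb hTo, Measure.map_apply
            (continuous_affineChart M).measurable (hEo.smul _).measurableSet]
      _ = hilbertMeasure (projSet (bulgedCone C ρ P s (σ s))) E := by
          rw [hTdef, projSet_smul, hilbertMeasure_smul (hbdd s)
            (isOpen_projSet (W.isOpen_bulgedCone s (σ s))) _ (hEo.smul _).measurableSet]
          congr 1
          exact Set.preimage_image_eq _ (MulAction.injective _)
  have hlim : Tendsto (fun s : ℝ => A * Real.exp (-s)) atTop (𝓝[>] 0) := by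
    refine tendsto_nhdsWithin_iff.2 ⟨?_, Eventually.of_forall fun s => ?_⟩
    · have := (Real.tendsto_exp_atBot.comp tendsto_neg_atTop_atBot).const_mul A
      rwa [mul_zero] at this
    · exact mul_pos hA (Real.exp_pos _)
  have h1 := (tendsto_lintegral_inv_add hε0).comp hlim
  have h2 := ENNReal.Tendsto.const_mul (a := ENNReal.ofReal (2 * ε)) h1 (Or.inl ENNReal.top_ne_zero)
  rw [ENNReal.mul_top (by simpa using hε0)] at h2
  refine tendsto_nhds_top_mono h2 ?_
  filter_upwards [eventually_ge_atTop 0] with s hs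
  exact key s hs

end WallSystem
end

/-! ### The cone over a strictly convex domain -/

noncomputable section

/-- `C` is one of the two convex components of the cone over a strictly convex domain `Ω`. -/
structure IsConeComponent (Ω : Set RP2) (C : Set (Fin 3 → ℝ)) : Prop where
  isOpen : IsOpen C
  convex : Convex ℝ C
  smul_mem : ∀ t : ℝ, 0 < t → ∀ v ∈ C, t • v ∈ C
  exists_pos : ∃ α : (Fin 3 → ℝ) →L[ℝ] ℝ, ∀ v ∈ closure C, v ≠ 0 → 0 < α v
  add_mem : ∀ p ∈ closure C, ∀ q ∈ closure C, LinearIndependent ℝ ![p, q] → p + q ∈ C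
  coneOver_eq : coneOver Ω = C ∪ -C
  nonempty : C.Nonempty

theorem continuousAt_dehomogenize {w : Fin 3 → ℝ} (hw : w 2 ≠ 0) :
    ContinuousAt dehomogenize w := by
  have h : ContinuousAt (fun w : Fin 3 → ℝ => ![w 0 / w 2, w 1 / w 2]) w := by
    refine continuousAt_pi.2 fun i => ?_
    fin_cases i
    · exact (continuous_apply 0).continuousAt.div (continuous_apply 2).continuousAt hw
    · exact (continuous_apply 1).continuousAt.div (continuous_apply 2).continuousAt hw
  exact (PiLp.continuous_toLp 2 _).continuousAt.comp h

theorem dehomogenize_smul {t : ℝ} (ht : t ≠ 0) (w : Fin 3 → ℝ) :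
    dehomogenize (t • w) = dehomogenize w := by
  ext i
  fin_cases i <;> simp [dehomogenize, mul_div_mul_left _ _ ht]

theorem dehomogenize_add {v w : Fin 3 → ℝ} (hv : 0 < v 2) (hw : 0 < w 2) :
    dehomogenize (v + w) = (v 2 / (v 2 + w 2)) • dehomogenize v +
      (w 2 / (v 2 + w 2)) • dehomogenize w := by
  have : v 2 + w 2 ≠ 0 := by positivity
  ext i
  fin_cases i <;> simp [dehomogenize] <;> field_simp

/-- The cone over a subset of the plane. -/
def planeCone (U : Set (EuclideanSpace ℝ (Fin 2))) : Set (Fin 3 → ℝ) :=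
  {w | 0 < w 2 ∧ dehomogenize w ∈ U}

section planeCone

variable {U : Set (EuclideanSpace ℝ (Fin 2))}

theorem isOpen_planeCone (hU : IsOpen U) : IsOpen (planeCone U) := by
  refine isOpen_iff_mem_nhds.2 fun w hw => ?_
  filter_upwards [(continuous_apply (2 : Fin 3)).continuousAt.eventually (lt_mem_nhds hw.1),
    (continuousAt_dehomogenize hw.1.ne').eventually (hU.mem_nhds hw.2)] with z h1 h2
  exact ⟨h1, h2⟩

theorem smul_mem_planeCone {t : ℝ} (ht : 0 < t) {w : Fin 3 → ℝ} (hw : w ∈ planeCone U) :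
    t • w ∈ planeCone U := by
  refine ⟨mul_pos ht hw.1, ?_⟩
  rw [dehomogenize_smul ht.ne']
  exact hw.2

theorem add_mem_planeCone (hU : Convex ℝ U) {v w : Fin 3 → ℝ} (hv : v ∈ planeCone U)
    (hw : w ∈ planeCone U) : v + w ∈ planeCone U := by
  have h1 := hv.1
  have h2 := hw.1
  refine ⟨add_pos h1 h2, ?_⟩
  rw [dehomogenize_add h1 h2]
  exact hU hv.2 hw.2 (by positivity) (by positivity) (by field_simp)

theorem convex_planeCone (hU : Convex ℝ U) : Convex ℝ (planeCone U) := by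
  refine convex_iff_forall_pos.2 fun v hv w hw a b ha hb _ => ?_
  exact add_mem_planeCone hU (smul_mem_planeCone ha hv) (smul_mem_planeCone hb hw)

/-- Boundedness of `U` gives |w₀|, |w₁| ≤ R w₂ on the cone. This closed condition prevents a nonzero
limit from having w₂ = 0. -/
theorem mem_closure_planeCone (hU : Bornology.IsBounded U) {w : Fin 3 → ℝ}
    (hw : w ∈ closure (planeCone U)) (h0 : w ≠ 0) : 0 < w 2 ∧ dehomogenize w ∈ closure U := by
  obtain ⟨R, hR⟩ := hU.exists_norm_le
  have hsub : closure (planeCone U) ⊆ {w | 0 ≤ w 2 ∧ |w 0| ≤ R * w 2 ∧ |w 1| ≤ R * w 2} := by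
    refine closure_minimal ?_ ?_
    · rintro v ⟨hv, hvU⟩
      have h := hR _ hvU
      have e0 : |v 0 / v 2| ≤ R := (PiLp.norm_apply_le (dehomogenize v) 0).trans h
      have e1 : |v 1 / v 2| ≤ R := (PiLp.norm_apply_le (dehomogenize v) 1).trans h
      rw [abs_div, abs_of_pos hv, div_le_iff₀ hv] at e0 e1
      exact ⟨hv.le, e0, e1⟩
    · have c1 : IsClosed {w : Fin 3 → ℝ | 0 ≤ w 2} := isClosed_le (by fun_prop) (by fun_prop)
      have c2 : IsClosed {w : Fin 3 → ℝ | |w 0| ≤ R * w 2} :=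
        isClosed_le (by fun_prop) (by fun_prop)
      have c3 : IsClosed {w : Fin 3 → ℝ | |w 1| ≤ R * w 2} :=
        isClosed_le (by fun_prop) (by fun_prop)
      exact c1.inter (c2.inter c3)
  obtain ⟨h2, h0', h1'⟩ := hsub hw
  have hpos : 0 < w 2 := by
    refine lt_of_le_of_ne h2 fun h => h0 ?_
    rw [← h, mul_zero] at h0' h1'
    ext i
    fin_cases i
    · exact abs_nonpos_iff.1 h0'
    · exact abs_nonpos_iff.1 h1'
    · exact h.symm
  refine ⟨hpos, ?_⟩
  refine mem_closure_of_frequently_of_tendsto ?_ (continuousAt_dehomogenize hpos.ne').tendsto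
  exact (mem_closure_iff_frequently.1 hw).mono fun v hv => hv.2

end planeCone

/-- The component is the one with positive last coordinate in a chart. There `dehomogenize` takes a
sum of vectors to a proper convex combination, so strict convexity of the closure becomes `add_mem`.
-/
theorem IsStrictlyConvexDomain.exists_isConeComponent {Ω : Set RP2}
    (hΩ : IsStrictlyConvexDomain Ω) : ∃ C, IsConeComponent Ω C := by
  obtain ⟨M, hr, ⟨z, hz⟩, ho, hb, hc, hs⟩ := hΩ
  set U := affineChart M ⁻¹' Ω with hU
  have hcl : closure (M • planeCone U) = M • closure (planeCone U) := by
    rw [closure_smul]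
  have hmem : ∀ v, v ∈ M • planeCone U ↔ M⁻¹ • v ∈ planeCone U := fun v =>
    mem_smul_set_iff_inv_smul_mem
  refine ⟨M • planeCone U, (isOpen_planeCone ho).smul M, ?_, ?_, ?_, ?_, ?_, ?_⟩
  · rw [convex_iff_forall_pos]
    intro v hv w hw a b ha hb hab
    rw [hmem] at *
    rw [smul_add, smul_comm _ a, smul_comm _ b]
    exact convex_planeCone hc hv hw ha.le hb.le hab
  · intro t ht v hv
    rw [hmem] at *
    rw [smul_comm]
    exact smul_mem_planeCone ht hv
  · refine ⟨⟨coord M 2, continuous_coord M 2⟩, fun v hv h0 => ?_⟩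
    rw [hcl, mem_smul_set_iff_inv_smul_mem] at hv
    exact (mem_closure_planeCone hb hv (smul_vec_ne_zero _ h0)).1
  · intro p hp q hq hpq
    rw [hcl, mem_smul_set_iff_inv_smul_mem] at hp hq
    have hp0 : p ≠ 0 := hpq.ne_zero 0
    have hq0 : q ≠ 0 := hpq.ne_zero 1
    obtain ⟨p2, pU⟩ := mem_closure_planeCone hb hp (smul_vec_ne_zero _ hp0)
    obtain ⟨q2, qU⟩ := mem_closure_planeCone hb hq (smul_vec_ne_zero _ hq0)
    rw [hmem, smul_add]
    refine ⟨add_pos p2 q2, ?_⟩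
    have hne : dehomogenize (M⁻¹ • p) ≠ dehomogenize (M⁻¹ • q) := by
      intro h
      have hp' := smul_affineVector_dehomogenize p2.ne'
      have hq' := smul_affineVector_dehomogenize q2.ne'
      rw [h] at hp'
      have e : (M⁻¹ • q) 2 • p + (-(M⁻¹ • p) 2) • q = 0 := by
        refine smul_left_cancel M⁻¹ ?_
        rw [smul_add, smul_comm M⁻¹ _ p, smul_comm M⁻¹ _ q, smul_zero]
        generalize affineVector (dehomogenize (M⁻¹ • q)) = d at *
        generalize (M⁻¹ • p) 2 = a at *
        generalize (M⁻¹ • q) 2 = b at *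
        rw [← hp', ← hq', smul_smul, smul_smul, ← add_smul]
        convert zero_smul ℝ _ using 2
        ring
      exact q2.ne' (LinearIndependent.pair_iff.1 hpq _ _ e).1
    rw [dehomogenize_add p2 q2]
    have := hs pU qU hne (a := (M⁻¹ • p) 2 / ((M⁻¹ • p) 2 + (M⁻¹ • q) 2))
      (b := (M⁻¹ • q) 2 / ((M⁻¹ • p) 2 + (M⁻¹ • q) 2)) (by positivity) (by positivity)
      (by field_simp)
    rwa [hc.interior_closure_eq_interior_of_nonempty_interior ⟨z, by rwa [ho.interior_eq]⟩,
      ho.interior_eq] at this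
  · have key : ∀ v (hv : v ≠ 0), (Projectivization.mk ℝ v hv : RP2) ∈ Ω ↔
        (M⁻¹ • v) 2 ≠ 0 ∧ dehomogenize (M⁻¹ • v) ∈ U := by
      intro v hv
      constructor
      · intro h
        obtain ⟨x, hx⟩ := hr h
        obtain ⟨h2, rfl⟩ := (mk_eq_affineChart_iff M hv x).1 hx.symm
        refine ⟨h2, ?_⟩
        rw [hU, mem_preimage, hx]
        exact h
      · rintro ⟨h2, h⟩
        rw [(mk_eq_affineChart_iff M hv _).2 ⟨h2, rfl⟩]
        exact h
    have hneg : ∀ w : Fin 3 → ℝ, dehomogenize (-w) = dehomogenize w := fun w => by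
      rw [← neg_one_smul ℝ, dehomogenize_smul (by norm_num)]
    ext v
    constructor
    · rintro ⟨hv, h⟩
      obtain ⟨h2, h⟩ := (key v hv).1 h
      rcases lt_or_gt_of_ne h2 with h2 | h2
      · refine Or.inr ?_
        rw [Set.mem_neg, hmem, smul_neg]
        exact ⟨neg_pos.2 h2, by rwa [hneg]⟩
      · exact Or.inl ((hmem v).2 ⟨h2, h⟩)
    · rintro (h | h)
      · obtain ⟨h2, h⟩ := (hmem v).1 h
        have hv : v ≠ 0 := by
          rintro rfl
          simp at h2
        exact ⟨hv, (key v hv).2 ⟨h2.ne', h⟩⟩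
      · rw [Set.mem_neg, hmem, smul_neg] at h
        obtain ⟨h2, h⟩ := h
        have h2 : 0 < -(M⁻¹ • v) 2 := h2
        have hv : v ≠ 0 := by
          rintro rfl
          simp at h2
        rw [hneg] at h
        exact ⟨hv, (key v hv).2 ⟨by linarith, h⟩⟩
  · refine ⟨M • affineVector z, smul_mem_smul_set ⟨by simp, ?_⟩⟩
    have : dehomogenize (affineVector z) = z := by
      ext i
      fin_cases i <;> simp [dehomogenize, affineVector]
    rwa [this]

namespace IsConeComponent

variable {Ω : Set RP2} {C : Set (Fin 3 → ℝ)}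

theorem neg (h : IsConeComponent Ω C) : IsConeComponent Ω (-C) where
  isOpen := h.isOpen.neg
  convex := h.convex.neg
  smul_mem t ht v hv := by
    rw [Set.mem_neg, ← smul_neg]
    exact h.smul_mem t ht _ hv
  exists_pos := by
    obtain ⟨α, hα⟩ := h.exists_pos
    refine ⟨-α, fun v hv h0 => ?_⟩
    rw [← neg_closure, Set.mem_neg] at hv
    simpa using hα _ hv (neg_ne_zero.2 h0)
  add_mem p hp q hq hpq := by
    rw [← neg_closure, Set.mem_neg] at hp hq
    rw [Set.mem_neg, neg_add]
    refine h.add_mem _ hp _ hq ?_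
    rw [LinearIndependent.pair_iff] at *
    intro a b hab
    refine hpq a b ?_
    rw [smul_neg, smul_neg, ← neg_add, neg_eq_zero] at hab
    exact hab
  coneOver_eq := by rw [neg_neg, union_comm, h.coneOver_eq]
  nonempty := h.nonempty.neg

theorem ne_zero (h : IsConeComponent Ω C) {v : Fin 3 → ℝ} (hv : v ∈ C) : v ≠ 0 := by
  have : v ∈ coneOver Ω := h.coneOver_eq ▸ Or.inl hv
  exact this.1

theorem neg_notMem (h : IsConeComponent Ω C) {v : Fin 3 → ℝ} (hv : v ∈ closure C) (h0 : v ≠ 0) :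
    -v ∉ closure C := by
  obtain ⟨α, hα⟩ := h.exists_pos
  intro hn
  have h1 := hα v hv h0
  have h2 := hα _ hn (neg_ne_zero.2 h0)
  rw [map_neg] at h2
  linarith

theorem mk_mem_iff (h : IsConeComponent Ω C) {v : Fin 3 → ℝ} (hv : v ≠ 0) :
    (Projectivization.mk ℝ v hv : RP2) ∈ Ω ↔ v ∈ C ∨ -v ∈ C := by
  have : (Projectivization.mk ℝ v hv : RP2) ∈ Ω ↔ v ∈ coneOver Ω := ⟨fun h => ⟨hv, h⟩, fun h => h.2⟩
  rw [this, h.coneOver_eq]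
  rfl

theorem pos_of_smul_mem (h : IsConeComponent Ω C) {v : Fin 3 → ℝ} (hv : v ∈ C) {c : ℝ}
    (hc : c • v ∈ C) : 0 < c := by
  by_contra hn
  rcases (not_lt.1 hn).lt_or_eq with hn | rfl
  · refine h.neg_notMem (subset_closure hv) (h.ne_zero hv) (subset_closure ?_)
    have := h.smul_mem (-c)⁻¹ (inv_pos.2 (neg_pos.2 hn)) _ hc
    rwa [smul_smul, inv_neg, neg_mul, inv_mul_cancel₀ hn.ne, neg_one_smul] at this
  · exact h.ne_zero hc (zero_smul _ _)

theorem eq_projSet (h : IsConeComponent Ω C) : Ω = projSet C := by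
  ext x
  induction x using Projectivization.ind with | h v hv => ?_
  rw [h.mk_mem_iff hv, mk_mem_projSet]
  constructor
  · rintro (h1 | h1)
    · exact ⟨1, one_ne_zero, by rwa [one_smul]⟩
    · exact ⟨-1, by norm_num, by rwa [neg_one_smul]⟩
  · rintro ⟨c, hc, h1⟩
    rcases lt_or_gt_of_ne hc with hc | hc
    · right
      have := h.smul_mem (-c)⁻¹ (inv_pos.2 (neg_pos.2 hc)) _ h1
      rwa [smul_smul, inv_neg, neg_mul, inv_mul_cancel₀ hc.ne, neg_one_smul] at this
    · left
      have := h.smul_mem c⁻¹ (inv_pos.2 hc) _ h1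
      rwa [smul_smul, inv_mul_cancel₀ hc.ne', one_smul] at this

/-- Preservation of orientation gives a path from `v` to its image in the cone over Ω. Such a path
cannot pass between the disjoint open sets `C` and `-C`. -/
theorem map_mem (h : IsConeComponent Ω C) {G : Type*} [Group G] {ρ : G →* SL(3, ℝ)}
    (hρ : IsStrictlyConvexHolonomy Ω ρ) (g : G) {v : Fin 3 → ℝ} (hv : v ∈ C) : ρ g • v ∈ C := by
  obtain ⟨γ, hγ⟩ := hρ.oriented g v (h.coneOver_eq ▸ Or.inl hv)
  rw [h.coneOver_eq] at hγ
  have hdisj : Disjoint C (-C) := Set.disjoint_left.2 fun w hw hw' =>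
    h.neg_notMem (subset_closure hw) (h.ne_zero hw) (subset_closure hw')
  have hsub : range γ ⊆ C := (isPreconnected_range γ.continuous).subset_left_of_subset_union
    h.isOpen h.isOpen.neg hdisj (by rintro _ ⟨t, rfl⟩; exact hγ t) ⟨v, ⟨0, γ.source⟩, hv⟩
  exact hsub ⟨1, γ.target⟩

end IsConeComponent

end

/-! ### Normalizing the signs of the eigenframe -/

noncomputable section

theorem tendsto_of_tendsto_coord (F : SL(3, ℝ)) {ι : Type*} {l : Filter ι} {u : ι → Fin 3 → ℝ}
    {w : Fin 3 → ℝ} (h : ∀ i, Tendsto (fun n => coord F i (u n)) l (𝓝 (coord F i w))) :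
    Tendsto u l (𝓝 w) := by
  have h1 : Tendsto (fun n => F⁻¹ • u n) l (𝓝 (F⁻¹ • w)) := tendsto_pi_nhds.2 h
  simpa using h1.const_smul F

theorem specialLinearGroup_ext_smul {g h : SL(3, ℝ)} (hgh : ∀ v : Fin 3 → ℝ, g • v = h • v) :
    g = h := by
  refine Subtype.ext (Matrix.ext_of_mulVec_single fun i => ?_)
  exact hgh (Pi.single i 1)

theorem IsEigenframe.exists_coord {A P : SL(3, ℝ)} (h : IsEigenframe A P) :
    ∃ t : Fin 3 → ℝ, t 1 < t 0 ∧ t 2 < t 1 ∧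
      ∀ i v, coord P i (A • v) = Real.exp (t i) * coord P i v := by
  obtain ⟨t₁, t₂, t₃, h1, h2, hA⟩ := h
  refine ⟨![t₁, t₂, t₃], h1, h2, fun i v => ?_⟩
  have h3 : A • v = P • (Matrix.diagonal ![Real.exp t₁, Real.exp t₂, Real.exp t₃]).mulVec
      (P⁻¹ • v) := by
    change _ = (P : Matrix (Fin 3) (Fin 3) ℝ).mulVec _
    rw [Matrix.mulVec_mulVec, ← hA, ← Matrix.mulVec_mulVec]
    change _ = A • P • P⁻¹ • v
    rw [smul_inv_smul]
  rw [coord_apply, h3, inv_smul_smul, Matrix.mulVec_diagonal, coord_apply]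
  fin_cases i <;> rfl

theorem exists_sign_frame (P : SL(3, ℝ)) {e : Fin 3 → ℝ} (he : ∀ i, e i * e i = 1)
    (hprod : e 0 * e 1 * e 2 = 1) : ∃ P' : SL(3, ℝ), (∀ i v, coord P' i v = e i * coord P i v) ∧
      (∀ i, frameVec P' i = e i • frameVec P i) ∧ ∀ s, bulge P' s = bulge P s := by
  have hdet : (Matrix.diagonal e).det = 1 := by
    rw [Matrix.det_diagonal, Fin.prod_univ_three, hprod]
  obtain ⟨D, hD⟩ : ∃ D : SL(3, ℝ), (D : Matrix (Fin 3) (Fin 3) ℝ) = Matrix.diagonal e :=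
    ⟨⟨_, hdet⟩, rfl⟩
  have hDD : D * D = 1 := by
    apply Subtype.ext
    change (D : Matrix (Fin 3) (Fin 3) ℝ) * (D : Matrix (Fin 3) (Fin 3) ℝ) = 1
    rw [hD, Matrix.diagonal_mul_diagonal, ← Matrix.diagonal_one]
    congr 1
    exact funext he
  have hinv : D⁻¹ = D := inv_eq_of_mul_eq_one_left hDD
  have hc : ∀ i v, coord (P * D) i v = e i * coord P i v := by
    intro i v
    rw [coord_apply, mul_inv_rev, mul_smul, hinv]
    change (D : Matrix (Fin 3) (Fin 3) ℝ).mulVec _ i = _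
    rw [hD, Matrix.mulVec_diagonal]
    rfl
  refine ⟨P * D, hc, fun i => coord_ext (P * D) fun j => ?_, fun s =>
    specialLinearGroup_ext_smul fun v => coord_ext (P * D) fun j => ?_⟩
  · rw [LinearMap.map_smul, hc j (frameVec P i), coord_frameVec, coord_frameVec, smul_eq_mul]
    split_ifs with hij
    · subst hij
      linear_combination -he j
    · simp
  · rw [coord_bulge, hc, hc, coord_bulge]
    ring

theorem mk_mem_axis_iff {Ω : Set RP2} {P : SL(3, ℝ)} {v : Fin 3 → ℝ} (hv : v ≠ 0) :
    (Projectivization.mk ℝ v hv : RP2) ∈ axis Ω P ↔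
      (Projectivization.mk ℝ v hv : RP2) ∈ Ω ∧ coord P 1 v = 0 := by
  have hcol : ∀ i, (fun j => P j i) = frameVec P i := fun i => by
    ext j
    change _ = (P : Matrix (Fin 3) (Fin 3) ℝ).mulVec (Pi.single i 1) j
    rw [Matrix.mulVec_single_one]
    rfl
  refine and_congr_right fun _ => ?_
  rw [Projectivization.submodule_mk, Submodule.span_singleton_le_iff_mem, hcol, hcol,
    Submodule.mem_span_pair]
  constructor
  · rintro ⟨a, b, rfl⟩
    simp [coord_frameVec]
  · intro h
    refine ⟨coord P 0 v, coord P 2 v, ?_⟩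
    conv_rhs => rw [eq_sum_frameVec P v, h]
    simp

namespace IsConeComponent

variable {Ω : Set RP2} {C : Set (Fin 3 → ℝ)} {P : SL(3, ℝ)}

theorem smul_mem_closure (h : IsConeComponent Ω C) {t : ℝ} (ht : 0 < t) {v : Fin 3 → ℝ}
    (hv : v ∈ closure C) : t • v ∈ closure C :=
  _root_.map_mem_closure (continuous_const_smul t) hv fun _ hx => h.smul_mem t ht _ hx

/-- The iterates of `A`, rescaled by the dominant eigenvalue, converge to the projection on its
eigenline and stay in `C`. -/
theorem axial_limit (h : IsConeComponent Ω C) {A : SL(3, ℝ)} (hA : ∀ v ∈ C, A • v ∈ C)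
    {t : Fin 3 → ℝ} (ht : ∀ i v, coord P i (A • v) = Real.exp (t i) * coord P i v) {j : Fin 3}
    (hj : ∀ i, i ≠ j → t i < t j) {v : Fin 3 → ℝ} (hv : v ∈ C) :
    coord P j v • frameVec P j ∈ closure C := by
  set B : (Fin 3 → ℝ) → Fin 3 → ℝ := fun w => Real.exp (-t j) • A • w with hB
  have hBC : ∀ n, B^[n] v ∈ C := by
    intro n
    induction n with
    | zero => exact hv
    | succ n ih =>
      rw [Function.iterate_succ_apply']
      exact h.smul_mem _ (Real.exp_pos _) _ (hA _ ih)
  have hBc : ∀ n i, coord P i (B^[n] v) = Real.exp (t i - t j) ^ n * coord P i v := by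
    intro n i
    induction n with
    | zero => simp
    | succ n ih =>
      rw [Function.iterate_succ_apply', hB]
      simp only
      rw [LinearMap.map_smul, ht, ← hB, ih, smul_eq_mul, pow_succ, sub_eq_add_neg, Real.exp_add]
      ring
  refine mem_closure_of_tendsto (f := fun n => B^[n] v) (b := atTop)
    (tendsto_of_tendsto_coord P fun i => ?_) (Eventually.of_forall hBC)
  simp only [hBc]
  rw [LinearMap.map_smul, coord_frameVec, smul_eq_mul]
  split_ifs with hij
  · subst hij
    simp
  · rw [mul_zero]
    have : Tendsto (fun n : ℕ => Real.exp (t i - t j) ^ n) atTop (𝓝 0) :=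
      tendsto_pow_atTop_nhds_zero_of_lt_one (Real.exp_pos _).le
        (Real.exp_lt_one_iff.2 (by linarith [hj i hij]))
    simpa using this.mul_const (coord P i v)

/-- If the coordinate vanished at a point of `C`, or took both signs, openness and `hlim` would put
both `frameVec P j` and its negative into the closed cone. That contradicts properness of the cone.
-/
theorem exists_coord_sign (h : IsConeComponent Ω C) {j : Fin 3}
    (hlim : ∀ v ∈ C, coord P j v • frameVec P j ∈ closure C) :
    ∃ ε : ℝ, ε * ε = 1 ∧ (∀ v ∈ C, 0 < ε * coord P j v) ∧ ε • frameVec P j ∈ closure C := by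
  have hf := frameVec_ne_zero P j
  have hpos : ∀ v ∈ C, 0 < coord P j v → frameVec P j ∈ closure C := fun v hv hp => by
    have := h.smul_mem_closure (inv_pos.2 hp) (hlim v hv)
    rwa [smul_smul, inv_mul_cancel₀ hp.ne', one_smul] at this
  have hneg : ∀ v ∈ C, coord P j v < 0 → -frameVec P j ∈ closure C := fun v hv hp => by
    have := h.smul_mem_closure (inv_pos.2 (neg_pos.2 hp)) (hlim v hv)
    rwa [smul_smul, inv_neg, neg_mul, inv_mul_cancel₀ hp.ne, neg_one_smul] at this
  have hne : ∀ v ∈ C, coord P j v ≠ 0 := by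
    intro v hv h0
    have key : ∀ c : ℝ, ∃ r : ℝ, 0 < r ∧ v + (r * c) • frameVec P j ∈ C := by
      intro c
      have hc : Tendsto (fun r : ℝ => v + (r * c) • frameVec P j) (𝓝[>] 0) (𝓝 v) := by
        have : Continuous fun r : ℝ => v + (r * c) • frameVec P j := by fun_prop
        have := this.tendsto 0
        rw [zero_mul, zero_smul, add_zero] at this
        exact this.mono_left nhdsWithin_le_nhds
      obtain ⟨r, hr, hr0⟩ := ((hc.eventually (h.isOpen.mem_nhds hv)).and
        self_mem_nhdsWithin).exists
      exact ⟨r, hr0, hr⟩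
    obtain ⟨r, hr, hrC⟩ := key 1
    obtain ⟨r', hr', hrC'⟩ := key (-1)
    refine h.neg_notMem (hpos _ hrC ?_) hf (hneg _ hrC' ?_)
    · simpa [h0] using hr
    · simpa [h0] using hr'
  obtain ⟨v₀, hv₀⟩ := h.nonempty
  rcases lt_or_gt_of_ne (hne v₀ hv₀) with h0 | h0
  · refine ⟨-1, by norm_num, fun v hv => ?_, by simpa using hneg v₀ hv₀ h0⟩
    rcases lt_or_gt_of_ne (hne v hv) with h1 | h1
    · linarith
    · exact absurd (hneg v₀ hv₀ h0) (h.neg_notMem (hpos v hv h1) hf)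
  · refine ⟨1, by norm_num, fun v hv => ?_, by simpa using hpos v₀ hv₀ h0⟩
    rcases lt_or_gt_of_ne (hne v hv) with h1 | h1
    · exact absurd (hneg v hv h1) (h.neg_notMem (hpos v₀ hv₀ h0) hf)
    · linarith

/-- A change of signs in the frame makes the axis and a given point positive. -/
theorem exists_normalized_frame (h : IsConeComponent Ω C) {G : Type*} [Group G]
    {ρ : G →* SL(3, ℝ)} (hρ : IsStrictlyConvexHolonomy Ω ρ) {γ : G}
    (hP : IsEigenframe (ρ γ) P) {x : RP2} (hx : x ∈ Ω \ axis Ω P) :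
    ∃ C' : Set (Fin 3 → ℝ), ∃ P' : SL(3, ℝ), IsConeComponent Ω C' ∧ axis Ω P' = axis Ω P ∧
      (∀ s, bulge P' s = bulge P s) ∧
      (∃ t : Fin 3 → ℝ, t 1 < t 0 ∧ t 2 < t 1 ∧
        ∀ i v, coord P' i (ρ γ • v) = Real.exp (t i) * coord P' i v) ∧
      (∀ v ∈ C', 0 < coord P' 0 v) ∧ (∀ v ∈ C', 0 < coord P' 2 v) ∧
      frameVec P' 0 ∈ closure C' ∧ frameVec P' 2 ∈ closure C' ∧
      ∃ y, ∃ hy : y ≠ 0, y ∈ C' ∧ 0 < coord P' 1 y ∧ (Projectivization.mk ℝ y hy : RP2) = x := by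
  obtain ⟨t, ht1, ht2, ht⟩ := hP.exists_coord
  obtain ⟨ε₀, he0, hC0, hf0⟩ := h.exists_coord_sign (P := P) (j := 0) fun v hv =>
    h.axial_limit (fun v hv => h.map_mem hρ γ hv) ht (by
      intro i hi
      fin_cases i
      exacts [absurd rfl hi, ht1, ht2.trans ht1]) hv
  have ht' : ∀ i v, coord P i (ρ γ⁻¹ • v) = Real.exp (-t i) * coord P i v := by
    intro i v
    have := ht i (ρ γ⁻¹ • v)
    rw [map_inv, smul_inv_smul] at this
    rw [this, map_inv, ← mul_assoc, ← Real.exp_add]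
    simp
  obtain ⟨ε₂, he2, hC2, hf2⟩ := h.exists_coord_sign (P := P) (j := 2) fun v hv =>
    h.axial_limit (fun v hv => h.map_mem hρ γ⁻¹ hv) ht' (by
      intro i hi
      fin_cases i
      exacts [neg_lt_neg (ht2.trans ht1), neg_lt_neg ht2, absurd rfl hi]) hv
  obtain ⟨hxΩ, hxa⟩ := hx
  rw [h.eq_projSet] at hxΩ
  obtain ⟨y, hy, hyC, rfl⟩ := hxΩ
  have hy1 : coord P 1 y ≠ 0 := fun h0 =>
    hxa ((mk_mem_axis_iff hy).2 ⟨(h.mk_mem_iff hy).2 (Or.inl hyC), h0⟩)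
  obtain ⟨ε₁, he1, hy1⟩ : ∃ ε : ℝ, ε * ε = 1 ∧ 0 < ε * coord P 1 y := by
    rcases lt_or_gt_of_ne hy1 with h1 | h1
    · exact ⟨-1, by norm_num, by linarith⟩
    · exact ⟨1, by norm_num, by linarith⟩
  -- A sign change keeps the frame in SL(3, ℝ) only if the signs have product 1. Multiplying each of
  -- them by π makes the product π⁴ = 1. When π = -1, the extra sign is absorbed by passing to `-C`.
  set π := ε₀ * ε₁ * ε₂ with hπ
  have hππ : π * π = 1 := by
    calc π * π = (ε₀ * ε₀) * (ε₁ * ε₁) * (ε₂ * ε₂) := by rw [hπ]; ring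
      _ = 1 := by rw [he0, he1, he2]; norm_num
  obtain ⟨P', hc', hf', hb'⟩ := exists_sign_frame P (e := ![π * ε₀, π * ε₁, π * ε₂]) (by
    intro i
    fin_cases i
    · change (π * ε₀) * (π * ε₀) = 1
      linear_combination hππ * (ε₀ * ε₀) + he0
    · change (π * ε₁) * (π * ε₁) = 1
      linear_combination hππ * (ε₁ * ε₁) + he1
    · change (π * ε₂) * (π * ε₂) = 1
      linear_combination hππ * (ε₂ * ε₂) + he2) (by
    change (π * ε₀) * (π * ε₁) * (π * ε₂) = 1
    have : (π * ε₀) * (π * ε₁) * (π * ε₂) = (π * π) * (π * π) := by rw [hπ]; ring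
    rw [this, hππ, one_mul])
  have c0 : ∀ v, coord P' 0 v = π * ε₀ * coord P 0 v := hc' 0
  have c1 : ∀ v, coord P' 1 v = π * ε₁ * coord P 1 v := hc' 1
  have c2 : ∀ v, coord P' 2 v = π * ε₂ * coord P 2 v := hc' 2
  have f0 : frameVec P' 0 = π • ε₀ • frameVec P 0 := (hf' 0).trans (mul_smul _ _ _)
  have f2 : frameVec P' 2 = π • ε₂ • frameVec P 2 := (hf' 2).trans (mul_smul _ _ _)
  have hax : axis Ω P' = axis Ω P := by
    ext x
    induction x using Projectivization.ind with | h v hv => ?_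
    rw [mk_mem_axis_iff, mk_mem_axis_iff, c1]
    refine and_congr_right fun _ => ?_
    have hne : π * ε₁ ≠ 0 := by
      intro h0
      rcases mul_eq_zero.1 h0 with h0 | h0
      · rw [h0] at hππ; norm_num at hππ
      · rw [h0] at he1; norm_num at he1
    simp [hne]
  have heig : ∃ t : Fin 3 → ℝ, t 1 < t 0 ∧ t 2 < t 1 ∧
        ∀ i v, coord P' i (ρ γ • v) = Real.exp (t i) * coord P' i v :=
    ⟨t, ht1, ht2, fun i v => by rw [hc', hc', ht]; ring⟩
  rcases mul_self_eq_one_iff.1 hππ with hp | hp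
  · refine ⟨C, P', h, hax, hb', heig, ?_, ?_, ?_, ?_, y, hy, hyC, ?_, rfl⟩
    · intro v hv; rw [c0, hp, one_mul]; exact hC0 v hv
    · intro v hv; rw [c2, hp, one_mul]; exact hC2 v hv
    · rw [f0, hp, one_smul]; exact hf0
    · rw [f2, hp, one_smul]; exact hf2
    · rw [c1, hp, one_mul]; exact hy1
  · refine ⟨-C, P', h.neg, hax, hb', heig, ?_, ?_, ?_, ?_, -y, neg_ne_zero.2 hy, ?_, ?_, ?_⟩
    · intro v hv
      have := hC0 _ hv
      rw [map_neg] at this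
      rw [c0, hp]; linarith
    · intro v hv
      have := hC2 _ hv
      rw [map_neg] at this
      rw [c2, hp]; linarith
    · rw [f0, hp, ← neg_closure, Set.mem_neg, neg_one_smul, neg_neg]; exact hf0
    · rw [f2, hp, ← neg_closure, Set.mem_neg, neg_one_smul, neg_neg]; exact hf2
    · rwa [Set.mem_neg, neg_neg]
    · rw [c1, hp, map_neg]; linarith
    · exact (mk_eq_mk_iff_smul _ _).2 ⟨-1, by norm_num, by simp⟩

end IsConeComponent

end

/-! ### Components of the complement of the lifts as convex cells -/

noncomputable section

theorem isCompact_projSet {S : Set (Fin 3 → ℝ)} (hS : IsCompact S) (h0 : ∀ v ∈ S, v ≠ 0) :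
    IsCompact (projSet S) := by
  have : projSet S = range fun v : S => (Projectivization.mk ℝ v.1 (h0 v v.2) : RP2) := by
    ext x
    constructor
    · rintro ⟨v, hv, hS, rfl⟩
      exact ⟨⟨v, hS⟩, rfl⟩
    · rintro ⟨v, rfl⟩
      exact ⟨v, h0 v v.2, v.2, rfl⟩
  rw [this]
  have : CompactSpace S := isCompact_iff_compactSpace.1 hS
  exact isCompact_range (continuous_mk_comp continuous_subtype_val fun v => h0 v v.2)

/-- The points of `C` on the same side of every wall as `x`. -/
def cell {G : Type*} [Group G] (C : Set (Fin 3 → ℝ)) (ρ : G →* SL(3, ℝ)) (P : SL(3, ℝ))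
    (x : Fin 3 → ℝ) : Set (Fin 3 → ℝ) :=
  {y ∈ C | ∀ g : G, 0 < coord (ρ g * P) 1 x * coord (ρ g * P) 1 y}

section cell

variable {G : Type*} [Group G] {C : Set (Fin 3 → ℝ)} {ρ : G →* SL(3, ℝ)} {P : SL(3, ℝ)}

theorem cell_eq_of_mem {x y : Fin 3 → ℝ} (hy : y ∈ cell C ρ P x) :
    cell C ρ P y = cell C ρ P x := by
  ext z
  refine and_congr_right fun _ => forall_congr' fun g => ⟨fun h => ?_, fun h => ?_⟩
  · exact pos_of_mul_pos_of_mul_pos (by rw [mul_comm]; exact hy.2 g) h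
  · exact pos_of_mul_pos_of_mul_pos (hy.2 g) h

theorem coord_mul_map_smul (k g : G) (v : Fin 3 → ℝ) :
    coord (ρ k * P) 1 (ρ g • v) = coord (ρ (g⁻¹ * k) * P) 1 v := by
  rw [← coord_mul_smul (ρ g) (ρ (g⁻¹ * k) * P), ← mul_assoc, ← map_mul, mul_inv_cancel_left]

theorem smul_cell (hC : ∀ g : G, ∀ v ∈ C, ρ g • v ∈ C) (g : G) (x : Fin 3 → ℝ) :
    ρ g • cell C ρ P x = cell C ρ P (ρ g • x) := by
  have key : ∀ (g : G) (x y : Fin 3 → ℝ), y ∈ cell C ρ P x → ρ g • y ∈ cell C ρ P (ρ g • x) := by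
    intro g x y hy
    refine ⟨hC g y hy.1, fun k => ?_⟩
    rw [coord_mul_map_smul, coord_mul_map_smul]
    exact hy.2 _
  ext y
  rw [mem_smul_set_iff_inv_smul_mem]
  constructor
  · intro h
    simpa using key g x _ h
  · intro h
    have := key g⁻¹ _ _ h
    rwa [map_inv, inv_smul_smul] at this

/-- The point `x` is weakly on the same side of every wall as the axis, and strictly for walls other
than the axis. Its cell is thus described by the sign conditions of a piece. -/
theorem WallSystem.cell_eq_piece (W : WallSystem C ρ P) {x : Fin 3 → ℝ}
    (h0 : ∀ g : G, coord (ρ g * P) 1 x ≠ 0)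
    (hs : ∀ p ∈ C, coord P 1 p = 0 → ∀ g : G, 0 ≤ coord (ρ g * P) 1 x * coord (ρ g * P) 1 p)
    {σ : ℝ} (hσ : 0 < σ * coord P 1 x) : cell C ρ P x = WallSystem.piece C ρ P σ := by
  have hp0 := W.axisPt_mem one_pos one_pos
  have hp : ∀ g : G, ¬ WallSystem.Aligned ρ P g →
      0 < coord (ρ g * P) 1 x * coord (ρ g * P) 1 (WallSystem.axisPt P 1 1) := by
    intro g hg
    refine lt_of_le_of_ne (hs _ hp0 (WallSystem.coord_axisPt _ _ _ _) g) (Ne.symm ?_)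
    exact mul_ne_zero (h0 g) fun h => hg (W.aligned_of_axisPt one_pos one_pos h)
  have e1 : ∀ v, coord (ρ (1 : G) * P) 1 v = coord P 1 v := fun v => by rw [map_one, one_mul]
  ext y
  constructor
  · rintro ⟨hy, h⟩
    refine ⟨hy, ?_, fun g hg => pos_of_mul_pos_of_mul_pos (hp g hg) (h g)⟩
    have := h 1
    rw [e1, e1] at this
    exact pos_of_mul_pos_of_mul_pos (by rwa [mul_comm] at hσ) this
  · rintro ⟨hy, h1, h⟩
    refine ⟨hy, fun g => ?_⟩
    by_cases hg : WallSystem.Aligned ρ P g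
    · obtain ⟨k, hk, hkv⟩ := hg 1
      rw [hkv, hkv]
      have := mul_pos (mul_pos hk hk) (pos_of_mul_pos_of_mul_pos hσ h1)
      linarith
    · exact pos_of_mul_pos_of_mul_pos (by rw [mul_comm]; exact hp g hg) (h g hg)

end cell

namespace IsConeComponent

variable {Ω : Set RP2} {C : Set (Fin 3 → ℝ)} {G : Type*} [Group G] {ρ : G →* SL(3, ℝ)}
  {P : SL(3, ℝ)}

theorem mk_mem_lifts_iff (h : IsConeComponent Ω C) (hρ : IsStrictlyConvexHolonomy Ω ρ)
    {v : Fin 3 → ℝ} (hv : v ∈ C) :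
    (Projectivization.mk ℝ v (h.ne_zero hv) : RP2) ∈ lifts Ω ρ P ↔
      ∃ g : G, coord (ρ g * P) 1 v = 0 := by
  rw [lifts, mem_iUnion]
  refine exists_congr fun g => ?_
  rw [mem_smul_set_iff_inv_smul_mem, coord_mul]
  have hv' : ρ g⁻¹ • v ∈ C := h.map_mem hρ _ hv
  change (Projectivization.mk ℝ ((ρ g)⁻¹ • v) (smul_vec_ne_zero _ (h.ne_zero hv)) : RP2) ∈ _ ↔ _
  rw [mk_mem_axis_iff, h.mk_mem_iff, and_iff_right]
  rw [map_inv] at hv'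
  exact Or.inl hv'

/-- A multiple of `v` that lies in `C` is a positive multiple, so no information is lost in the
projective plane. -/
theorem mk_mem_projSet_iff (h : IsConeComponent Ω C) {S : Set (Fin 3 → ℝ)} (hS : S ⊆ C)
    (hcone : ∀ t : ℝ, 0 < t → ∀ v ∈ S, t • v ∈ S) {v : Fin 3 → ℝ} (hv : v ∈ C) :
    (Projectivization.mk ℝ v (h.ne_zero hv) : RP2) ∈ projSet S ↔ v ∈ S := by
  rw [mk_mem_projSet]
  constructor
  · rintro ⟨c, -, hcv⟩
    have hc := h.pos_of_smul_mem hv (hS hcv)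
    have := hcone c⁻¹ (inv_pos.2 hc) _ hcv
    rwa [smul_smul, inv_mul_cancel₀ hc.ne', one_smul] at this
  · exact fun hvS => ⟨1, one_ne_zero, by rwa [one_smul]⟩

theorem smul_mem_cell (h : IsConeComponent Ω C) {x : Fin 3 → ℝ} {t : ℝ} (ht : 0 < t)
    {v : Fin 3 → ℝ} (hv : v ∈ cell C ρ P x) : t • v ∈ cell C ρ P x := by
  refine ⟨h.smul_mem t ht v hv.1, fun g => ?_⟩
  rw [LinearMap.map_smul, smul_eq_mul, mul_left_comm]
  exact mul_pos ht (hv.2 g)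

/-- Each wall divides its complement into two open sets, so a connected set stays on one side of it.
Conversely, points on the same sides of all walls are joined by a segment that crosses none. -/
theorem connectedComponentIn_eq (h : IsConeComponent Ω C) (hρ : IsStrictlyConvexHolonomy Ω ρ)
    {x : Fin 3 → ℝ} (hx : x ∈ C) (h0 : ∀ g : G, coord (ρ g * P) 1 x ≠ 0) :
    connectedComponentIn (Ω \ lifts Ω ρ P) (Projectivization.mk ℝ x (h.ne_zero hx)) =
      projSet (cell C ρ P x) := by
  have hD : ∀ v (hv : v ∈ C), (Projectivization.mk ℝ v (h.ne_zero hv) : RP2) ∈ Ω \ lifts Ω ρ P ↔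
      ∀ g : G, coord (ρ g * P) 1 v ≠ 0 := by
    intro v hv
    rw [Set.mem_sdiff, h.mk_mem_lifts_iff hρ hv, not_exists, and_iff_right]
    exact (h.mk_mem_iff _).2 (Or.inl hv)
  have hxD := (hD x hx).2 h0
  refine Subset.antisymm ?_ ?_
  · intro z hz
    have hzD := connectedComponentIn_subset _ _ hz
    have hzΩ := hzD.1
    rw [h.eq_projSet] at hzΩ
    obtain ⟨y, hy0, hy, rfl⟩ := hzΩ
    refine ⟨y, hy0, ⟨hy, fun g => ?_⟩, rfl⟩
    set f := coord (ρ g * P) 1 with hf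
    have hfc : Continuous f := continuous_coord _ _
    set S₁ : Set (Fin 3 → ℝ) := {v ∈ C | 0 < f x * f v} with hS₁
    set S₂ : Set (Fin 3 → ℝ) := {v ∈ C | f x * f v < 0} with hS₂
    have hc₁ : ∀ t : ℝ, 0 < t → ∀ v ∈ S₁, t • v ∈ S₁ := fun t ht v hv => by
      refine ⟨h.smul_mem t ht v hv.1, ?_⟩
      rw [LinearMap.map_smul, smul_eq_mul, mul_left_comm]
      exact mul_pos ht hv.2
    have ho₁ : IsOpen (projSet S₁) := isOpen_projSet
      (h.isOpen.inter (isOpen_lt continuous_const (continuous_const.mul hfc)))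
    have ho₂ : IsOpen (projSet S₂) := isOpen_projSet
      (h.isOpen.inter (isOpen_lt (continuous_const.mul hfc) continuous_const))
    have hdisj : Disjoint (projSet S₁) (projSet S₂) := by
      refine Set.disjoint_left.2 ?_
      rintro _ h₁ ⟨v, hv0, hv, rfl⟩
      have := (h.mk_mem_projSet_iff (sep_subset _ _) hc₁ hv.1).1 h₁
      exact lt_asymm this.2 hv.2
    have hsub : connectedComponentIn (Ω \ lifts Ω ρ P) (Projectivization.mk ℝ x (h.ne_zero hx)) ⊆
        projSet S₁ := by
      refine isPreconnected_connectedComponentIn.subset_left_of_subset_union ho₁ ho₂ hdisj ?_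
        ⟨_, mem_connectedComponentIn hxD, ⟨x, _, ⟨hx, mul_self_pos.2 (h0 g)⟩, rfl⟩⟩
      intro w hw
      have hwD := connectedComponentIn_subset _ _ hw
      have hwΩ := hwD.1
      rw [h.eq_projSet] at hwΩ
      obtain ⟨v, hv0, hv, rfl⟩ := hwΩ
      rcases lt_or_gt_of_ne (mul_ne_zero (h0 g) ((hD v hv).1 hwD g)) with h1 | h1
      · exact Or.inr ⟨v, hv0, ⟨hv, h1⟩, rfl⟩
      · exact Or.inl ⟨v, hv0, ⟨hv, h1⟩, rfl⟩
    exact ((h.mk_mem_projSet_iff (sep_subset _ _) hc₁ hy).1 (hsub hz)).2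
  · rintro _ ⟨y, hy0, ⟨hy, hs⟩, rfl⟩
    have hseg : ∀ v ∈ segment ℝ x y, v ∈ C ∧ ∀ g : G, coord (ρ g * P) 1 v ≠ 0 := by
      intro v hv
      refine ⟨h.convex.segment_subset hx hy hv, fun g hg => ?_⟩
      obtain ⟨a, b, ha, hb, hab, rfl⟩ := hv
      rw [map_add, LinearMap.map_smul, LinearMap.map_smul, smul_eq_mul, smul_eq_mul] at hg
      have h1 := hs g
      have h2 := mul_self_pos.2 (h0 g)
      have h3 : a * (coord (ρ g * P) 1 x * coord (ρ g * P) 1 x) +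
          b * (coord (ρ g * P) 1 x * coord (ρ g * P) 1 y) = 0 := by
        linear_combination coord (ρ g * P) 1 x * hg
      have ha' := mul_nonneg ha h2.le
      have hb' := mul_nonneg hb h1.le
      have ea : a = 0 := (mul_eq_zero.1 (le_antisymm (by linarith) ha')).resolve_right h2.ne'
      have eb : b = 0 := (mul_eq_zero.1 (le_antisymm (by linarith) hb')).resolve_right h1.ne'
      linarith
    have hpre : IsPreconnected (range fun v : segment ℝ x y =>
        (Projectivization.mk ℝ v.1 (h.ne_zero (hseg v v.2).1) : RP2)) := by
      have : PreconnectedSpace (segment ℝ x y) :=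
        isPreconnected_iff_preconnectedSpace.1 (convex_segment x y).isPreconnected
      exact isPreconnected_range
        (continuous_mk_comp continuous_subtype_val fun v => h.ne_zero (hseg v v.2).1)
    refine hpre.subset_connectedComponentIn ⟨⟨x, left_mem_segment ℝ x y⟩, rfl⟩ ?_
      ⟨⟨y, right_mem_segment ℝ x y⟩, rfl⟩
    rintro _ ⟨v, rfl⟩
    exact (hD v (hseg v v.2).1).2 (hseg v v.2).2

theorem mem_closure_of_mk_mem_closure (h : IsConeComponent Ω C) {S : Set (Fin 3 → ℝ)} (hS : S ⊆ C)
    (hcone : ∀ t : ℝ, 0 < t → ∀ v ∈ S, t • v ∈ S) {p : Fin 3 → ℝ} (hp : p ∈ C)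
    (hcl : (Projectivization.mk ℝ p (h.ne_zero hp) : RP2) ∈ closure (projSet S)) :
    p ∈ closure S := by
  rw [mem_closure_iff] at hcl ⊢
  intro N hN hpN
  obtain ⟨z, ⟨v, hv0, hv, rfl⟩, hz⟩ := hcl (projSet (N ∩ C)) (isOpen_projSet (hN.inter h.isOpen))
    ⟨p, _, ⟨hpN, hp⟩, rfl⟩
  exact ⟨v, hv.1, (h.mk_mem_projSet_iff hS hcone hv.2).1 hz⟩

theorem sign_of_axis_subset_closure (h : IsConeComponent Ω C) {x : Fin 3 → ℝ}
    (hax : axis Ω P ⊆ closure (projSet (cell C ρ P x))) {p : Fin 3 → ℝ} (hp : p ∈ C)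
    (hp1 : coord P 1 p = 0) (g : G) : 0 ≤ coord (ρ g * P) 1 x * coord (ρ g * P) 1 p := by
  have hcl := h.mem_closure_of_mk_mem_closure (sep_subset _ _)
    (fun t ht v hv => h.smul_mem_cell (ρ := ρ) (P := P) (x := x) ht hv) hp
    (hax ((mk_mem_axis_iff (h.ne_zero hp)).2 ⟨(h.mk_mem_iff _).2 (Or.inl hp), hp1⟩))
  exact closure_minimal (fun v hv => (hv.2 g).le)
    (isClosed_le continuous_const (continuous_const.mul (continuous_coord (ρ g * P) 1))) hcl

/-- Noncrossing comes from a component that has the whole axis in its closure: the functional of any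
wall has a weakly constant sign on the axis. -/
theorem wallSystem (h : IsConeComponent Ω C) (hρ : IsStrictlyConvexHolonomy Ω ρ) {γ : G}
    {t : Fin 3 → ℝ} (ht1 : t 1 < t 0) (ht2 : t 2 < t 1)
    (ht : ∀ i v, coord P i (ρ γ • v) = Real.exp (t i) * coord P i v)
    (hC0 : ∀ v ∈ C, 0 < coord P 0 v) (hC2 : ∀ v ∈ C, 0 < coord P 2 v)
    (hf0 : frameVec P 0 ∈ closure C) (hf2 : frameVec P 2 ∈ closure C) {x : Fin 3 → ℝ}
    (h0 : ∀ g : G, coord (ρ g * P) 1 x ≠ 0)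
    (hs : ∀ p ∈ C, coord P 1 p = 0 → ∀ g : G, 0 ≤ coord (ρ g * P) 1 x * coord (ρ g * P) 1 p) :
    WallSystem C ρ P where
  isOpen := h.isOpen
  convex := h.convex
  smul_mem := h.smul_mem
  exists_pos := h.exists_pos
  add_mem := h.add_mem
  map_mem := fun g _ hv => h.map_mem hρ g hv
  coord_zero_pos := hC0
  coord_two_pos := hC2
  frameVec_zero_mem := hf0
  frameVec_two_mem := hf2
  free g v hv r hr hgv := by
    refine hρ.free g (Projectivization.mk ℝ v (h.ne_zero hv))
      ((h.mk_mem_iff _).2 (Or.inl hv)) ?_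
    exact (mk_eq_mk_iff_smul (smul_vec_ne_zero _ (h.ne_zero hv)) _).2 ⟨r, hr.ne', hgv⟩
  proper S hS hSc := by
    have hK := isCompact_projSet hSc fun v hv => h.ne_zero (hS hv)
    refine (hρ.properlyDiscontinuous (projSet S) ?_ hK).subset ?_
    · rw [h.eq_projSet]
      exact projSet_mono hS
    · rintro g ⟨v, hv, w, hw, r, hr, hgv⟩
      have hv0 := h.ne_zero (hS hv)
      have hw0 := h.ne_zero (hS hw)
      refine ⟨Projectivization.mk ℝ w hw0, ⟨Projectivization.mk ℝ v hv0, ⟨v, hv0, hv, rfl⟩, ?_⟩,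
        ⟨w, hw0, hw, rfl⟩⟩
      exact (mk_eq_mk_iff_smul (smul_vec_ne_zero _ hv0) _).2 ⟨r, hr.ne', hgv⟩
  noncrossing g a c ha hc hac := by
    set X := coord (ρ g * P) 1 with hX
    have hind : LinearIndependent ℝ ![frameVec P 0, frameVec P 2] := by
      rw [LinearIndependent.pair_iff]
      intro r r' hr
      have e0 := congrArg (coord P 0) hr
      have e2 := congrArg (coord P 2) hr
      simp [coord_frameVec] at e0 e2
      exact ⟨e0, e2⟩
    have hmem : ∀ a c : ℝ, 0 < a → 0 < c → a • frameVec P 0 + c • frameVec P 2 ∈ C := by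
      intro a c ha hc
      refine h.add_mem _ (h.smul_mem_closure ha hf0) _ (h.smul_mem_closure hc hf2) ?_
      rw [LinearIndependent.pair_iff] at hind ⊢
      intro r r' hr
      rw [smul_smul, smul_smul] at hr
      obtain ⟨e1, e2⟩ := hind _ _ hr
      exact ⟨(mul_eq_zero.1 e1).resolve_right ha.ne', (mul_eq_zero.1 e2).resolve_right hc.ne'⟩
    have hnn : ∀ a c : ℝ, 0 < a → 0 < c →
        0 ≤ X x * (a * X (frameVec P 0) + c * X (frameVec P 2)) := by
      intro a c ha hc
      have := hs _ (hmem a c ha hc) (by simp [coord_frameVec]) g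
      rw [map_add, LinearMap.map_smul, LinearMap.map_smul] at this
      exact this
    rw [map_add, LinearMap.map_smul, LinearMap.map_smul, smul_eq_mul, smul_eq_mul] at hac
    have hx := h0 g
    -- The functional is zero at (a, c), so its values at (2a, c) and (a, 2c) are the two separate
    -- terms. Both have the weak sign and their sum is zero, so both vanish.
    have k1 := hnn (2 * a) c (by positivity) hc
    have k2 := hnn a (2 * c) ha (by positivity)
    have l1 : 0 ≤ X x * (a * X (frameVec P 0)) := by
      have : 2 * a * X (frameVec P 0) + c * X (frameVec P 2) = a * X (frameVec P 0) := by
        linarith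
      rwa [this] at k1
    have l2 : 0 ≤ X x * (c * X (frameVec P 2)) := by
      have : a * X (frameVec P 0) + 2 * c * X (frameVec P 2) = c * X (frameVec P 2) := by
        linarith
      rwa [this] at k2
    have l3 : X x * (a * X (frameVec P 0)) + X x * (c * X (frameVec P 2)) = 0 := by
      rw [← mul_add, hac, mul_zero]
    have m1 : X x * (a * X (frameVec P 0)) = 0 := by linarith
    have m2 : X x * (c * X (frameVec P 2)) = 0 := by linarith
    exact ⟨((mul_eq_zero.1 ((mul_eq_zero.1 m1).resolve_left hx)).resolve_left ha.ne'),
      ((mul_eq_zero.1 ((mul_eq_zero.1 m2).resolve_left hx)).resolve_left hc.ne')⟩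
  exists_axial := ⟨γ, t, ht1, ht2, ht⟩

end IsConeComponent

theorem bulgedDomain_eq_projSet {Ω : Set RP2} {C : Set (Fin 3 → ℝ)} (h : IsConeComponent Ω C)
    {G : Type*} [Group G] {ρ : G →* SL(3, ℝ)} {P : SL(3, ℝ)} (s : ℝ) (ρ' : G →* SL(3, ℝ)) :
    bulgedDomain Ω P (projSet (WallSystem.piece C ρ P (-1))) (projSet (WallSystem.piece C ρ P 1))
      s ρ' = projSet (WallSystem.bulgedCone C ρ P s ρ') := by
  have hax : axis Ω P = projSet {v ∈ C | coord P 1 v = 0} := by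
    ext x
    constructor
    · intro hx
      have hxΩ := hx.1
      rw [h.eq_projSet] at hxΩ
      obtain ⟨v, hv0, hv, rfl⟩ := hxΩ
      exact ⟨v, hv0, ⟨hv, ((mk_mem_axis_iff hv0).1 hx).2⟩, rfl⟩
    · rintro ⟨v, hv0, hv, rfl⟩
      exact (mk_mem_axis_iff hv0).2 ⟨(h.mk_mem_iff hv0).2 (Or.inl hv.1), hv.2⟩
  rw [bulgedDomain, WallSystem.bulgedCone, projSet_iUnion, hax]
  simp only [WallSystem.bulgedPiece, projSet_smul, projSet_union]

/-- Group elements permute the cells, so an element that moves one point of a cell into another cell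
moves the whole cell onto it. -/
theorem isConeBulging_of_isBulging {Ω : Set RP2} {C : Set (Fin 3 → ℝ)} (h : IsConeComponent Ω C)
    {G : Type*} [Group G] {ρ : G →* SL(3, ℝ)} (hρ : IsStrictlyConvexHolonomy Ω ρ) {P : SL(3, ℝ)}
    {x₁ x₂ : Fin 3 → ℝ} (e₁ : cell C ρ P x₁ = WallSystem.piece C ρ P (-1))
    (e₂ : cell C ρ P x₂ = WallSystem.piece C ρ P 1) {s : ℝ} {ρ' : G →* SL(3, ℝ)}
    (hb : IsBulging ρ P (projSet (cell C ρ P x₁)) (projSet (cell C ρ P x₂)) s ρ') :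
    WallSystem.IsConeBulging C ρ P s ρ' := by
  have key : ∀ (g : G) (a b y : Fin 3 → ℝ), y ∈ cell C ρ P a → ρ g • y ∈ cell C ρ P b →
      ρ g • projSet (cell C ρ P a) = projSet (cell C ρ P b) := by
    intro g a b y ha hgb
    rw [← projSet_smul, ← cell_eq_of_mem ha, smul_cell (fun g v hv => h.map_mem hρ g hv),
      cell_eq_of_mem hgb]
  constructor
  · rw [← e₁]
    exact fun g y hy hgy => hb.left g (key g _ _ y hy hgy)
  · rw [← e₂]
    exact fun g y hy hgy => hb.right g (key g _ _ y hy hgy)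
  · rw [← e₁, ← e₂]
    exact fun g y hy hgy => hb.stable g (key g _ _ y hy hgy)

end

/-! ### Reduction of the theorem to the wall system -/

theorem mainTheorem4 {G : Type*} [Group G] (Ω : Set RP2) (ρ₀ : G →* SL(3, ℝ))
    (hρ₀ : IsStrictlyConvexHolonomy Ω ρ₀)
    (γ : G) (c : ℝ → RP2) (hc : IsLiftOfSimpleClosedCurve Ω ρ₀ γ c)
    (P : SL(3, ℝ)) (hP : IsEigenframe (ρ₀ γ) P)
    (K₁ K₂ : Set RP2) (hK₁ : IsAdjacentPiece Ω ρ₀ P K₁) (hK₂ : IsAdjacentPiece Ω ρ₀ P K₂)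
    (hK : K₁ ≠ K₂)
    (ρ : ℝ → G →* SL(3, ℝ)) (hρ : ∀ s, IsBulging ρ₀ P K₁ K₂ s (ρ s)) :
    Tendsto (fun s => hilbertArea (bulgedDomain Ω P K₁ K₂ s (ρ s)) (ρ s)) atTop (𝓝 ⊤) := by
  obtain ⟨C₀, h₀⟩ := hρ₀.strictlyConvex.exists_isConeComponent
  obtain ⟨⟨z₁, hz₁, rfl⟩, hax₁⟩ := hK₁
  obtain ⟨⟨z₂, hz₂, rfl⟩, hax₂⟩ := hK₂
  have hz₂' : z₂ ∈ Ω \ axis Ω P := by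
    refine ⟨hz₂.1, fun hz => hz₂.2 (mem_iUnion.2 ⟨1, ?_⟩)⟩
    rwa [map_one, one_smul]
  -- The new frame `Q` has the same axis and the same bulging matrices, and it places K₂ on the
  -- positive side.
  obtain ⟨C, Q, h, hax, hbulge, ⟨t, ht1, ht2, ht⟩, hC0, hC2, hf0, hf2, x₂, hx₂0, hx₂, hpos, rfl⟩ :=
    h₀.exists_normalized_frame hρ₀ hP hz₂'
  have hl : lifts Ω ρ₀ P = lifts Ω ρ₀ Q := by
    unfold lifts
    rw [hax]
  have hdom : ∀ K₁ K₂ s ρ', bulgedDomain Ω P K₁ K₂ s ρ' = bulgedDomain (G := G) Ω Q K₁ K₂ s ρ' := by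
    intro K₁ K₂ s ρ'
    unfold bulgedDomain
    rw [hax, hbulge]
  have hb : ∀ K₁ K₂ s ρ', IsBulging ρ₀ P K₁ K₂ s ρ' → IsBulging ρ₀ Q K₁ K₂ s ρ' := by
    rintro K₁ K₂ s ρ' ⟨hb1, hb2, hb3⟩
    exact ⟨hb1, by simpa only [hbulge] using hb2, by simpa only [hbulge] using hb3⟩
  simp only [hdom]
  rw [← hax] at hax₁ hax₂
  simp only [hl] at hz₁ hz₂ hax₁ hax₂ hK hρ ⊢
  obtain ⟨x₁, hx₁0, hx₁, rfl⟩ : z₁ ∈ projSet C := h.eq_projSet ▸ hz₁.1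
  have hw₁ : ∀ g : G, coord (ρ₀ g * Q) 1 x₁ ≠ 0 := fun g hg =>
    hz₁.2 ((h.mk_mem_lifts_iff hρ₀ hx₁).2 ⟨g, hg⟩)
  have hw₂ : ∀ g : G, coord (ρ₀ g * Q) 1 x₂ ≠ 0 := fun g hg =>
    hz₂.2 ((h.mk_mem_lifts_iff hρ₀ hx₂).2 ⟨g, hg⟩)
  simp only [h.connectedComponentIn_eq hρ₀ hx₁ hw₁, h.connectedComponentIn_eq hρ₀ hx₂ hw₂]
    at hax₁ hax₂ hK hρ ⊢
  have hs₁ := fun p (hp : p ∈ C) hp1 => h.sign_of_axis_subset_closure (ρ := ρ₀) hax₁ hp hp1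
  have hs₂ := fun p (hp : p ∈ C) hp1 => h.sign_of_axis_subset_closure (ρ := ρ₀) hax₂ hp hp1
  have W : WallSystem C ρ₀ Q := h.wallSystem hρ₀ ht1 ht2 ht hC0 hC2 hf0 hf2 hw₂ hs₂
  have e₂ : cell C ρ₀ Q x₂ = WallSystem.piece C ρ₀ Q 1 :=
    W.cell_eq_piece hw₂ hs₂ (by rwa [one_mul])
  -- If K₁ were also on the positive side, it would be the same piece as K₂.
  have e₁ : cell C ρ₀ Q x₁ = WallSystem.piece C ρ₀ Q (-1) := by
    refine W.cell_eq_piece hw₁ hs₁ ?_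
    by_contra hn
    have h1 : coord Q 1 x₁ ≠ 0 := by simpa using hw₁ 1
    have h2 : 0 < 1 * coord Q 1 x₁ := by
      rcases lt_or_gt_of_ne h1 with h1 | h1 <;> linarith
    exact hK (by rw [e₂, W.cell_eq_piece hw₁ hs₁ h2])
  have hcb : ∀ s, WallSystem.IsConeBulging C ρ₀ Q s (ρ s) := fun s =>
    isConeBulging_of_isBulging h hρ₀ e₁ e₂ (hb _ _ _ _ (hρ s))
  simp only [e₁, e₂, bulgedDomain_eq_projSet h]
  exact W.tendsto_hilbertArea hcb
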